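/- **Setting.** Let $(W,S)$ be a Coxeter system with $S$ finite, $k$ a noetherian integral domain, and $V$ a free $k$-module of finite rank with a $k$-linear action of $W$, together with $\alpha_s\in V$ and $\alpha_s^\vee\in V^*=\mathrm{Hom}_k(V,k)$ for $s\in S$ such that $\langle\alpha_s^\vee,\alpha_s\rangle=2$, $s(v)=v-\langle\alpha_s^\vee,v\rangle\alpha_s$ for $v\in V$, $\alpha_s^\vee\colon V\to k$ is surjective and $\alpha_s\neq0$. Assume moreover that $\alpha_s\colon V^*\to k$, $f\mapsto f(\alpha_s)$, is surjective for every $s\in S$ (this is automatic if $k$ is a field or if $2\in k^\times$). Let $R=S(V)$, graded by $\deg V=2$, with the induced action of $W$, and let $Q$ be its fraction field. For a reflection $t=usu^{-1}$ ($u\in W$, $s\in S$) put $\alpha_t=u(\alpha_s)$, which is well defined up to a unit of $k$. The grading shift is $M(n)^i=M^{n+i}$. **Bimodules.** $\mathcal C'$ is the category of graded $R$-bimodules $M$ (that is, graded $R\otimes_kR$-modules) with a decomposition $M_Q:=M\otimes_RQ=\bigoplus_{w\in W}M_Q^w$ into $(R,Q)$-sub-bimodules, only finitely many of them nonzero, such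 that $mf=w(f)m$ for $m\in M_Q^w$, $f\in R$; morphisms are the degree-zero bimodule homomorphisms $M\to N$ for which the induced map sends $M_Q^w$ into $N_Q^w$ for all $w$. $\mathcal C\subset\mathcal C'$ is the full subcategory of objects that are finitely generated as bimodules and flat as right $R$-modules. For $M,N\in\mathcal C$, $M\otimes N=M\otimes_RN$ with $(M\otimes N)_Q^w=\bigoplus_{xy=w}M_Q^x\otimes_QN_Q^y$; the unit object $R_e$ is $R$ with $(R_e)_Q^e=Q$ and $(R_e)_Q^w=0$ for $w\ne e$. For $s\in S$, $B_s=R\otimes_{R^s}R(1)$ with the unique decomposition supported on $\{e,s\}$. $\mathcal S\mathrm{bimod}$ is the full subcategory of $\mathcal C$ of the direct summands of finite direct sums of objects $B_{s_1}\otimes\cdots\otimes B_{s_l}(n)$ with $l\ge0$, $s_1,\dots,s_l\in S$, $n\in\mathbb Z$ (for $l=0$ the product is $R_e$). **Modules over the structure algebra.** Let $$\mathcal Z=\Bigl\{(z_w)\in\prod_{w\in W}R\;\Big|\;z_{tw}\equiv z_w\!\!\pmod{\alpha_t}\text{ for all }w\in W\text{ and all reflections }t\Bigr\},$$ the structure algebra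 of the Bruhat moment graph, and for $s\in S$ let $\mathcal Z^s=\{(z_w)\in\mathcal Z\mid z_{ws}=z_w\text{ for all }w\}$. A graded $\mathcal Z$-module is a $\mathcal Z$-module $M=\bigoplus_{i\in\mathbb Z}M^i$ such that every $z\in\mathcal Z$ all of whose components lie in $R^d$ maps $M^i$ to $M^{i+d}$. Let $\mathcal Z\text{-}\mathrm{Mod}^f$ be the category of graded $\mathcal Z$-modules, with degree-zero $\mathcal Z$-linear maps, on which the action of $\mathcal Z$ factors through the restriction $\mathcal Z\to\prod_{w\in I}R$ for some finite $I\subset W$. Let $R(e)$ be $R$ with $(z_w)f=z_ef$, and let $\mathcal Z\text{-}\mathrm{Mod}^{\mathrm S}\subset\mathcal Z\text{-}\mathrm{Mod}^f$ be the full subcategory of direct summands of finite direct sums of the modules $\mathcal Z\otimes_{\mathcal Z^{s_1}}\cdots\mathcal Z\otimes_{\mathcal Z^{s_l}}R(e)(n)$ with $l\ge0$, $s_1,\dots,s_l\in S$, $n\in\mathbb Z$. **The functor.** $F$ sends a graded $\mathcal Z$-module $M$ to the graded $R$-bimodule $M$ on which $f\in R$ acts from the left by the constant family $(f)_w\in\mathcal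 Z$ and from the right by $(w(f))_w\in\mathcal Z$, with $M_Q^x=\{m\in M_Q\mid zm=z_xm\text{ for all }z=(z_w)\in\mathcal Z\}$, and is the identity on underlying maps. **Theorem.** Assume the GKM condition: $\alpha_{t_1},\alpha_{t_2}$ are linearly independent over $k$ for any two distinct reflections $t_1\neq t_2$. Then $F$ is a functor $\mathcal Z\text{-}\mathrm{Mod}^f\to\mathcal C'$ (in particular $M_Q=\bigoplus_xM_Q^x$ for all $M\in\mathcal Z\text{-}\mathrm{Mod}^f$), it maps $\mathcal Z\text{-}\mathrm{Mod}^{\mathrm S}$ into $\mathcal S\mathrm{bimod}$, and the restricted functor $\mathcal Z\text{-}\mathrm{Mod}^{\mathrm S}\to\mathcal S\mathrm{bimod}$ is an equivalence of categories. -/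

import Mathlib

open CategoryTheory TensorProduct

universe u v

noncomputable section

namespace MomentGraph

/-! ## The representation `V` and the symmetric algebra `R = S(V)` -/

/-- A triple `(V, {α_s}, {α_s^∨})` for the Coxeter system `cs`: a `k`-linear action `ρ` of `W`
on `V`, vectors `α_s ∈ V` and functionals `α_s^∨ ∈ V^*` with `⟨α_s^∨, α_s⟩ = 2`,
`s(v) = v - ⟨α_s^∨, v⟩ α_s`, `α_s^∨` surjective and `α_s ≠ 0`. -/
structure Realization (k : Type u) [CommRing k] {W : Type u} [Group W] {B : Type v}
    {M : CoxeterMatrix B} (cs : CoxeterSystem M W) (V : Type u) [AddCommGroup V] [Module k V] where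
  ρ : Representation k W V
  α : B → V
  αv : B → Module.Dual k V
  pairing : ∀ i, αv i (α i) = 2
  simple_apply : ∀ i v, ρ (cs.simple i) v = v - αv i v • α i
  surjective : ∀ i, Function.Surjective (αv i)
  ne_zero : ∀ i, α i ≠ 0

/-- `R = S(V)`. -/
abbrev Sym (k V : Type u) [CommRing k] [AddCommGroup V] [Module k V] : Type u :=
  SymmetricAlgebra k V

/-- The degree `d` part of `R`, where `deg V = 2`. -/
def symDeg (k V : Type u) [CommRing k] [AddCommGroup V] [Module k V] (d : ℤ) :
    Submodule k (Sym k V) :=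
  ⨆ (n : ℕ) (_ : 2 * (n : ℤ) = d), (LinearMap.range (SymmetricAlgebra.ι k V)) ^ n

/-- `R ⊗_k R`; an `R`-bimodule is an `R ⊗_k R`-module, `f ⊗ g` acting by `m ↦ f m g`. -/
abbrev Env (k V : Type u) [CommRing k] [AddCommGroup V] [Module k V] : Type u :=
  Sym k V ⊗[k] Sym k V

/-- The multiplicative set `{1 ⊗ f ∣ f ∈ R ∖ {0}}` (for `k` a domain, `V` free). -/
def rightDen (k V : Type u) [CommRing k] [AddCommGroup V] [Module k V] : Submonoid (Env k V) :=
  (nonZeroDivisors (Sym k V)).map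
    (Algebra.TensorProduct.includeRight : Sym k V →ₐ[k] Env k V)

/-- `R ⊗_k Q`; its modules are the `(R, Q)`-bimodules. -/
abbrev EnvQ (k V : Type u) [CommRing k] [AddCommGroup V] [Module k V] : Type u :=
  Localization (rightDen k V)

/-- `M_Q = M ⊗_R Q`, i.e. the localization of `M` at the right action of `R ∖ {0}`. -/
abbrev LocQ (k V : Type u) [CommRing k] [AddCommGroup V] [Module k V]
    (M : Type u) [AddCommGroup M] [Module (Env k V) M] : Type u :=
  LocalizedModule (rightDen k V) M

section Loc

variable {k V : Type u} [CommRing k] [AddCommGroup V] [Module k V]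

/-- The canonical map `M → M_Q`. -/
abbrev toLocQ (M : Type u) [AddCommGroup M] [Module (Env k V) M] : M →ₗ[Env k V] LocQ k V M :=
  LocalizedModule.mkLinearMap (rightDen k V) M

/-- The map `M_Q → N_Q` induced by a bimodule map `M → N`. -/
def locQMap {M N : Type u} [AddCommGroup M] [Module (Env k V) M] [AddCommGroup N]
    [Module (Env k V) N] (f : M →ₗ[Env k V] N) : LocQ k V M →ₗ[EnvQ k V] LocQ k V N :=
  IsLocalizedModule.mapExtendScalars (rightDen k V) (toLocQ M) (toLocQ N) (EnvQ k V) f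

theorem locQMap_id {M : Type u} [AddCommGroup M] [Module (Env k V) M] (x : LocQ k V M) :
    locQMap (LinearMap.id : M →ₗ[Env k V] M) x = x := by
  have h := IsLocalizedModule.map_id (rightDen k V) (toLocQ (k := k) (V := V) M)
  exact LinearMap.congr_fun h x

theorem locQMap_comp {M N P : Type u} [AddCommGroup M] [Module (Env k V) M] [AddCommGroup N]
    [Module (Env k V) N] [AddCommGroup P] [Module (Env k V) P] (g : N →ₗ[Env k V] P)
    (f : M →ₗ[Env k V] N) (x : LocQ k V M) :
    locQMap (g ∘ₗ f) x = locQMap g (locQMap f x) := by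
  have h := IsLocalizedModule.map_comp' (rightDen k V) (toLocQ (k := k) (V := V) M)
    (toLocQ (k := k) (V := V) N) (toLocQ (k := k) (V := V) P) f g
  exact LinearMap.congr_fun h x

theorem locQMap_smul {M N : Type u} [AddCommGroup M] [Module (Env k V) M] [AddCommGroup N]
    [Module (Env k V) N] (f : M →ₗ[Env k V] N) (a : Env k V) (x : LocQ k V M) :
    locQMap f (a • x) = a • locQMap f x :=
  map_smul (IsLocalizedModule.map (rightDen k V) (toLocQ M) (toLocQ N) f) a x

end Loc

/-! ## Bimodules with a family `(M_Q^w)`, and the categories `C'` and `C` -/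

/-- An `R`-bimodule `M` with subgroups `M^i` (`i ∈ ℤ`) and sub-`(R, Q)`-bimodules
`M_Q^w ⊆ M_Q` (`w ∈ W`). The conditions under which this is an object of `C'` are collected in
`IsCPrime`. -/
structure BimodObj (k V W : Type u) [CommRing k] [AddCommGroup V] [Module k V] where
  carrier : Type u
  [addCommGroup : AddCommGroup carrier]
  [module : Module (Env k V) carrier]
  gr : ℤ → AddSubgroup carrier
  comp : W → Submodule (EnvQ k V) (LocQ k V carrier)

attribute [instance] BimodObj.addCommGroup BimodObj.module

section Bimod

variable {k V W : Type u} [CommRing k] [AddCommGroup V] [Module k V]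

/-- Bimodule homomorphisms of degree zero mapping `M_Q^w` to `N_Q^w`. -/
@[ext]
structure BimodHom (M N : BimodObj k V W) where
  toLin : M.carrier →ₗ[Env k V] N.carrier
  map_gr : ∀ d, ∀ m ∈ M.gr d, toLin m ∈ N.gr d
  map_comp : ∀ w, ∀ x ∈ M.comp w, locQMap toLin x ∈ N.comp w

instance : Category (BimodObj k V W) where
  Hom M N := BimodHom M N
  id M :=
    { toLin := LinearMap.id
      map_gr := fun _ _ h => h
      map_comp := fun w x h => by rw [locQMap_id]; exact h }
  comp f g :=
    { toLin := g.toLin ∘ₗ f.toLin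
      map_gr := fun d m h => g.map_gr d _ (f.map_gr d m h)
      map_comp := fun w x h => by
        rw [locQMap_comp]; exact g.map_comp w _ (f.map_comp w x h) }

/-- The grading shift: `M(n)^i = M^{n+i}`. -/
def BimodObj.shift (M : BimodObj k V W) (n : ℤ) : BimodObj k V W where
  carrier := M.carrier
  gr i := M.gr (n + i)
  comp := M.comp

/-- Finite direct sums. -/
def BimodObj.directSum {n : ℕ} (M : Fin n → BimodObj k V W) : BimodObj k V W where
  carrier := ∀ i, (M i).carrier
  gr d := ⨅ i, ((M i).gr d).comap (Pi.evalAddMonoidHom (fun i => (M i).carrier) i)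
  comp w := ⨅ i, ((M i).comp w).comap
    (locQMap (LinearMap.proj i : (∀ i, (M i).carrier) →ₗ[Env k V] (M i).carrier))

/-- `M` is a direct summand of `N`. -/
def BimodObj.IsSummand (M N : BimodObj k V W) : Prop :=
  ∃ M' : BimodObj k V W, Nonempty (BimodObj.directSum ![M, M'] ≅ N)

end Bimod

/-! ## The tensor product over `R` of two bimodules -/

section Tensor

variable {k V W : Type u} [CommRing k] [AddCommGroup V] [Module k V]

/-- A bimodule considered as an `R`-module through its right action. -/
def RightMod (M : Type u) : Type u := M

/-- A bimodule considered as an `R`-module through its left action. -/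
def LeftMod (M : Type u) : Type u := M

instance (M : Type u) [h : AddCommGroup M] : AddCommGroup (RightMod M) := h
instance (M : Type u) [h : AddCommGroup M] : AddCommGroup (LeftMod M) := h

instance (M : Type u) [AddCommGroup M] [h : Module (Env k V) M] : Module (Env k V) (RightMod M) := h
instance (M : Type u) [AddCommGroup M] [h : Module (Env k V) M] : Module (Env k V) (LeftMod M) := h

instance (M : Type u) [AddCommGroup M] [h : Module (Env k V) M] :
    Module (Sym k V) (RightMod M) :=
  Module.compHom M
    (Algebra.TensorProduct.includeRight : Sym k V →ₐ[k] Env k V).toRingHom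

instance (M : Type u) [AddCommGroup M] [h : Module (Env k V) M] :
    Module (Sym k V) (LeftMod M) :=
  Module.compHom M
    (Algebra.TensorProduct.includeLeft : Sym k V →ₐ[k] Env k V).toRingHom

/-- The action of `f ⊗ 1` on the first factor of `M ⊗_R N`. -/
def tensorLeft (M N : Type u) [AddCommGroup M] [Module (Env k V) M] [AddCommGroup N]
    [Module (Env k V) N] (a : Sym k V) :
    Module.End (Sym k V) (RightMod M ⊗[Sym k V] LeftMod N) :=
  LinearMap.rTensor (LeftMod N)
    { toFun := fun m : RightMod M => ((a ⊗ₜ[k] 1 : Env k V) • m : RightMod M)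
      map_add' := fun x y => smul_add _ x y
      map_smul' := fun b x => smul_comm (a ⊗ₜ[k] 1 : Env k V) ((1 : Sym k V) ⊗ₜ[k] b : Env k V)
        (show M from x) }

/-- The action of `1 ⊗ f` on the second factor of `M ⊗_R N`. -/
def tensorRight (M N : Type u) [AddCommGroup M] [Module (Env k V) M] [AddCommGroup N]
    [Module (Env k V) N] (a : Sym k V) :
    Module.End (Sym k V) (RightMod M ⊗[Sym k V] LeftMod N) :=
  LinearMap.lTensor (RightMod M)
    { toFun := fun m : LeftMod N => (((1 : Sym k V) ⊗ₜ[k] a : Env k V) • m : LeftMod N)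
      map_add' := fun x y => smul_add _ x y
      map_smul' := fun b x => smul_comm ((1 : Sym k V) ⊗ₜ[k] a : Env k V) (b ⊗ₜ[k] 1 : Env k V)
        (show N from x) }

theorem tensorLeft_tmul {M N : Type u} [AddCommGroup M] [Module (Env k V) M] [AddCommGroup N]
    [Module (Env k V) N] (a : Sym k V) (m : RightMod M) (n : LeftMod N) :
    tensorLeft M N a (m ⊗ₜ[Sym k V] n) =
      ((a ⊗ₜ[k] 1 : Env k V) • m : RightMod M) ⊗ₜ[Sym k V] n := rfl

theorem tensorRight_tmul {M N : Type u} [AddCommGroup M] [Module (Env k V) M] [AddCommGroup N]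
    [Module (Env k V) N] (a : Sym k V) (m : RightMod M) (n : LeftMod N) :
    tensorRight M N a (m ⊗ₜ[Sym k V] n) =
      m ⊗ₜ[Sym k V] (((1 : Sym k V) ⊗ₜ[k] a : Env k V) • n : LeftMod N) := rfl

/-- The action of `R ⊗_k R` on `M ⊗_R N`: `f ⊗ g` acts by `m ⊗ n ↦ f m ⊗ n g`. -/
def tensorAction (M N : Type u) [AddCommGroup M] [Module (Env k V) M] [AddCommGroup N]
    [Module (Env k V) N] : Env k V →+* Module.End (Sym k V) (RightMod M ⊗[Sym k V] LeftMod N) :=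
  letI : Module k (RightMod M ⊗[Sym k V] LeftMod N) :=
    Module.compHom _ (algebraMap k (Sym k V))
  haveI : IsScalarTower k (Sym k V) (RightMod M ⊗[Sym k V] LeftMod N) :=
    IsScalarTower.of_algebraMap_smul fun _ _ => rfl
  haveI : SMulCommClass k (Sym k V) (RightMod M ⊗[Sym k V] LeftMod N) :=
    ⟨fun c a x => smul_comm (algebraMap k (Sym k V) c) a x⟩
  (Algebra.TensorProduct.lift
    ({ toFun := tensorLeft M N
       map_one' := by
         refine TensorProduct.ext' fun m n => ?_
         rw [tensorLeft_tmul]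
         congr 1
         exact one_smul (Env k V) m
       map_mul' := fun a b => by
         refine TensorProduct.ext' fun m n => ?_
         rw [Module.End.mul_apply, tensorLeft_tmul, tensorLeft_tmul, tensorLeft_tmul, smul_smul]
         simp
       map_zero' := by
         refine TensorProduct.ext' fun m n => ?_
         rw [tensorLeft_tmul, TensorProduct.zero_tmul]
         exact (congrArg (fun y : RightMod M => y ⊗ₜ[Sym k V] n) (zero_smul (Env k V) m)).trans
           (TensorProduct.zero_tmul _ _)
       map_add' := fun a b => by
         refine TensorProduct.ext' fun m n => ?_
         rw [LinearMap.add_apply, tensorLeft_tmul, tensorLeft_tmul, tensorLeft_tmul,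
           TensorProduct.add_tmul, add_smul, TensorProduct.add_tmul]
       commutes' := fun c => by
         refine TensorProduct.ext' fun m n => ?_
         rw [tensorLeft_tmul, Module.algebraMap_end_apply, ← algebraMap_smul (Sym k V) c,
           TensorProduct.smul_tmul']
         congr 1
         change ((algebraMap k (Sym k V) c ⊗ₜ[k] 1 : Env k V) • m : RightMod M) =
           ((1 ⊗ₜ[k] algebraMap k (Sym k V) c : Env k V) • m : RightMod M)
         congr 1
         rw [Algebra.algebraMap_eq_smul_one, TensorProduct.smul_tmul] } :
      Sym k V →ₐ[k] Module.End (Sym k V) (RightMod M ⊗[Sym k V] LeftMod N))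
    ({ toFun := tensorRight M N
       map_one' := by
         refine TensorProduct.ext' fun m n => ?_
         rw [tensorRight_tmul]
         congr 1
         exact one_smul (Env k V) n
       map_mul' := fun a b => by
         refine TensorProduct.ext' fun m n => ?_
         rw [Module.End.mul_apply, tensorRight_tmul, tensorRight_tmul, tensorRight_tmul, smul_smul]
         simp
       map_zero' := by
         refine TensorProduct.ext' fun m n => ?_
         rw [tensorRight_tmul, TensorProduct.tmul_zero]
         exact (congrArg (fun y : LeftMod N => m ⊗ₜ[Sym k V] y) (zero_smul (Env k V) n)).trans
           (TensorProduct.tmul_zero _ _)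
       map_add' := fun a b => by
         refine TensorProduct.ext' fun m n => ?_
         rw [LinearMap.add_apply, tensorRight_tmul, tensorRight_tmul, tensorRight_tmul,
           TensorProduct.tmul_add, add_smul, TensorProduct.tmul_add]
       commutes' := fun c => by
         refine TensorProduct.ext' fun m n => ?_
         rw [tensorRight_tmul, Module.algebraMap_end_apply, ← algebraMap_smul (Sym k V) c,
           ← TensorProduct.tmul_smul]
         congr 1
         change ((1 ⊗ₜ[k] algebraMap k (Sym k V) c : Env k V) • n : LeftMod N) =
           ((algebraMap k (Sym k V) c ⊗ₜ[k] 1 : Env k V) • n : LeftMod N)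
         congr 1
         rw [Algebra.algebraMap_eq_smul_one, TensorProduct.smul_tmul] } :
      Sym k V →ₐ[k] Module.End (Sym k V) (RightMod M ⊗[Sym k V] LeftMod N))
    (fun a b => by
      refine TensorProduct.ext' fun m n => ?_
      rfl)).toRingHom

/-- `M ⊗_R N` as a bimodule. -/
def BiTensor (k V M N : Type u) [CommRing k] [AddCommGroup V] [Module k V] [AddCommGroup M]
    [Module (Env k V) M] [AddCommGroup N] [Module (Env k V) N] : Type u :=
  RightMod M ⊗[Sym k V] LeftMod N

instance (M N : Type u) [AddCommGroup M] [Module (Env k V) M] [AddCommGroup N]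
    [Module (Env k V) N] : AddCommGroup (BiTensor k V M N) :=
  inferInstanceAs (AddCommGroup (RightMod M ⊗[Sym k V] LeftMod N))

instance (M N : Type u) [AddCommGroup M] [Module (Env k V) M] [AddCommGroup N]
    [Module (Env k V) N] : Module (Env k V) (BiTensor k V M N) :=
  Module.compHom (RightMod M ⊗[Sym k V] LeftMod N) (tensorAction M N)

/-- The element `m ⊗ n` of `M ⊗_R N`. -/
def biTmul {M N : Type u} [AddCommGroup M] [Module (Env k V) M] [AddCommGroup N]
    [Module (Env k V) N] (m : M) (n : N) : BiTensor k V M N :=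
  (show RightMod M from m) ⊗ₜ[Sym k V] (show LeftMod N from n)

theorem smul_biTmul {M N : Type u} [AddCommGroup M] [Module (Env k V) M] [AddCommGroup N]
    [Module (Env k V) N] (f g : Sym k V) (m : M) (n : N) :
    (f ⊗ₜ[k] g : Env k V) • (biTmul m n : BiTensor k V M N) =
      biTmul ((f ⊗ₜ[k] (1 : Sym k V) : Env k V) • m) (((1 : Sym k V) ⊗ₜ[k] g : Env k V) • n) :=
  rfl

theorem biTmul_balanced {M N : Type u} [AddCommGroup M] [Module (Env k V) M] [AddCommGroup N]
    [Module (Env k V) N] (f : Sym k V) (m : M) (n : N) :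
    (biTmul (((1 : Sym k V) ⊗ₜ[k] f : Env k V) • m) n : BiTensor k V M N) =
      biTmul m ((f ⊗ₜ[k] (1 : Sym k V) : Env k V) • n) :=
  TensorProduct.smul_tmul (R := Sym k V) (M := RightMod M) (N := LeftMod N) f m n

/-- `M ⊗ N = M ⊗_R N` with the tensor product grading and
`(M ⊗ N)_Q^w = ⨁_{xy = w} M_Q^x ⊗_Q N_Q^y`; the latter is spanned over `Q` by the images of the
elements `m ⊗ n`, where `m ∈ M` and `n ∈ N` have images in `M_Q^x` and `N_Q^y` with `xy = w`. -/
def BimodObj.tensor [Group W] (M N : BimodObj k V W) : BimodObj k V W where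
  carrier := BiTensor k V M.carrier N.carrier
  gr d := AddSubgroup.closure
    {x | ∃ i j, i + j = d ∧ ∃ m ∈ M.gr i, ∃ n ∈ N.gr j, x = biTmul m n}
  comp w := Submodule.span (EnvQ k V)
    {x | ∃ a b, a * b = w ∧ ∃ (m : M.carrier) (n : N.carrier),
      toLocQ M.carrier m ∈ M.comp a ∧ toLocQ N.carrier n ∈ N.comp b ∧
        x = toLocQ (BiTensor k V M.carrier N.carrier) (biTmul m n)}

end Tensor

/-! ## Soergel bimodules -/

section Soergel

variable {k : Type u} [CommRing k] {W : Type u} [Group W] {B : Type v} {C : CoxeterMatrix B}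
  {cs : CoxeterSystem C W} {V : Type u} [AddCommGroup V] [Module k V]

/-- The action of `W` on `R` by algebra automorphisms extending the action on `V`. -/
def Realization.act (r : Realization k cs V) (w : W) : Sym k V →ₐ[k] Sym k V :=
  SymmetricAlgebra.lift (SymmetricAlgebra.ι k V ∘ₗ r.ρ w)

open scoped Classical in
/-- `M` is an object of `C'`: a graded `R`-bimodule with a decomposition
`M_Q = ⨁_w M_Q^w` with finitely many nonzero terms, and `m f = w(f) m` for `m ∈ M_Q^w`. -/
structure IsCPrime (r : Realization k cs V) (M : BimodObj k V W) : Prop where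
  isInternal_gr : DirectSum.IsInternal M.gr
  left_smul_mem : ∀ d e, ∀ f ∈ symDeg k V d, ∀ m ∈ M.gr e,
    (f ⊗ₜ[k] (1 : Sym k V) : Env k V) • m ∈ M.gr (d + e)
  right_smul_mem : ∀ d e, ∀ f ∈ symDeg k V d, ∀ m ∈ M.gr e,
    ((1 : Sym k V) ⊗ₜ[k] f : Env k V) • m ∈ M.gr (d + e)
  isInternal_comp : DirectSum.IsInternal M.comp
  finite_comp : {w | M.comp w ≠ ⊥}.Finite
  right_smul_eq : ∀ w, ∀ x ∈ M.comp w, ∀ f : Sym k V,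
    ((1 : Sym k V) ⊗ₜ[k] f : Env k V) • x = (r.act w f ⊗ₜ[k] (1 : Sym k V) : Env k V) • x

/-- `M` is an object of `C`: it is in `C'`, finitely generated as a bimodule, and flat as a right
`R`-module. -/
structure IsC (r : Realization k cs V) (M : BimodObj k V W) : Prop extends IsCPrime r M where
  finite : Module.Finite (Env k V) M.carrier
  flat : Module.Flat (Sym k V) (RightMod M.carrier)

/-- The unit object `R_e`. -/
def unitObj (k V W : Type u) [CommRing k] [AddCommGroup V] [Module k V] [Group W] :
    BimodObj k V W :=
  letI : Module (Env k V) (Sym k V) :=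
    Module.compHom (Sym k V) (Algebra.TensorProduct.lmul' k (S := Sym k V)).toRingHom
  { carrier := Sym k V
    gr := fun d => (symDeg k V d).toAddSubgroup
    comp := fun w => ⨆ _ : w = 1, ⊤ }

/-- `R^s`. -/
def Realization.fixed (r : Realization k cs V) (i : B) : Subalgebra k (Sym k V) :=
  AlgHom.equalizer (r.act (cs.simple i)) (AlgHom.id k (Sym k V))

/-- `R ⊗_{R^s} R`. -/
abbrev Realization.BsCarrier (r : Realization k cs V) (i : B) : Type u :=
  Sym k V ⊗[r.fixed i] Sym k V

instance (r : Realization k cs V) (i : B) : Module (Env k V) (r.BsCarrier i) :=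
  Module.compHom (r.BsCarrier i)
    (Algebra.TensorProduct.productMap
      ((Algebra.TensorProduct.includeLeft :
        Sym k V →ₐ[r.fixed i] r.BsCarrier i).restrictScalars k)
      ((Algebra.TensorProduct.includeRight :
        Sym k V →ₐ[r.fixed i] r.BsCarrier i).restrictScalars k)).toRingHom

theorem smul_BsCarrier (r : Realization k cs V) (i : B) (f g a b : Sym k V) :
    (f ⊗ₜ[k] g : Env k V) • (a ⊗ₜ[r.fixed i] b : r.BsCarrier i) =
      (f * a) ⊗ₜ[r.fixed i] (g * b) := by
  change Algebra.TensorProduct.productMap _ _ (f ⊗ₜ[k] g) * (a ⊗ₜ[r.fixed i] b) = _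
  simp

/-- The bimodule `B_s = R ⊗_{R^s} R (1)`. Its decomposition is the one supported on `{e, s}`:
for `w ∈ {e, s}`, `(B_s)_Q^w` consists of the `x` with `x f = w(f) x` for all `f ∈ R`. -/
def Realization.Bs (r : Realization k cs V) (i : B) : BimodObj k V W :=
  BimodObj.shift
    { carrier := r.BsCarrier i
      gr := fun d => AddSubgroup.closure
        {x | ∃ a b, a + b = d ∧ ∃ f ∈ symDeg k V a, ∃ g ∈ symDeg k V b, x = f ⊗ₜ[r.fixed i] g}
      comp := fun w => ⨆ _ : w = 1 ∨ w = cs.simple i, ⨅ f : Sym k V,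
        LinearMap.ker
          (algebraMap (Env k V) (EnvQ k V)
              ((1 : Sym k V) ⊗ₜ[k] f - r.act w f ⊗ₜ[k] (1 : Sym k V)) •
            (LinearMap.id : LocQ k V (r.BsCarrier i) →ₗ[EnvQ k V] LocQ k V (r.BsCarrier i))) }
    1

/-- `B_{s_1} ⊗ ⋯ ⊗ B_{s_l}(n)`. -/
def Realization.BS (r : Realization k cs V) (x : List B) (n : ℤ) : BimodObj k V W :=
  (x.foldr (fun i N => (r.Bs i).tensor N) (unitObj k V W)).shift n

/-- Soergel bimodules: the objects of `C` which are direct summands of finite direct sums of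
objects `B_{s_1} ⊗ ⋯ ⊗ B_{s_l}(n)`. -/
def IsSoergelBimod (r : Realization k cs V) : ObjectProperty (BimodObj k V W) := fun M =>
  IsC r M ∧ ∃ (m : ℕ) (x : Fin m → List B) (n : Fin m → ℤ),
    M.IsSummand (BimodObj.directSum fun j => r.BS (x j) (n j))

end Soergel

/-! ## The structure algebra of the moment graph and its modules -/

section Structure

variable {k : Type u} [CommRing k] {W : Type u} [Group W] {B : Type v} {C : CoxeterMatrix B}
  {cs : CoxeterSystem C W} {V : Type u} [AddCommGroup V] [Module k V]

/-- `a = α_t` for the reflection `t`: `t = u s u⁻¹` and `a = u(α_s)` with `s` simple. For given `t`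
such an `a` is determined up to a unit of `k`. -/
def Realization.IsRoot (r : Realization k cs V) (t : W) (a : V) : Prop :=
  ∃ (u : W) (i : B), t = u * cs.simple i * u⁻¹ ∧ a = r.ρ u (r.α i)

/-- The GKM condition: `α_{t₁}, α_{t₂}` are linearly independent for reflections `t₁ ≠ t₂`. -/
def Realization.GKM (r : Realization k cs V) : Prop :=
  ∀ t₁ t₂ a₁ a₂, r.IsRoot t₁ a₁ → r.IsRoot t₂ a₂ → t₁ ≠ t₂ → LinearIndependent k ![a₁, a₂]

/-- The structure algebra `Z`: families `(z_w)` in `R` with `z_{tw} ≡ z_w mod α_t`. -/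
def Realization.Z (r : Realization k cs V) : Subalgebra (Sym k V) (W → Sym k V) where
  carrier := {z | ∀ t a w, r.IsRoot t a → SymmetricAlgebra.ι k V a ∣ z (t * w) - z w}
  mul_mem' := by
    intro y z hy hz t a w h
    have e : (y * z) (t * w) - (y * z) w =
        (y (t * w) - y w) * z (t * w) + y w * (z (t * w) - z w) := by
      simp only [Pi.mul_apply]; ring
    rw [e]
    exact dvd_add ((hy t a w h).mul_right _) ((hz t a w h).mul_left _)
  add_mem' := by
    intro y z hy hz t a w h
    have e : (y + z) (t * w) - (y + z) w = (y (t * w) - y w) + (z (t * w) - z w) := by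
      simp only [Pi.add_apply]; ring
    rw [e]
    exact dvd_add (hy t a w h) (hz t a w h)
  algebraMap_mem' := by
    intro f t a w _
    simp

theorem Realization.act_ι (r : Realization k cs V) (w : W) (v : V) :
    r.act w (SymmetricAlgebra.ι k V v) = SymmetricAlgebra.ι k V (r.ρ w v) := by
  simp [Realization.act]

theorem Realization.dvd_act_sub (r : Realization k cs V) (t w : W) (a : V) (h : r.IsRoot t a)
    (f : Sym k V) : SymmetricAlgebra.ι k V a ∣ r.act (t * w) f - r.act w f := by
  induction f using SymmetricAlgebra.induction with
  | algebraMap c => simp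
  | ι v =>
    obtain ⟨u, i, rfl, rfl⟩ := h
    rw [r.act_ι, r.act_ι, ← map_sub]
    have e : r.ρ (u * cs.simple i * u⁻¹ * w) v - r.ρ w v =
        -(r.αv i (r.ρ (u⁻¹ * w) v)) • r.ρ u (r.α i) := by
      have e1 : r.ρ (u * cs.simple i * u⁻¹ * w) v =
          r.ρ u (r.ρ (cs.simple i) (r.ρ (u⁻¹ * w) v)) := by
        simp [map_mul, mul_assoc]
      have e2 : r.ρ u (r.ρ (u⁻¹ * w) v) = r.ρ w v := by
        rw [← Module.End.mul_apply, ← map_mul]; simp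
      rw [e1, r.simple_apply, map_sub, map_smul, e2]
      simp
    rw [e, map_smul, Algebra.smul_def]
    exact dvd_mul_left _ _
  | mul f g hf hg =>
    rw [map_mul, map_mul]
    have e : r.act (t * w) f * r.act (t * w) g - r.act w f * r.act w g =
        (r.act (t * w) f - r.act w f) * r.act (t * w) g +
          r.act w f * (r.act (t * w) g - r.act w g) := by ring
    rw [e]
    exact dvd_add (hf.mul_right _) (hg.mul_left _)
  | add f g hf hg =>
    rw [map_add, map_add, add_sub_add_comm]
    exact dvd_add hf hg

/-- The ring homomorphism `R → Z`, `f ↦ (w(f))_w`. -/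
def Realization.toZRight (r : Realization k cs V) : Sym k V →ₐ[k] r.Z :=
  AlgHom.codRestrict (AlgHom.pi fun w => r.act w) (r.Z.restrictScalars k)
    (fun f t a w h => r.dvd_act_sub t w a h f)

/-- The ring homomorphism `R ⊗_k R → Z`, `f ⊗ g ↦ (f w(g))_w`. -/
def Realization.envToZ (r : Realization k cs V) : Env k V →ₐ[k] r.Z :=
  Algebra.TensorProduct.productMap (IsScalarTower.toAlgHom k (Sym k V) r.Z) r.toZRight

theorem Realization.envToZ_apply (r : Realization k cs V) (f g : Sym k V) (w : W) :
    (r.envToZ (f ⊗ₜ[k] g) : W → Sym k V) w = f * r.act w g := rfl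

/-- `Z^s = {(z_w) ∈ Z ∣ z_{ws} = z_w}`. -/
def Realization.Zs (r : Realization k cs V) (i : B) : Subalgebra (Sym k V) r.Z where
  carrier := {z | ∀ w, (z : W → Sym k V) (w * cs.simple i) = (z : W → Sym k V) w}
  mul_mem' := by
    intro y z hy hz w
    simp only [Subalgebra.coe_mul, Pi.mul_apply, hy w, hz w]
  add_mem' := by
    intro y z hy hz w
    simp only [Subalgebra.coe_add, Pi.add_apply, hy w, hz w]
  algebraMap_mem' := fun f w => rfl

/-- `z ∈ Z` is homogeneous of degree `d`: all `z_w` are. -/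
def Realization.ZHomog (r : Realization k cs V) (d : ℤ) (z : r.Z) : Prop :=
  ∀ w, (z : W → Sym k V) w ∈ symDeg k V d

/-- A `Z`-module `M` with subgroups `M^i` (`i ∈ ℤ`). -/
structure ZObj (r : Realization k cs V) where
  carrier : Type u
  [addCommGroup : AddCommGroup carrier]
  [module : Module r.Z carrier]
  gr : ℤ → AddSubgroup carrier

attribute [instance] ZObj.addCommGroup ZObj.module

variable {r : Realization k cs V}

/-- `Z`-linear maps of degree zero. -/
@[ext]
structure ZHom (M N : ZObj r) where
  toLin : M.carrier →ₗ[r.Z] N.carrier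
  map_gr : ∀ d, ∀ m ∈ M.gr d, toLin m ∈ N.gr d

instance : Category (ZObj r) where
  Hom M N := ZHom M N
  id M := ⟨LinearMap.id, fun _ _ h => h⟩
  comp f g := ⟨g.toLin ∘ₗ f.toLin, fun d m h => g.map_gr d _ (f.map_gr d m h)⟩

/-- `M` is a graded `Z`-module on which the action of `Z` factors through the restriction
`Z → Z^I` for some finite `I ⊆ W`. -/
structure IsZModF (M : ZObj r) : Prop where
  isInternal_gr : DirectSum.IsInternal M.gr
  smul_mem : ∀ d e, ∀ z : r.Z, r.ZHomog d z → ∀ m ∈ M.gr e, z • m ∈ M.gr (d + e)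
  factors : ∃ I : Finset W, ∀ y z : r.Z,
    (∀ w ∈ I, (y : W → Sym k V) w = (z : W → Sym k V) w) → ∀ m : M.carrier, y • m = z • m

/-- The grading shift: `M(n)^i = M^{n+i}`. -/
def ZObj.shift (M : ZObj r) (n : ℤ) : ZObj r where
  carrier := M.carrier
  gr i := M.gr (n + i)

/-- Finite direct sums. -/
def ZObj.directSum {n : ℕ} (M : Fin n → ZObj r) : ZObj r where
  carrier := ∀ i, (M i).carrier
  gr d := ⨅ i, ((M i).gr d).comap (Pi.evalAddMonoidHom (fun i => (M i).carrier) i)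

/-- `M` is a direct summand of `N`. -/
def ZObj.IsSummand (M N : ZObj r) : Prop :=
  ∃ M' : ZObj r, Nonempty (ZObj.directSum ![M, M'] ≅ N)

/-- `Z ⊗_{Z^s} M` with the tensor product grading. -/
def ZObj.induce (i : B) (M : ZObj r) : ZObj r where
  carrier := r.Z ⊗[r.Zs i] M.carrier
  gr d := AddSubgroup.closure
    {x | ∃ a b, a + b = d ∧ ∃ z : r.Z, r.ZHomog a z ∧ ∃ m ∈ M.gr b, x = z ⊗ₜ[r.Zs i] m}

/-- The module `R(e)`: the `Z`-module `R` with `(z_w) f = z_e f`. -/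
def zUnit (r : Realization k cs V) : ZObj r :=
  letI : Module r.Z (Sym k V) := Module.compHom (Sym k V)
    ((Pi.evalRingHom (fun _ : W => Sym k V) 1).comp r.Z.val.toRingHom)
  { carrier := Sym k V
    gr := fun d => (symDeg k V d).toAddSubgroup }

/-- `Z ⊗_{Z^{s_1}} ⋯ ⊗_{Z^{s_l}} R(e)(n)`. -/
def ZObj.BS (r : Realization k cs V) (x : List B) (n : ℤ) : ZObj r :=
  (x.foldr (fun i N => N.induce i) (zUnit r)).shift n

/-- The analogue of Soergel bimodules for `Z`: the finitely supported graded `Z`-modules which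
are direct summands of finite direct sums of modules `Z ⊗_{Z^{s_1}} ⋯ ⊗_{Z^{s_l}} R(e)(n)`. -/
def IsZSoergel (r : Realization k cs V) : ObjectProperty (ZObj r) := fun M =>
  IsZModF M ∧ ∃ (m : ℕ) (x : Fin m → List B) (n : Fin m → ℤ),
    M.IsSummand (ZObj.directSum fun j => ZObj.BS r (x j) (n j))

/-! ## The functor `F` -/

/-- A `Z`-module viewed as an `R`-bimodule through `f ⊗ g ↦ (f w(g))_w`. -/
instance (M : ZObj r) : Module (Env k V) M.carrier :=
  Module.compHom M.carrier r.envToZ.toRingHom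

theorem ZObj.env_smul (M : ZObj r) (a : Env k V) (m : M.carrier) :
    a • m = r.envToZ a • m := rfl

/-- Multiplication by `z ∈ Z` as a bimodule endomorphism. -/
def ZObj.lsmul (M : ZObj r) (z : r.Z) : M.carrier →ₗ[Env k V] M.carrier where
  toFun m := z • m
  map_add' := smul_add z
  map_smul' a m := smul_comm z (r.envToZ a) m

/-- A `Z`-linear map as a bimodule homomorphism. -/
def ZHom.toBimod {M N : ZObj r} (f : ZHom M N) : M.carrier →ₗ[Env k V] N.carrier where
  toFun m := f.toLin m
  map_add' := map_add f.toLin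
  map_smul' a m := map_smul f.toLin (r.envToZ a) m

/-- `M_Q^x = {m ∈ M_Q ∣ (z_w) m = z_x m for all (z_w) ∈ Z}`. -/
def ZObj.comp (M : ZObj r) (x : W) : Submodule (EnvQ k V) (LocQ k V M.carrier) :=
  ⨅ z : r.Z, LinearMap.ker (locQMap (M.lsmul z) -
    algebraMap (Env k V) (EnvQ k V) ((z : W → Sym k V) x ⊗ₜ[k] (1 : Sym k V)) • LinearMap.id)

theorem ZObj.mem_comp (M : ZObj r) (x : W) (m : LocQ k V M.carrier) :
    m ∈ M.comp x ↔ ∀ z : r.Z, locQMap (M.lsmul z) m =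
      ((z : W → Sym k V) x ⊗ₜ[k] (1 : Sym k V) : Env k V) • m := by
  simp only [ZObj.comp, Submodule.mem_iInf, LinearMap.mem_ker, LinearMap.sub_apply,
    LinearMap.smul_apply, LinearMap.id_apply, algebraMap_smul, sub_eq_zero]

/-- The functor `F`: a `Z`-module is sent to the bimodule with `f m g = (f w(g))_w m` and the
family `M_Q^x`. -/
def functorF (r : Realization k cs V) : ZObj r ⥤ BimodObj k V W where
  obj M := { carrier := M.carrier, gr := M.gr, comp := M.comp }
  map {M N} f :=
    { toLin := ZHom.toBimod f
      map_gr := f.map_gr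
      map_comp := fun w x hx => by
        rw [ZObj.mem_comp] at hx ⊢
        intro z
        have e : N.lsmul z ∘ₗ ZHom.toBimod f = ZHom.toBimod f ∘ₗ M.lsmul z :=
          LinearMap.ext fun m => (map_smul f.toLin z m).symm
        rw [← locQMap_comp, e, locQMap_comp, hx z, locQMap_smul] }

end Structure

end MomentGraph

end

/-! Both sides of the equivalence are built by scalar extension along an involution of `Z`. The
module `Z ⊗_{Z^s} M` belongs to the right involution `z ↦ (z_{ws})_w`. A product `B_s ⊗ N` grows on
the left and belongs to the left involution `z ↦ (s(z_{sw}))_w`. In both cases `Z` is free over the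
invariants with basis `1, gen`, and the coordinates are given by Demazure operators. Their quotients
lie in `Z` because a root `α_t` dividing `b f`, with `b` the root of another reflection, already
divides `f`; this uses GKM and the surjectivity of `α_t` on `V^*`
(`Realization.IsRoot.dvd_of_dvd_mul`). Either extension of `M` is therefore `M × M` with an explicit
2 × 2 action (`Double`).

Left and right extensions commute (`Double.comm`) and agree on `R(e)` (`Realization.exchangeIso`).
So the iterated right extension of `R(e)` along a word is the iterated left extension along the
reversed word (`Realization.foldr_induce_iso_LBS`). Since `F` turns the left extension into `B_s ⊗
-` up to a shift (`ZObj.tensorBsIso`), it matches the Bott–Samelson objects of the two sides, with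
reversed words and shifts corrected by the length.

That `F` lands in `C'` is a separation statement: for `x ∈ W` and a finite `I ⊆ W` some `z ∈ Z` is
nonzero at `x` and zero on the rest of `I` (`Realization.exists_separating`). If `x` and `y` act
differently on `V`, a family `(w(v))_w` tells them apart. Otherwise GKM makes `y x⁻¹` central, and a
central element `≠ 1` survives under some homomorphism `φ : W → W` that kills all but finitely many
reflections (`CoxeterSystem.exists_hom_of_central`). The product of the remaining roots, placed on a
coset of `ker φ`, is then a separating element of `Z`. Separating elements split each finitely
supported module, after right multiplication by some nonzero `g`, into eigenvectors of `Z`.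

On eigenvectors `z` acts as left multiplication by `z_x`, so a bimodule map respecting the
decompositions commutes with `Z` there. When the target is flat on the right, hence torsion free, it
commutes with `Z` everywhere (`BimodHom.map_Z_smul`), which gives fullness. Applied to the
idempotents of a direct summand of `F(P)` and of its complement, the same fact puts a `Z`-module
structure on both, which gives essential surjectivity. -/

noncomputable section

/-! ## A parity cocycle on Coxeter groups -/

namespace CoxeterSystem

variable {B : Type*} {M : CoxeterMatrix B} {W : Type*} [Group W] (cs : CoxeterSystem M W)

open scoped Classical in
/-- The map `(t, ε) ↦ (s t s, ε + [t = s])`. -/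
def parityStep (i : B) : Function.End (W × ZMod 2) := fun x =>
  (cs.simple i * x.1 * cs.simple i, x.2 + if x.1 = cs.simple i then 1 else 0)

-- With `g = s_i s_j` one has `s_j g^n = g^{-n} s_j`. So the condition `g^m t g^{-m} = s_j` met at
-- the step for `j` reads `g^{2m} t = s_j`, and the one met at the step for `i` reads `g^{2m+1} t =
-- s_j`.
open scoped Classical in
theorem parityStep_pow (i j : B) (m : ℕ) (x : W × ZMod 2) :
    ((cs.parityStep i * cs.parityStep j) ^ m) x =
      ((cs.simple i * cs.simple j) ^ m * x.1 * ((cs.simple i * cs.simple j) ^ m)⁻¹,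
        x.2 + ∑ l ∈ Finset.range (2 * m),
          if (cs.simple i * cs.simple j) ^ l * x.1 = cs.simple j then 1 else 0) := by
  induction m with
  | zero => change x = _; simp
  | succ m ih =>
    rw [pow_succ']
    change (cs.parityStep i * cs.parityStep j) (((cs.parityStep i * cs.parityStep j) ^ m) x) = _
    rw [ih]
    set g := cs.simple i * cs.simple j with hg
    have hinv : cs.simple j * cs.simple i = g⁻¹ := by simp [hg]
    have hgs : ∀ n : ℕ, cs.simple j * g ^ n = (g ^ n)⁻¹ * cs.simple j := by
      intro n
      induction n with
      | zero => simp
      | succ n ihn =>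
        rw [pow_succ, ← mul_assoc, ihn, ← pow_succ, pow_succ', mul_inv_rev, mul_assoc, mul_assoc]
        congr 1
        simp [hg, mul_assoc]
    change cs.parityStep i (cs.parityStep j _) = _
    simp only [parityStep]
    refine Prod.ext ?_ ?_
    · simp only [hg, pow_succ', mul_inv_rev, cs.inv_simple, mul_assoc]
    · simp only
      rw [show 2 * (m + 1) = 2 * m + 1 + 1 by ring, Finset.sum_range_succ, Finset.sum_range_succ,
        ← add_assoc, ← add_assoc]
      congr 2
      · refine if_congr ?_ rfl rfl
        rw [mul_inv_eq_iff_eq_mul, hgs, ← eq_inv_mul_iff_mul_eq, ← eq_inv_mul_iff_mul_eq,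
          ← mul_assoc, ← mul_inv_rev, ← pow_add, two_mul]
      · refine propext ?_
        have e : cs.simple j * (g ^ m * x.1 * (g ^ m)⁻¹) * cs.simple j = cs.simple i ↔
            g ^ m * x.1 * (g ^ m)⁻¹ = cs.simple j * cs.simple i * cs.simple j := by
          constructor
          · intro h
            rw [← h]
            simp [mul_assoc]
          · intro h
            rw [h]
            simp [mul_assoc]
        rw [e, hinv, mul_inv_eq_iff_eq_mul, mul_assoc g⁻¹, hgs, ← eq_inv_mul_iff_mul_eq,
          ← eq_inv_mul_iff_mul_eq, ← mul_assoc, ← mul_assoc, ← mul_inv_rev, ← mul_inv_rev]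
        congr! 3
        rw [← pow_succ', ← pow_add, two_mul, add_assoc]

/-- For `m = M i j` one has `g^m = 1`, so the `2m` summands of the parity form two equal halves,
which cancel modulo 2. -/
theorem parityStep_isLiftable : M.IsLiftable cs.parityStep := by
  classical
  intro i j
  funext x
  rw [parityStep_pow, cs.simple_mul_simple_pow, two_mul, Finset.sum_range_add]
  simp only [pow_add, cs.simple_mul_simple_pow, one_mul, CharTwo.add_self_eq_zero]
  change _ = x
  simp

/-- The action of `W` on `W × ℤ/2` extending `parityStep`. -/
def parityHom : W →* Function.End (W × ZMod 2) :=
  cs.lift ⟨cs.parityStep, cs.parityStep_isLiftable⟩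

/-- The parity of the number of occurrences of `t` among the right inversions of a word for `w`. -/
def invParity (w t : W) : ZMod 2 := (cs.parityHom w (t, 0)).2

theorem parityHom_apply (w t : W) (ε : ZMod 2) :
    cs.parityHom w (t, ε) = (w * t * w⁻¹, ε + cs.invParity w t) := by
  have h : ∀ (t : W) (ε : ZMod 2), cs.parityHom w (t, ε) =
      (w * t * w⁻¹, ε + (cs.parityHom w (t, 0)).2) := by
    induction w using cs.simple_induction_left with
    | one => intro t ε; simp [Function.End.one_def]
    | mul_simple_left w i ih =>
      intro t ε
      have e : cs.parityHom (cs.simple i) = cs.parityStep i :=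
        cs.lift_apply_simple cs.parityStep_isLiftable i
      rw [map_mul, e]
      change cs.parityStep i (cs.parityHom w _) =
        (_, _ + (cs.parityStep i (cs.parityHom w _)).2)
      rw [ih t ε, ih t 0]
      simp [parityStep, mul_assoc, add_assoc]
  exact h t ε

theorem invParity_mul (x y t : W) :
    cs.invParity (x * y) t = cs.invParity y t + cs.invParity x (y * t * y⁻¹) := by
  rw [invParity, map_mul]
  change (cs.parityHom x (cs.parityHom y (t, 0))).2 = _
  rw [parityHom_apply, parityHom_apply, zero_add]

open scoped Classical in
theorem invParity_simple (i : B) (t : W) :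
    cs.invParity (cs.simple i) t = if t = cs.simple i then 1 else 0 := by
  have e : cs.parityHom (cs.simple i) = cs.parityStep i :=
    cs.lift_apply_simple cs.parityStep_isLiftable i
  rw [invParity, e]
  simp [parityStep]

theorem invParity_one (t : W) : cs.invParity 1 t = 0 := by
  simp [invParity, Function.End.one_def]

/-- The cocycle identity peels off the first letter in the same way as the recursion for
`rightInvSeq`, and an odd count is not zero. -/
theorem mem_rightInvSeq_of_invParity (ω : List B) (t : W)
    (h : cs.invParity (cs.wordProd ω) t ≠ 0) : t ∈ cs.rightInvSeq ω := by
  induction ω with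
  | nil => simp [invParity_one] at h
  | cons i ω ih =>
    rw [wordProd_cons, invParity_mul, invParity_simple] at h
    rw [rightInvSeq, List.mem_cons]
    by_cases h0 : cs.invParity (cs.wordProd ω) t = 0
    · left
      rw [h0, zero_add] at h
      have h1 : cs.wordProd ω * t * (cs.wordProd ω)⁻¹ = cs.simple i := by
        by_contra h1
        exact h (if_neg h1)
      rw [← h1]
      simp [mul_assoc]
    · exact Or.inr (ih h0)

theorem length_mul_lt_of_invParity {w t : W} (h : cs.invParity w t ≠ 0) :
    cs.length (w * t) < cs.length w := by
  obtain ⟨ω, hω, rfl⟩ := cs.exists_isReduced w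
  exact (cs.isRightInversion_of_mem_rightInvSeq hω (cs.mem_rightInvSeq_of_invParity ω t h)).2

theorem invParity_finite (w : W) : {t | cs.invParity w t ≠ 0}.Finite := by
  obtain ⟨ω, hω, rfl⟩ := cs.exists_isReduced w
  exact (cs.rightInvSeq ω).finite_toSet.subset fun t h => cs.mem_rightInvSeq_of_invParity ω t h

/-- If the parity at `s` were 0 for `w`, the cocycle identity would make it 1 for `ws`, and then `w
= (ws)s` would be shorter than `ws`. -/
theorem invParity_simple_of_descent {w : W} {i : B}
    (h : cs.length (w * cs.simple i) < cs.length w) : cs.invParity w (cs.simple i) = 1 := by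
  by_contra h0
  have h0 : cs.invParity w (cs.simple i) = 0 := by
    generalize cs.invParity w (cs.simple i) = a at h0
    revert a; decide
  have h1 : cs.invParity (w * cs.simple i) (cs.simple i) ≠ 0 := by
    rw [invParity_mul, invParity_simple]
    simp [h0]
  have := cs.length_mul_lt_of_invParity h1
  simp at this
  omega

/-! ### Inversions of central elements -/

section Central

variable {w : W} (hw : ∀ x, x * w = w * x)
include hw

/-- Compare the cocycle identities for `xw` and `wx`. -/
theorem invParity_conj_of_central (x t : W) :
    cs.invParity w (x * t * x⁻¹) = cs.invParity w t := by
  have h := cs.invParity_mul x w t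
  rw [hw x, invParity_mul, ← hw t, mul_inv_cancel_right, add_comm] at h
  exact add_right_cancel h

/-- A central element is unchanged by cyclic rotation of a word for it. The chosen letter can be
rotated to the end, so it is a right descent. -/
theorem invParity_letter_of_central (ω₁ ω₂ : List B) (i : B)
    (hω : cs.IsReduced (ω₁ ++ i :: ω₂)) (h : w = cs.wordProd (ω₁ ++ i :: ω₂)) :
    cs.invParity w (cs.simple i) = 1 := by
  have hlen : cs.length w = ω₁.length + ω₂.length + 1 := by
    rw [h, hω.eq]; simp; ring
  have e : w * cs.simple i = cs.wordProd (ω₂ ++ ω₁) := by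
    have h2 : (cs.wordProd ω₁ * cs.simple i)⁻¹ * w = w * (cs.wordProd ω₁ * cs.simple i)⁻¹ := hw _
    have h3 : w = cs.wordProd ω₁ * cs.simple i * cs.wordProd ω₂ := by
      rw [h, wordProd_append, wordProd_cons, mul_assoc]
    have h4 : cs.wordProd ω₂ = w * (cs.simple i * (cs.wordProd ω₁)⁻¹) := by
      rw [← cs.inv_simple i, ← mul_inv_rev, ← h2]
      rw [eq_inv_mul_iff_mul_eq]
      exact h3.symm
    rw [wordProd_append, h4]
    group
  refine cs.invParity_simple_of_descent ?_
  rw [e, hlen]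
  have := cs.length_wordProd_le (ω₂ ++ ω₁)
  rw [List.length_append] at this
  omega

-- For odd `M i j` the two generators are conjugate, so they have equal parity. A kept and a killed
-- generator thus have an even (or zero) entry, and `s^{M i j} = 1` gives the relation.
open scoped Classical in
theorem restrict_isLiftable_of_central : M.IsLiftable fun i =>
    if cs.invParity w (cs.simple i) = 1 then cs.simple i else 1 := by
  have key : ∀ i j, cs.invParity w (cs.simple i) = 1 → cs.invParity w (cs.simple j) ≠ 1 →
      Even (M i j) := by
    intro i j hi hj
    by_contra ho
    rw [Nat.not_even_iff_odd] at ho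
    obtain ⟨m, hm⟩ := ho
    apply hj
    rw [← hi]
    have hp : (cs.simple i * cs.simple j) ^ (2 * m + 1) = 1 := by
      rw [← hm]; exact cs.simple_mul_simple_pow i j
    set g := cs.simple i * cs.simple j with hg
    have hgs : ∀ n : ℕ, cs.simple j * (g ^ n)⁻¹ = g ^ n * cs.simple j := by
      intro n
      induction n with
      | zero => simp
      | succ n ihn =>
        rw [pow_succ', mul_inv_rev, ← mul_assoc, ihn, ← pow_succ', pow_succ, mul_assoc, mul_assoc]
        congr 1
        simp [hg, mul_assoc]
    have e : cs.simple i = g ^ (m + 1) * cs.simple j * (g ^ (m + 1))⁻¹ := by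
      rw [mul_assoc, hgs, ← mul_assoc, ← pow_add, show m + 1 + (m + 1) = 2 * m + 1 + 1 by ring,
        pow_succ, hp, one_mul, hg, mul_assoc, cs.simple_mul_simple_self, mul_one]
    rw [e, cs.invParity_conj_of_central hw]
  intro i j
  by_cases hi : cs.invParity w (cs.simple i) = 1 <;> by_cases hj : cs.invParity w (cs.simple j) = 1
  · simp [hi, hj]
  · obtain ⟨m, hm⟩ := key i j hi hj
    simp [hi, hj, hm, ← two_mul, pow_mul]
  · obtain ⟨m, hm⟩ := key j i hj hi
    rw [M.symmetric] at hm
    simp [hi, hj, hm, ← two_mul, pow_mul]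
  · simp [hi, hj]

/-- A nontrivial central element of a Coxeter group is not in the kernel of some homomorphism
which kills all but finitely many reflections. -/
theorem exists_hom_of_central (hw1 : w ≠ 1) :
    ∃ φ : W →* W, φ w ≠ 1 ∧ {t | cs.IsReflection t ∧ φ t ≠ 1}.Finite := by
  classical
  refine ⟨cs.lift ⟨_, cs.restrict_isLiftable_of_central hw⟩, ?_, ?_⟩
  · obtain ⟨ω, hω, h⟩ := cs.exists_isReduced w
    -- All letters of a reduced word of `w` are descents and so are kept; hence `φ w = w`. Suffixes
    -- make the induction possible.
    have key : ∀ ω' : List B, ω' <:+ ω →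
        cs.lift ⟨_, cs.restrict_isLiftable_of_central hw⟩ (cs.wordProd ω') = cs.wordProd ω' := by
      intro ω' h'
      induction ω' with
      | nil => simp
      | cons i ω' ih =>
        obtain ⟨ω₁, rfl⟩ := h'
        rw [wordProd_cons, map_mul, ih ⟨ω₁ ++ [i], by simp⟩, cs.lift_apply_simple,
          if_pos (cs.invParity_letter_of_central hw ω₁ ω' i hω h)]
    have e := key ω (List.suffix_refl _)
    rw [← h] at e
    rw [e]
    exact hw1
  · refine (cs.invParity_finite w).subset ?_
    -- A reflection conjugate to a killed generator is killed. The others have parity 1 and are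
    -- among the finitely many inversions of `w`.
    rintro t ⟨⟨x, i, rfl⟩, ht⟩
    rw [Set.mem_ofPred_eq, cs.invParity_conj_of_central hw]
    intro h0
    apply ht
    rw [map_mul, map_mul, cs.lift_apply_simple, if_neg (by rw [h0]; decide), mul_one,
      ← map_mul, mul_inv_cancel, map_one]

end Central

end CoxeterSystem

end

noncomputable section

namespace MomentGraph

/-! ## The grading of the symmetric algebra -/

section Grading

variable {k V : Type u} [CommRing k] [AddCommGroup V] [Module k V]

theorem pow_range_le_symDeg (n : ℕ) :
    (LinearMap.range (SymmetricAlgebra.ι k V)) ^ n ≤ symDeg k V (2 * n) :=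
  le_iSup₂_of_le n rfl le_rfl

theorem ι_mem_symDeg (v : V) : SymmetricAlgebra.ι k V v ∈ symDeg k V 2 := by
  refine pow_range_le_symDeg 1 ?_
  rw [pow_one]
  exact ⟨v, rfl⟩

theorem symDeg_induction {d : ℤ} {p : Sym k V → Prop} (zero : p 0)
    (add : ∀ f g, p f → p g → p (f + g))
    (mem : ∀ n : ℕ, 2 * (n : ℤ) = d → ∀ f ∈ (LinearMap.range (SymmetricAlgebra.ι k V)) ^ n, p f)
    {f : Sym k V} (hf : f ∈ symDeg k V d) : p f := by
  refine Submodule.iSup_induction _ (motive := p) hf (fun n f hn => ?_) zero add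
  by_cases h : 2 * (n : ℤ) = d
  · rw [iSup_pos h] at hn
    exact mem n h f hn
  · rw [iSup_neg h] at hn
    rw [(Submodule.mem_bot k).mp hn]
    exact zero

instance symDeg_gradedMonoid : SetLike.GradedMonoid (symDeg k V) where
  one_mem := by
    refine pow_range_le_symDeg 0 ?_
    rw [pow_zero]
    exact Submodule.one_le.mp le_rfl
  mul_mem := by
    intro d e f g hf hg
    refine symDeg_induction (p := fun f => f * g ∈ symDeg k V (d + e)) ?_ ?_ ?_ hf
    · rw [zero_mul]; exact zero_mem _
    · intro f f' h h'; rw [add_mul]; exact add_mem h h'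
    · rintro n rfl f hf
      refine symDeg_induction (p := fun g => f * g ∈ symDeg k V (2 * n + e)) ?_ ?_ ?_ hg
      · rw [mul_zero]; exact zero_mem _
      · intro g g' h h'; rw [mul_add]; exact add_mem h h'
      · rintro m rfl g hg
        have := pow_range_le_symDeg (n + m) (by rw [pow_add]; exact Submodule.mul_mem_mul hf hg)
        convert this using 2
        push_cast
        ring

/-- The canonical map from `V` to the degree two part of `R`. -/
def symDegι (k V : Type u) [CommRing k] [AddCommGroup V] [Module k V] :
    V →ₗ[k] DirectSum ℤ fun d => symDeg k V d :=
  DirectSum.lof k ℤ (fun d => symDeg k V d) 2 ∘ₗ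
    (SymmetricAlgebra.ι k V).codRestrict _ ι_mem_symDeg

theorem symDegι_apply (v : V) : symDegι k V v =
    DirectSum.of (fun d => symDeg k V d) 2 ⟨SymmetricAlgebra.ι k V v, ι_mem_symDeg v⟩ := rfl

theorem coeAlgHom_comp_lift_symDegι :
    (DirectSum.coeAlgHom (symDeg k V)).comp (SymmetricAlgebra.lift (symDegι k V)) =
      AlgHom.id k (Sym k V) := by
  refine SymmetricAlgebra.algHom_ext (LinearMap.ext fun v => ?_)
  have h : (DirectSum.coeAlgHom (symDeg k V)) (symDegι k V v) = SymmetricAlgebra.ι k V v := by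
    rw [symDegι_apply, DirectSum.coeAlgHom_of]
  rw [← SymmetricAlgebra.lift_ι_apply (symDegι k V) v] at h
  exact h

theorem symDeg_of_congr {d e : ℤ} (f : symDeg k V d) (g : symDeg k V e) (hde : d = e)
    (hfg : (f : Sym k V) = g) : DirectSum.of (fun d => symDeg k V d) d f =
      DirectSum.of (fun d => symDeg k V d) e g := by
  subst hde
  rw [Subtype.ext hfg]

theorem lift_symDegι_pow (n : ℕ) (f : Sym k V)
    (hf : f ∈ (LinearMap.range (SymmetricAlgebra.ι k V)) ^ n) :
    SymmetricAlgebra.lift (symDegι k V) f =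
      DirectSum.of (fun d => symDeg k V d) (2 * n) ⟨f, pow_range_le_symDeg n hf⟩ := by
  induction hf using Submodule.pow_induction_on_left' with
  | algebraMap c =>
    rw [AlgHom.commutes, DirectSum.algebraMap_apply]
    refine symDeg_of_congr _ _ (by norm_num) ?_
    exact SetLike.GradeZero.coe_algebraMap (symDeg k V) c
  | add x y i hx hy ihx ihy =>
    rw [map_add, ihx, ihy, ← map_add, AddMemClass.mk_add_mk]
  | mem_mul m hm i x hx ih =>
    obtain ⟨v, rfl⟩ := hm
    rw [map_mul, ih, SymmetricAlgebra.lift_ι_apply, symDegι_apply, DirectSum.of_mul_of]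
    refine symDeg_of_congr _ _ ?_ (SetLike.coe_gMul (symDeg k V) _ _)
    push_cast
    ring

theorem lift_symDegι_apply (d : ℤ) (f : symDeg k V d) :
    SymmetricAlgebra.lift (symDegι k V) (f : Sym k V) =
      DirectSum.of (fun d => symDeg k V d) d f := by
  obtain ⟨f, hf⟩ := f
  obtain ⟨_, h⟩ := symDeg_induction (p := fun f => ∃ hf : f ∈ symDeg k V d,
      SymmetricAlgebra.lift (symDegι k V) f = DirectSum.of (fun d => symDeg k V d) d ⟨f, hf⟩)
      ⟨zero_mem _, by rw [map_zero]; exact (map_zero _).symm⟩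
      (fun f g ⟨hf, ef⟩ ⟨hg, eg⟩ => ⟨add_mem hf hg, by rw [map_add, ef, eg, ← map_add]; rfl⟩)
      (by rintro n rfl f hf; exact ⟨_, lift_symDegι_pow n f hf⟩) hf
  exact h

/-- The universal property of `S(V)` supplies the decomposition map: it is the algebra map sending
`v` to its copy in degree 2. -/
instance symDeg_gradedAlgebra : GradedAlgebra (symDeg k V) :=
  GradedAlgebra.ofAlgHom _ (SymmetricAlgebra.lift (symDegι k V)) coeAlgHom_comp_lift_symDegι
    lift_symDegι_apply

theorem symDeg_isInternal :
    DirectSum.IsInternal fun d => (symDeg k V d).toAddSubgroup :=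
  DirectSum.Decomposition.isInternal (symDeg k V)

theorem symDeg_map {d : ℤ} (φ : V →ₗ[k] V) {f : Sym k V} (hf : f ∈ symDeg k V d) :
    SymmetricAlgebra.lift (SymmetricAlgebra.ι k V ∘ₗ φ) f ∈ symDeg k V d := by
  refine symDeg_induction (p := fun f => SymmetricAlgebra.lift (SymmetricAlgebra.ι k V ∘ₗ φ) f ∈
    symDeg k V d) (by simp) (fun f g hf hg => by rw [map_add]; exact add_mem hf hg) ?_ hf
  rintro n rfl f hf
  refine pow_range_le_symDeg n ?_
  have h := Submodule.mem_map_of_mem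
    (f := (SymmetricAlgebra.lift (SymmetricAlgebra.ι k V ∘ₗ φ)).toLinearMap) hf
  rw [Submodule.map_pow] at h
  refine pow_le_pow_left' (M := Submodule k (Sym k V)) ?_ n h
  rintro _ ⟨_, ⟨v, rfl⟩, rfl⟩
  exact ⟨φ v, by simp⟩

/-- The component of `f q` in degree `e + j` is `f q_j`, so `q_j = 0` unless `e + j = d`. -/
theorem mem_symDeg_of_mul [IsDomain (Sym k V)] {d e : ℤ} {f q : Sym k V} (hf : f ∈ symDeg k V e)
    (hf0 : f ≠ 0) (h : f * q ∈ symDeg k V d) : q ∈ symDeg k V (d - e) := by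
  classical
  have h1 : ∀ j, j ≠ d - e → (DirectSum.decompose (symDeg k V) q j : Sym k V) = 0 := by
    intro j hj
    have h2 := DirectSum.coe_decompose_mul_add_of_left_mem (symDeg k V) (j := j) (b := q) hf
    rw [DirectSum.decompose_of_mem_ne (symDeg k V) h (by omega)] at h2
    exact (mul_eq_zero.mp h2.symm).resolve_left hf0
  rw [← DirectSum.sum_support_decompose (symDeg k V) q]
  refine Submodule.sum_mem _ fun j _ => ?_
  by_cases hj : j = d - e
  · rw [← hj]; exact Subtype.property _
  · rw [h1 j hj]; exact zero_mem _

end Grading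

/-! ## Roots -/

section Roots

variable {k : Type u} [CommRing k] {W : Type u} [Group W] {B : Type v} {C : CoxeterMatrix B}
  {cs : CoxeterSystem C W} {V : Type u} [AddCommGroup V] [Module k V] (r : Realization k cs V)

theorem Realization.act_one (f : Sym k V) : r.act 1 f = f := by
  have : r.act 1 = AlgHom.id k _ := by
    refine SymmetricAlgebra.algHom_ext ?_
    ext v
    simp [r.act_ι]
  rw [this]; rfl

theorem Realization.act_mul (x y : W) (f : Sym k V) : r.act (x * y) f = r.act x (r.act y f) := by
  have : r.act (x * y) = (r.act x).comp (r.act y) := by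
    refine SymmetricAlgebra.algHom_ext ?_
    ext v
    simp [r.act_ι]
  rw [this]; rfl

theorem Realization.act_inv_act (x : W) (f : Sym k V) : r.act x⁻¹ (r.act x f) = f := by
  rw [← r.act_mul, inv_mul_cancel, r.act_one]

theorem Realization.act_act_inv (x : W) (f : Sym k V) : r.act x (r.act x⁻¹ f) = f := by
  rw [← r.act_mul, mul_inv_cancel, r.act_one]

theorem Realization.act_simple_act_simple (i : B) (f : Sym k V) :
    r.act (cs.simple i) (r.act (cs.simple i) f) = f := by
  rw [← r.act_mul, cs.simple_mul_simple_self, r.act_one]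

theorem Realization.act_injective (x : W) : Function.Injective (r.act x) :=
  Function.LeftInverse.injective (r.act_inv_act x)

theorem Realization.act_eq_zero_iff (x : W) {f : Sym k V} : r.act x f = 0 ↔ f = 0 :=
  map_eq_zero_iff _ (r.act_injective x)

theorem Realization.act_mem_symDeg (x : W) {d : ℤ} {f : Sym k V} (hf : f ∈ symDeg k V d) :
    r.act x f ∈ symDeg k V d := symDeg_map _ hf

theorem ι_injective [Module.Free k V] : Function.Injective (SymmetricAlgebra.ι k V) := by
  let b := Module.Free.chooseBasis k V
  intro v w h
  have h1 : ∀ v, SymmetricAlgebra.equivMvPolynomial b (SymmetricAlgebra.ι k V v) =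
      ∑ i ∈ (b.repr v).support, MvPolynomial.monomial (Finsupp.single i 1) (b.repr v i) := by
    intro v
    conv_lhs => rw [← b.linearCombination_repr v]
    rw [Finsupp.linearCombination_apply, Finsupp.sum]
    simp only [map_sum, map_smul, SymmetricAlgebra.equivMvPolynomial_ι_apply, MvPolynomial.X,
      MvPolynomial.smul_monomial, smul_eq_mul, mul_one]
  apply b.repr.injective
  ext i
  have h2 : ∀ v, MvPolynomial.coeff (Finsupp.single i 1)
      (SymmetricAlgebra.equivMvPolynomial b (SymmetricAlgebra.ι k V v)) = b.repr v i := by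
    intro v
    classical
    rw [h1, MvPolynomial.coeff_sum]
    simp only [MvPolynomial.coeff_monomial]
    simp only [Finsupp.single_left_inj one_ne_zero, Finset.sum_ite_eq', Finsupp.mem_support_iff,
      ne_eq, ite_not]
    split_ifs with h
    · exact h.symm
    · rfl
  rw [← h2 v, ← h2 w, h]

variable {r}

theorem Realization.isRoot_simple (i : B) : r.IsRoot (cs.simple i) (r.α i) :=
  ⟨1, i, by simp, by simp⟩

theorem Realization.IsRoot.conj {t : W} {a : V} (h : r.IsRoot t a) (x : W) :
    r.IsRoot (x * t * x⁻¹) (r.ρ x a) := by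
  obtain ⟨u, i, rfl, rfl⟩ := h
  exact ⟨x * u, i, by group, by simp⟩

theorem Realization.IsRoot.isReflection {t : W} {a : V} (h : r.IsRoot t a) :
    cs.IsReflection t := by
  obtain ⟨u, i, rfl, rfl⟩ := h
  exact ⟨u, i, rfl⟩

theorem Realization.ρ_inv_ρ (x : W) (v : V) : r.ρ x⁻¹ (r.ρ x v) = v := by
  rw [← Module.End.mul_apply, ← map_mul]; simp

theorem Realization.ρ_ρ_inv (x : W) (v : V) : r.ρ x (r.ρ x⁻¹ v) = v := by
  rw [← Module.End.mul_apply, ← map_mul]; simp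

theorem Realization.IsRoot.exists_coroot {t : W} {a : V} (h : r.IsRoot t a) :
    ∃ φ : Module.Dual k V, Function.Surjective φ ∧ ∀ v, r.ρ t v = v - φ v • a := by
  obtain ⟨u, i, rfl, rfl⟩ := h
  refine ⟨r.αv i ∘ₗ r.ρ u⁻¹, ?_, ?_⟩
  · intro c
    obtain ⟨v, hv⟩ := r.surjective i c
    exact ⟨r.ρ u v, by rw [LinearMap.comp_apply, Realization.ρ_inv_ρ, hv]⟩
  · intro v
    rw [map_mul, map_mul, Module.End.mul_apply, Module.End.mul_apply, r.simple_apply, map_sub,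
      Realization.ρ_ρ_inv, map_smul]
    rfl

theorem Realization.IsRoot.ne_zero {t : W} {a : V} (h : r.IsRoot t a) : a ≠ 0 := by
  obtain ⟨u, i, rfl, rfl⟩ := h
  intro h0
  apply r.ne_zero i
  rw [← Realization.ρ_inv_ρ (r := r) u (r.α i), h0, map_zero]

/-- Both vectors describe `v - t(v) = φ(v) a = ψ(v) b`; evaluate where `ψ(v) = 1`. -/
theorem Realization.IsRoot.exists_smul {t : W} {a b : V} (ha : r.IsRoot t a) (hb : r.IsRoot t b) :
    ∃ c : k, b = c • a := by
  obtain ⟨φ, -, hφ'⟩ := ha.exists_coroot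
  obtain ⟨ψ, hψ, hψ'⟩ := hb.exists_coroot
  obtain ⟨v, hv⟩ := hψ 1
  refine ⟨φ v, ?_⟩
  have h := (hφ' v).symm.trans (hψ' v)
  rw [hv, one_smul] at h
  exact (sub_right_injective h).symm

theorem Realization.IsRoot.dvd {t : W} {a b : V} (ha : r.IsRoot t a) (hb : r.IsRoot t b) :
    SymmetricAlgebra.ι k V a ∣ SymmetricAlgebra.ι k V b := by
  obtain ⟨c, rfl⟩ := ha.exists_smul hb
  rw [map_smul, Algebra.smul_def]
  exact dvd_mul_left _ _

theorem Realization.IsRoot.exists_dual {t : W} {a : V} (h : r.IsRoot t a)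
    (hα : ∀ i, Function.Surjective fun f : Module.Dual k V => f (r.α i)) :
    ∃ φ : Module.Dual k V, φ a = 1 := by
  obtain ⟨u, i, rfl, rfl⟩ := h
  obtain ⟨φ, hφ⟩ := hα i 1
  refine ⟨φ ∘ₗ r.ρ u⁻¹, ?_⟩
  rw [LinearMap.comp_apply, Realization.ρ_inv_ρ]
  exact hφ

/-- The projection `v ↦ v - φ(v) a` extends to an endomorphism `π` of `S(V)` that kills `a` and is
the identity modulo `a`. Applying `π` to the divisibility gives `π(b) π(f) = 0` in a domain, with
`π(b) ≠ 0`. -/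
theorem ι_dvd_of_dvd_mul [IsDomain k] [Module.Free k V] {a b : V} {φ : Module.Dual k V}
    (hφ : φ a = 1) (hb : ∀ c : k, b ≠ c • a) {f : Sym k V}
    (h : SymmetricAlgebra.ι k V a ∣ SymmetricAlgebra.ι k V b * f) :
    SymmetricAlgebra.ι k V a ∣ f := by
  let π : Sym k V →ₐ[k] Sym k V := SymmetricAlgebra.lift
    (SymmetricAlgebra.ι k V ∘ₗ (LinearMap.id - φ.smulRight a))
  have hπ : ∀ v, π (SymmetricAlgebra.ι k V v) = SymmetricAlgebra.ι k V (v - φ v • a) := by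
    intro v
    simp [π]
  have hsub : ∀ f, SymmetricAlgebra.ι k V a ∣ f - π f := by
    intro f
    induction f using SymmetricAlgebra.induction with
    | algebraMap c => simp
    | ι v =>
      rw [hπ, map_sub, sub_sub_cancel, map_smul, Algebra.smul_def]
      exact dvd_mul_left _ _
    | mul f g hf hg =>
      rw [map_mul, show f * g - π f * π g = (f - π f) * g + π f * (g - π g) by ring]
      exact dvd_add (hf.mul_right _) (hg.mul_left _)
    | add f g hf hg =>
      rw [map_add, add_sub_add_comm]
      exact dvd_add hf hg
  obtain ⟨q, hq⟩ := h
  have h0 : π (SymmetricAlgebra.ι k V a) = 0 := by rw [hπ, hφ, one_smul, sub_self, map_zero]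
  have h1 := congrArg π hq
  rw [map_mul, map_mul, h0, zero_mul, mul_eq_zero] at h1
  rcases h1 with h1 | h1
  · rw [hπ, ← map_zero (SymmetricAlgebra.ι k V)] at h1
    exact absurd (sub_eq_zero.mp (ι_injective h1)) (hb _)
  · have := hsub f
    rwa [h1, sub_zero] at this

theorem Realization.IsRoot.dvd_of_dvd_mul [IsDomain k] [Module.Free k V]
    (hα : ∀ i, Function.Surjective fun f : Module.Dual k V => f (r.α i)) (hGKM : r.GKM)
    {t t' : W} (hne : t ≠ t') {a b : V} (ha : r.IsRoot t a) (hb : r.IsRoot t' b) {f : Sym k V}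
    (h : SymmetricAlgebra.ι k V a ∣ SymmetricAlgebra.ι k V b * f) :
    SymmetricAlgebra.ι k V a ∣ f := by
  obtain ⟨φ, hφ⟩ := ha.exists_dual hα
  refine ι_dvd_of_dvd_mul hφ (fun c hc => ?_) h
  have h1 := LinearIndependent.pair_iff.mp (hGKM t t' a b ha hb hne) c (-1) (by rw [hc]; simp)
  exact neg_ne_zero.mpr one_ne_zero h1.2

theorem Realization.IsRoot.ι_ne_zero [Module.Free k V] {t : W} {a : V} (h : r.IsRoot t a) :
    SymmetricAlgebra.ι k V a ≠ 0 := by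
  rw [ne_eq, ← map_zero (SymmetricAlgebra.ι k V)]
  exact fun h0 => h.ne_zero (ι_injective h0)

theorem Realization.act_simple_α (i : B) :
    r.act (cs.simple i) (SymmetricAlgebra.ι k V (r.α i)) = -SymmetricAlgebra.ι k V (r.α i) := by
  rw [r.act_ι, r.simple_apply, r.pairing, ← map_neg]
  congr 1
  rw [two_smul]; abel

theorem Realization.ρ_mul_simple_α (w : W) (i : B) :
    r.ρ (w * cs.simple i) (r.α i) = -r.ρ w (r.α i) := by
  rw [map_mul, Module.End.mul_apply, r.simple_apply, r.pairing, ← map_neg]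
  congr 1
  rw [two_smul]; abel

theorem Realization.isRoot_ρ_α (w : W) (i : B) :
    r.IsRoot (w * cs.simple i * w⁻¹) (r.ρ w (r.α i)) := ⟨w, i, rfl, rfl⟩

/-- An element acting trivially on `V` is central. -/
theorem Realization.central_of_ρ_eq (hGKM : r.GKM) [Nontrivial k] {w : W} (hw : ∀ v, r.ρ w v = v)
    (x : W) : x * w = w * x := by
  induction x using cs.simple_induction_left with
  | one => simp
  | mul_simple_left x i ih =>
    -- Since `w` fixes `α_s`, both `s` and `w s w⁻¹` have the root `α_s`, and GKM identifies them.
    have h : w * cs.simple i * w⁻¹ = cs.simple i := by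
      by_contra hne
      have h1 := r.isRoot_ρ_α w i
      rw [hw] at h1
      have h2 := LinearIndependent.pair_iff.mp (hGKM _ _ _ _ h1 (Realization.isRoot_simple i) hne) 1 (-1)
        (by simp)
      exact one_ne_zero h2.1
    rw [mul_inv_eq_iff_eq_mul] at h
    rw [mul_assoc, ih, ← mul_assoc, ← mul_assoc, h]

end Roots

end MomentGraph

end

noncomputable section

namespace MomentGraph

/-! ## Rings with an involution and a Demazure operator -/

/-- An involution `σ` of a commutative ring such that all `z - σ z` are divisible by a regular
element `a`, which is itself of this form. -/
structure DemazureDatum (Z : Type*) [CommRing Z] where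
  σ : Z →+* Z
  σ_σ : ∀ z, σ (σ z) = z
  a : Z
  regular : ∀ z, a * z = 0 → z = 0
  gen : Z
  gen_sub : gen - σ gen = a
  exists_quot : ∀ z, ∃ q, z - σ z = a * q

namespace DemazureDatum

variable {Z : Type*} [CommRing Z] (D : DemazureDatum Z)

/-- The Demazure operator. -/
def q (z : Z) : Z := (D.exists_quot z).choose

theorem a_mul_q (z : Z) : D.a * D.q z = z - D.σ z := (D.exists_quot z).choose_spec.symm

/-- The coefficient of `1` in the expansion of `z` with respect to `1` and `gen`. -/
def p (z : Z) : Z := z - D.q z * D.gen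

variable {D} in
theorem cancel {x y : Z} (h : D.a * x = D.a * y) : x = y :=
  sub_eq_zero.mp (D.regular _ (by rw [mul_sub, h, sub_self]))

theorem q_eq {z y : Z} (h : z - D.σ z = D.a * y) : D.q z = y :=
  D.cancel (by rw [a_mul_q, h])

theorem σ_a : D.σ D.a = -D.a := by
  rw [← D.gen_sub, map_sub, D.σ_σ]; ring

theorem σ_q (z : Z) : D.σ (D.q z) = D.q z := by
  refine D.cancel ?_
  have h := congrArg D.σ (D.a_mul_q z)
  rw [map_mul, σ_a, map_sub, D.σ_σ] at h
  rw [a_mul_q]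
  linear_combination -h

theorem σ_p (z : Z) : D.σ (D.p z) = D.p z := by
  rw [p, map_sub, map_mul, σ_q]
  linear_combination D.a_mul_q z + D.q z * D.gen_sub

theorem p_add_q (z : Z) : D.p z + D.q z * D.gen = z := by rw [p]; ring

theorem q_add (y z : Z) : D.q (y + z) = D.q y + D.q z :=
  D.q_eq (by rw [mul_add, a_mul_q, a_mul_q, map_add]; ring)

theorem q_mul {x : Z} (hx : D.σ x = x) (z : Z) : D.q (x * z) = x * D.q z :=
  D.q_eq (by rw [map_mul, hx]; linear_combination -x * D.a_mul_q z)

theorem q_fixed {x : Z} (hx : D.σ x = x) : D.q x = 0 := D.q_eq (by rw [hx]; ring)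

theorem q_gen : D.q D.gen = 1 := D.q_eq (by rw [D.gen_sub]; ring)

theorem p_add (y z : Z) : D.p (y + z) = D.p y + D.p z := by
  simp only [p, q_add]; ring

theorem p_mul {x : Z} (hx : D.σ x = x) (z : Z) : D.p (x * z) = x * D.p z := by
  simp only [p, D.q_mul hx]; ring

theorem p_fixed {x : Z} (hx : D.σ x = x) : D.p x = x := by
  rw [p, D.q_fixed hx]; ring

theorem p_gen : D.p D.gen = 0 := by rw [p, q_gen]; ring

/-- Expand `z = p z + q z · gen` and use linearity over the invariants. Together with `q_mul_eq`
this says that the 2 × 2 matrices of multiplication operators multiply correctly. -/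
theorem p_mul_eq (y z : Z) : D.p (y * z) = D.p y * D.p z + D.q z * D.p (y * D.gen) := by
  conv_lhs => rw [← D.p_add_q z, mul_add, D.p_add, mul_comm y, D.p_mul (D.σ_p z),
    show y * (D.q z * D.gen) = D.q z * (y * D.gen) by ring, D.p_mul (D.σ_q z)]
  ring

theorem q_mul_eq (y z : Z) : D.q (y * z) = D.q y * D.p z + D.q z * D.q (y * D.gen) := by
  conv_lhs => rw [← D.p_add_q z, mul_add, D.q_add, mul_comm y, D.q_mul (D.σ_p z),
    show y * (D.q z * D.gen) = D.q z * (y * D.gen) by ring, D.q_mul (D.σ_q z)]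
  ring

/-- Two data are independent if the involutions commute and fix the data of each other. -/
structure Indep (D E : DemazureDatum Z) : Prop where
  comm : ∀ z, D.σ (E.σ z) = E.σ (D.σ z)
  fix_a : D.σ E.a = E.a
  fix_gen : D.σ E.gen = E.gen
  fix_a' : E.σ D.a = D.a
  fix_gen' : E.σ D.gen = D.gen

variable {D} {E : DemazureDatum Z}

/-- Multiplied by both regular elements, each side becomes `(1 - σ_D)(1 - σ_E) z`. -/
theorem Indep.q_q (h : Indep D E) (z : Z) : D.q (E.q z) = E.q (D.q z) := by
  refine D.cancel (E.cancel ?_)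
  have h1 := congrArg D.σ (E.a_mul_q z)
  have h2 := congrArg E.σ (D.a_mul_q z)
  rw [map_mul, h.fix_a, map_sub] at h1
  rw [map_mul, h.fix_a', map_sub] at h2
  linear_combination E.a * D.a_mul_q (E.q z) - D.a * E.a_mul_q (D.q z) + E.a_mul_q z
    - D.a_mul_q z - h1 + h2 + h.comm z

theorem Indep.q_p (h : Indep D E) (z : Z) : D.q (E.p z) = E.p (D.q z) := by
  have h1 : D.q (E.p z) + D.q (E.q z * E.gen) = D.q z := by rw [← q_add, E.p_add_q]
  rw [mul_comm, D.q_mul h.fix_gen, h.q_q] at h1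
  linear_combination h1 - E.p_add_q (D.q z)

theorem Indep.symm (h : Indep D E) : Indep E D :=
  ⟨fun z => (h.comm z).symm, h.fix_a', h.fix_gen', h.fix_a, h.fix_gen⟩

theorem Indep.p_p (h : Indep D E) (z : Z) : D.p (E.p z) = E.p (D.p z) := by
  have h1 : E.p (D.p z) + E.p (D.q z * D.gen) = E.p z := by rw [← p_add, D.p_add_q]
  rw [mul_comm, E.p_mul h.fix_gen', ← h.q_p] at h1
  linear_combination D.p_add_q (E.p z) - h1

end DemazureDatum

/-! ## The structure algebra -/

section StructureAlgebra

variable {k : Type u} [CommRing k] {W : Type u} [Group W] {B : Type v} {C : CoxeterMatrix B}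
  {cs : CoxeterSystem C W} {V : Type u} [AddCommGroup V] [Module k V] {r : Realization k cs V}

theorem Realization.Z_ext {y z : r.Z}
    (h : ∀ w, (y : W → Sym k V) w = (z : W → Sym k V) w) : y = z :=
  Subtype.ext (funext h)

/-- The constant families in the structure algebra. -/
def Realization.const (r : Realization k cs V) : Sym k V →+* r.Z := algebraMap (Sym k V) r.Z

theorem Realization.const_apply (f : Sym k V) (w : W) :
    (r.const f : W → Sym k V) w = f := rfl

theorem Realization.toZRight_apply (f : Sym k V) (w : W) :
    (r.toZRight f : W → Sym k V) w = r.act w f := rfl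

theorem Realization.Z_add_apply (y z : r.Z) (w : W) :
    ((y + z : r.Z) : W → Sym k V) w = (y : W → Sym k V) w + (z : W → Sym k V) w := rfl

theorem Realization.Z_sub_apply (y z : r.Z) (w : W) :
    ((y - z : r.Z) : W → Sym k V) w = (y : W → Sym k V) w - (z : W → Sym k V) w := rfl

theorem Realization.Z_mul_apply (y z : r.Z) (w : W) :
    ((y * z : r.Z) : W → Sym k V) w = (y : W → Sym k V) w * (z : W → Sym k V) w := rfl

theorem Realization.const_mul_apply (f : Sym k V) (z : r.Z) (w : W) :
    ((r.const f * z : r.Z) : W → Sym k V) w = f * (z : W → Sym k V) w := rfl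

theorem Realization.envToZ_tmul (f g : Sym k V) :
    r.envToZ (f ⊗ₜ[k] g) = r.const f * r.toZRight g := rfl

/-- The involution `(z_w) ↦ (z_{ws})`. -/
def Realization.σR (r : Realization k cs V) (i : B) : r.Z →+* r.Z where
  toFun z := ⟨fun w => (z : W → Sym k V) (w * cs.simple i), fun t a w h => by
    have := z.2 t a (w * cs.simple i) h
    rwa [← mul_assoc] at this⟩
  map_one' := rfl
  map_mul' _ _ := rfl
  map_zero' := rfl
  map_add' _ _ := rfl

theorem Realization.σR_apply (i : B) (z : r.Z) (w : W) :
    (r.σR i z : W → Sym k V) w = (z : W → Sym k V) (w * cs.simple i) := rfl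

theorem Realization.dvd_act_self_sub {t : W} {a : V} (h : r.IsRoot t a) (f : Sym k V) :
    SymmetricAlgebra.ι k V a ∣ r.act t f - f := by
  have := r.dvd_act_sub t 1 a h f
  rwa [mul_one, r.act_one] at this

/-- The involution `(z_w) ↦ (s(z_{sw}))`. -/
def Realization.σL (r : Realization k cs V) (i : B) : r.Z →+* r.Z where
  toFun z := ⟨fun w => r.act (cs.simple i) ((z : W → Sym k V) (cs.simple i * w)),
    fun t a w h => by
      have h1 : cs.simple i * (t * w) = (cs.simple i * t * (cs.simple i)⁻¹) * (cs.simple i * w) := by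
        group
      have h2 := z.2 _ _ (cs.simple i * w) (h.conj (cs.simple i))
      change _ ∣ r.act _ ((z : W → Sym k V) (cs.simple i * (t * w))) - r.act _ _
      rw [h1, ← map_sub]
      obtain ⟨q, hq⟩ := h2
      rw [hq, map_mul, r.act_ι, ← Module.End.mul_apply, ← map_mul, cs.simple_mul_simple_self,
        map_one]
      exact dvd_mul_right _ _⟩
  map_one' := Subtype.ext (funext fun _ => map_one _)
  map_mul' _ _ := Subtype.ext (funext fun _ => map_mul _ _ _)
  map_zero' := Subtype.ext (funext fun _ => map_zero _)
  map_add' _ _ := Subtype.ext (funext fun _ => map_add _ _ _)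

theorem Realization.σL_apply (i : B) (z : r.Z) (w : W) :
    (r.σL i z : W → Sym k V) w =
      r.act (cs.simple i) ((z : W → Sym k V) (cs.simple i * w)) := rfl

variable (r) in
/-- An element `δ` of `V` with `⟨α_s^∨, δ⟩ = 1`. -/
def Realization.δ (i : B) : V := (r.surjective i 1).choose

theorem Realization.αv_δ (i : B) : r.αv i (r.δ i) = 1 := (r.surjective i 1).choose_spec

theorem Realization.ι_δ_sub (i : B) :
    SymmetricAlgebra.ι k V (r.δ i) - r.act (cs.simple i) (SymmetricAlgebra.ι k V (r.δ i)) =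
      SymmetricAlgebra.ι k V (r.α i) := by
  rw [r.act_ι, r.simple_apply, Realization.αv_δ, one_smul, map_sub, sub_sub_cancel]

/-! ### Left and right Demazure operators on the structure algebra -/

variable [IsDomain k] [Module.Free k V]

omit [IsDomain k] in
theorem Realization.ι_ρ_α_ne_zero (w : W) (i : B) : SymmetricAlgebra.ι k V (r.ρ w (r.α i)) ≠ 0 :=
  (r.isRoot_ρ_α w i).ι_ne_zero

omit [IsDomain k] in
theorem Realization.ι_α_ne_zero (i : B) : SymmetricAlgebra.ι k V (r.α i) ≠ 0 :=
  (Realization.isRoot_simple i).ι_ne_zero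

variable (r) in
/-- The Demazure operator on `R`. -/
def Realization.symDatum (i : B) : DemazureDatum (Sym k V) where
  σ := (r.act (cs.simple i)).toRingHom
  σ_σ f := r.act_simple_act_simple i f
  a := SymmetricAlgebra.ι k V (r.α i)
  regular f h := (mul_eq_zero.mp h).resolve_left (Realization.ι_α_ne_zero i)
  gen := SymmetricAlgebra.ι k V (r.δ i)
  gen_sub := Realization.ι_δ_sub i
  exists_quot f := by
    obtain ⟨q, hq⟩ := Realization.dvd_act_self_sub (Realization.isRoot_simple (r := r) i) f
    refine ⟨-q, ?_⟩
    rw [mul_neg, ← hq, neg_sub]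
    rfl

variable (hα : ∀ i, Function.Surjective fun f : Module.Dual k V => f (r.α i)) (hGKM : r.GKM)

-- The quotient exists at each `w` by the congruence along `w s w⁻¹`. For this reflection it takes
-- the same value at `w` and `ws`, as numerator and denominator both change sign. For any other `t`,
-- the congruence for the quotient may be checked after multiplication by `w(α_s)`.
include hα hGKM in
theorem Realization.exists_quot_right (i : B) (z : r.Z) :
    ∃ q, z - r.σR i z = r.toZRight (SymmetricAlgebra.ι k V (r.α i)) * q := by
  have h : ∀ w, ∃ q, (z : W → Sym k V) w - (z : W → Sym k V) (w * cs.simple i) =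
      SymmetricAlgebra.ι k V (r.ρ w (r.α i)) * q := by
    intro w
    obtain ⟨q, hq⟩ := z.2 _ _ w (r.isRoot_ρ_α w i)
    refine ⟨-q, ?_⟩
    rw [inv_mul_cancel_right] at hq
    rw [mul_neg, ← hq, neg_sub]
  choose q hq using h
  refine ⟨⟨q, fun t a w ht => ?_⟩, Realization.Z_ext fun w => ?_⟩
  · by_cases hne : t = w * cs.simple i * w⁻¹
    · have e : q (t * w) = q w := by
        rw [hne, inv_mul_cancel_right]
        refine mul_left_cancel₀ (Realization.ι_ρ_α_ne_zero (r := r) w i) ?_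
        have h1 := hq (w * cs.simple i)
        rw [cs.simple_mul_simple_cancel_right, Realization.ρ_mul_simple_α, map_neg] at h1
        linear_combination hq w + h1
      rw [e, sub_self]
      exact dvd_zero _
    · refine ht.dvd_of_dvd_mul hα hGKM hne (r.isRoot_ρ_α w i) ?_
      -- The last term accounts for the denominator changing from `w(α_s)` to `tw(α_s)`; all three
      -- terms are divisible by `α_t`.
      have e : SymmetricAlgebra.ι k V (r.ρ w (r.α i)) * (q (t * w) - q w) =
          ((z : W → Sym k V) (t * w) - (z : W → Sym k V) w) -
          ((z : W → Sym k V) (t * (w * cs.simple i)) - (z : W → Sym k V) (w * cs.simple i)) -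
          (r.act (t * w) (SymmetricAlgebra.ι k V (r.α i)) -
            r.act w (SymmetricAlgebra.ι k V (r.α i))) * q (t * w) := by
        have h1 := hq (t * w)
        rw [r.act_ι, r.act_ι, ← mul_assoc]
        linear_combination hq w - h1
      rw [e]
      exact dvd_sub (dvd_sub (z.2 _ _ _ ht) (z.2 _ _ _ ht)) ((r.dvd_act_sub _ _ _ ht _).mul_right _)
  · rw [Realization.Z_mul_apply, Realization.toZRight_apply, r.act_ι]
    exact hq w

/-- The Demazure operator `z ↦ ((z_w - z_{ws}) / w(α_s))_w`. -/
def Realization.rightDatum (i : B) : DemazureDatum r.Z where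
  σ := r.σR i
  σ_σ z := Realization.Z_ext fun w => by
    rw [Realization.σR_apply, Realization.σR_apply, cs.simple_mul_simple_cancel_right]
  a := r.toZRight (SymmetricAlgebra.ι k V (r.α i))
  regular z h := Realization.Z_ext fun w => by
    have h1 := congrFun (congrArg Subtype.val h) w
    rw [Realization.Z_mul_apply, Realization.toZRight_apply, r.act_ι] at h1
    exact (mul_eq_zero.mp h1).resolve_left (Realization.ι_ρ_α_ne_zero w i)
  gen := r.toZRight (SymmetricAlgebra.ι k V (r.δ i))
  gen_sub := Realization.Z_ext fun w => by
    rw [Realization.Z_sub_apply, Realization.σR_apply, Realization.toZRight_apply,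
      Realization.toZRight_apply, Realization.toZRight_apply, r.act_mul, ← map_sub,
      Realization.ι_δ_sub]
  exists_quot := Realization.exists_quot_right hα hGKM i

-- Modulo `α_s` one has `z_w ≡ z_{sw} ≡ s(z_{sw})`, so the quotient exists at each `w`. It satisfies
-- `q_{sw} = s(q_w)`, which settles the congruence for `t = s`; for other `t` the denominator `α_s`
-- can be cancelled modulo `α_t`.
include hα hGKM in
theorem Realization.exists_quot_left (i : B) (z : r.Z) :
    ∃ q, z - r.σL i z = r.const (SymmetricAlgebra.ι k V (r.α i)) * q := by
  have h : ∀ w, ∃ q, (z : W → Sym k V) w -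
      r.act (cs.simple i) ((z : W → Sym k V) (cs.simple i * w)) =
      SymmetricAlgebra.ι k V (r.α i) * q := by
    intro w
    obtain ⟨q, hq⟩ := z.2 _ _ w (Realization.isRoot_simple i)
    obtain ⟨q', hq'⟩ := Realization.dvd_act_self_sub (Realization.isRoot_simple (r := r) i)
      ((z : W → Sym k V) (cs.simple i * w))
    exact ⟨-q - q', by linear_combination -hq - hq'⟩
  choose q hq using h
  have hs : ∀ w, q (cs.simple i * w) = r.act (cs.simple i) (q w) := by
    intro w
    refine mul_left_cancel₀ (Realization.ι_α_ne_zero (r := r) i) ?_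
    have h1 := congrArg (r.act (cs.simple i)) (hq w)
    rw [map_sub, r.act_simple_act_simple, map_mul, Realization.act_simple_α] at h1
    have h2 := hq (cs.simple i * w)
    rw [cs.simple_mul_simple_cancel_left] at h2
    linear_combination -h2 - h1
  refine ⟨⟨q, fun t a w ht => ?_⟩, Realization.Z_ext fun w => hq w⟩
  by_cases hne : t = cs.simple i
  · subst hne
    rw [hs]
    exact Realization.dvd_act_self_sub ht _
  · refine ht.dvd_of_dvd_mul hα hGKM hne (Realization.isRoot_simple i) ?_
    have h1 : cs.simple i * (t * w) = (cs.simple i * t * (cs.simple i)⁻¹) * (cs.simple i * w) := by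
      group
    have e : SymmetricAlgebra.ι k V (r.α i) * (q (t * w) - q w) =
        ((z : W → Sym k V) (t * w) - (z : W → Sym k V) w) -
        ((r.σL i z : W → Sym k V) (t * w) - (r.σL i z : W → Sym k V) w) := by
      rw [mul_sub, ← hq, ← hq, Realization.σL_apply, Realization.σL_apply]
      ring
    rw [e]
    exact dvd_sub (z.2 _ _ _ ht) ((r.σL i z).2 _ _ _ ht)

/-- The Demazure operator `z ↦ ((z_w - s(z_{sw})) / α_s)_w`. -/
def Realization.leftDatum (i : B) : DemazureDatum r.Z where
  σ := r.σL i
  σ_σ z := Realization.Z_ext fun w => by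
    rw [Realization.σL_apply, Realization.σL_apply, cs.simple_mul_simple_cancel_left,
      r.act_simple_act_simple]
  a := r.const (SymmetricAlgebra.ι k V (r.α i))
  regular z h := Realization.Z_ext fun w => by
    have h1 := congrFun (congrArg Subtype.val h) w
    exact (mul_eq_zero.mp h1).resolve_left (Realization.ι_α_ne_zero i)
  gen := r.const (SymmetricAlgebra.ι k V (r.δ i))
  gen_sub := Realization.Z_ext fun w => Realization.ι_δ_sub i
  exists_quot := Realization.exists_quot_left hα hGKM i

/-- Left and right multiplications on `W` commute. Constant families do not see the right
involution, and families `(w(f))_w` are fixed by the left one because `s(sw(f)) = w(f)`. -/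
theorem Realization.datum_indep (i j : B) :
    (Realization.leftDatum hα hGKM i).Indep (Realization.rightDatum hα hGKM j) where
  comm z := Realization.Z_ext fun w => by
    change r.act _ ((z : W → Sym k V) (_ * _ * _)) = r.act _ ((z : W → Sym k V) (_ * (_ * _)))
    rw [mul_assoc]
  fix_a := Realization.Z_ext fun w => by
    change (r.σL i (r.toZRight _) : W → Sym k V) w = (r.toZRight _ : W → Sym k V) w
    rw [Realization.σL_apply, Realization.toZRight_apply, Realization.toZRight_apply, ← r.act_mul, cs.simple_mul_simple_cancel_left]
  fix_gen := Realization.Z_ext fun w => by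
    change (r.σL i (r.toZRight _) : W → Sym k V) w = (r.toZRight _ : W → Sym k V) w
    rw [Realization.σL_apply, Realization.toZRight_apply, Realization.toZRight_apply, ← r.act_mul, cs.simple_mul_simple_cancel_left]
  fix_a' := rfl
  fix_gen' := rfl

/-- A Demazure datum on `Z` which is compatible with gradings and finite supports. -/
structure IsGradedDatum (D : DemazureDatum r.Z) : Prop where
  σ_homog : ∀ d z, r.ZHomog d z → r.ZHomog d (D.σ z)
  a_eq : ∀ w, ∃ v : V, v ≠ 0 ∧ (D.a : W → Sym k V) w = SymmetricAlgebra.ι k V v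
  gen_homog : r.ZHomog 2 D.gen
  σ_local : ∀ w, ∃ w', ∀ z : r.Z, (z : W → Sym k V) w' = 0 → (D.σ z : W → Sym k V) w = 0

theorem Realization.rightDatum_isGraded (i : B) :
    IsGradedDatum (Realization.rightDatum hα hGKM i) where
  σ_homog _ _ h _ := h _
  a_eq w := ⟨r.ρ w (r.α i), (r.isRoot_ρ_α w i).ne_zero, r.act_ι w _⟩
  gen_homog w := r.act_mem_symDeg w (ι_mem_symDeg _)
  σ_local w := ⟨w * cs.simple i, fun _ h => h⟩

theorem Realization.leftDatum_isGraded (i : B) :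
    IsGradedDatum (Realization.leftDatum hα hGKM i) where
  σ_homog d z h w := r.act_mem_symDeg _ (h _)
  a_eq w := ⟨r.α i, r.ne_zero i, rfl⟩
  gen_homog w := ι_mem_symDeg _
  σ_local w := ⟨cs.simple i * w, fun z h => by
    change r.act _ _ = 0
    rw [h, map_zero]⟩

variable {D : DemazureDatum r.Z} (hD : IsGradedDatum D)
include hD

theorem IsGradedDatum.q_homog {d : ℤ} {z : r.Z} (hz : r.ZHomog d z) : r.ZHomog (d - 2) (D.q z) := by
  intro w
  obtain ⟨v, hv, ha⟩ := hD.a_eq w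
  refine mem_symDeg_of_mul (ι_mem_symDeg v) (fun h => hv (ι_injective (h.trans (map_zero _).symm))) ?_
  rw [← ha, ← Realization.Z_mul_apply, D.a_mul_q]
  exact sub_mem (hz w) (hD.σ_homog d z hz w)

omit [IsDomain k] [Module.Free k V] hD in
theorem Realization.ZHomog.mul {d e : ℤ} {y z : r.Z} (hy : r.ZHomog d y) (hz : r.ZHomog e z) :
    r.ZHomog (d + e) (y * z) :=
  fun w => SetLike.mul_mem_graded (hy w) (hz w)

theorem IsGradedDatum.p_homog {d : ℤ} {z : r.Z} (hz : r.ZHomog d z) : r.ZHomog d (D.p z) := by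
  have h := (hD.q_homog hz).mul hD.gen_homog
  rw [sub_add_cancel] at h
  exact fun w => sub_mem (hz w) (h w)

/-- The value of `q z` at `w` only involves `z` at `w` and at the one further vertex that determines
`σ z` at `w`. -/
theorem IsGradedDatum.q_local (I : Finset W) : ∃ J : Finset W, ∀ z : r.Z,
    (∀ w ∈ J, (z : W → Sym k V) w = 0) → ∀ w ∈ I, (D.q z : W → Sym k V) w = 0 := by
  classical
  choose φ hφ using hD.σ_local
  refine ⟨I ∪ I.image φ, fun z hz w hw => ?_⟩
  obtain ⟨v, hv, ha⟩ := hD.a_eq w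
  have h : SymmetricAlgebra.ι k V v * (D.q z : W → Sym k V) w = 0 := by
    rw [← ha, ← Realization.Z_mul_apply, D.a_mul_q, Realization.Z_sub_apply,
      hz w (Finset.mem_union_left _ hw),
      hφ w z (hz _ (Finset.mem_union_right _ (Finset.mem_image_of_mem φ hw))), sub_zero]
  exact (mul_eq_zero.mp h).resolve_left fun h => hv (ι_injective (h.trans (map_zero _).symm))

end StructureAlgebra

end MomentGraph

end

noncomputable section

namespace MomentGraph

/-! ## Internal direct sums -/

section Internal

variable {ι M S : Type*} [DecidableEq ι] [AddCommGroup M] [SetLike S M] [AddSubmonoidClass S M]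
  (A : ι → S)

/-- Independence plus spanning. It is stated for a general `SetLike` so as to serve both gradings by
subgroups and decompositions by submodules, hence `hneg`. -/
theorem isInternal_iff (hneg : ∀ i, ∀ x ∈ A i, -x ∈ A i) : DirectSum.IsInternal A ↔
    (∀ (s : Finset ι) (f : ι → M), (∀ i, f i ∈ A i) → ∑ i ∈ s, f i = 0 → ∀ i ∈ s, f i = 0) ∧
    ∀ m : M, m ∈ AddSubmonoid.closure {x | ∃ i, x ∈ A i} := by
  classical
  constructor
  · rintro ⟨hi, hs⟩
    constructor
    · intro s f hf h0 i his
      have h1 : DirectSum.coeAddMonoidHom A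
          (∑ j ∈ s, DirectSum.of (fun i => A i) j ⟨f j, hf j⟩) = 0 := by
        rw [map_sum, ← h0]
        exact Finset.sum_congr rfl fun j _ => DirectSum.coeAddMonoidHom_of A j _
      have h2 := hi (h1.trans (map_zero _).symm)
      have h3 := congrArg (fun x => ((x i : A i) : M)) h2
      change ((∑ j ∈ s, DirectSum.of (fun i => A i) j ⟨f j, hf j⟩) i : M) = ((0 : A i) : M) at h3
      rw [DFinsupp.finsetSum_apply, Finset.sum_eq_single i, DirectSum.of_eq_same] at h3
      · exact h3
      · intro j _ hj
        exact DirectSum.of_eq_of_ne _ _ _ hj.symm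
      · exact fun h => absurd his h
    · intro m
      obtain ⟨x, rfl⟩ := hs m
      rw [DirectSum.coeAddMonoidHom_eq_dfinsuppSum]
      exact AddSubmonoid.sum_mem _ fun i _ => AddSubmonoid.subset_closure ⟨i, (x i).2⟩
  · rintro ⟨hi, hs⟩
    constructor
    · intro x y hxy
      rw [DirectSum.coeAddMonoidHom_eq_dfinsuppSum, DirectSum.coeAddMonoidHom_eq_dfinsuppSum,
        DFinsupp.sum_of_support_subset (Finset.subset_union_left (s₂ := DFinsupp.support y))
          fun _ _ => rfl,
        DFinsupp.sum_of_support_subset (Finset.subset_union_right (s₁ := DFinsupp.support x))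
          fun _ _ => rfl, ← sub_eq_zero, ← Finset.sum_sub_distrib] at hxy
      refine DFinsupp.ext fun i => Subtype.ext (sub_eq_zero.mp ?_)
      by_cases his : i ∈ DFinsupp.support x ∪ DFinsupp.support y
      · exact hi _ (fun i => (x i : M) - (y i : M))
          (fun i => sub_eq_add_neg (x i : M) (y i) ▸ add_mem (x i).2 (hneg i _ (y i).2)) hxy i his
      · rw [Finset.notMem_union, DFinsupp.notMem_support_iff, DFinsupp.notMem_support_iff] at his
        rw [his.1, his.2, sub_self]
    · intro m
      change m ∈ AddMonoidHom.mrange (DirectSum.coeAddMonoidHom A)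
      refine (AddSubmonoid.closure_le (S := AddMonoidHom.mrange _)).mpr ?_ (hs m)
      rintro x ⟨i, hx⟩
      exact ⟨DirectSum.of (fun i => A i) i ⟨x, hx⟩, DirectSum.coeAddMonoidHom_of A i _⟩

end Internal

/-! ## Localization at the right denominators -/

section LocQ

variable {k V : Type u} [CommRing k] [AddCommGroup V] [Module k V]
  {M N : Type u} [AddCommGroup M] [Module (Env k V) M] [AddCommGroup N] [Module (Env k V) N]

variable [IsDomain k] [Module.Free k V]

theorem one_tmul_mem_rightDen {g : Sym k V} (hg : g ≠ 0) :
    ((1 : Sym k V) ⊗ₜ[k] g : Env k V) ∈ rightDen k V :=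
  ⟨g, mem_nonZeroDivisors_of_ne_zero hg, rfl⟩

omit [Module.Free k V] in
theorem exists_of_mem_rightDen {u : Env k V} (hu : u ∈ rightDen k V) :
    ∃ g : Sym k V, g ≠ 0 ∧ u = (1 : Sym k V) ⊗ₜ[k] g := by
  obtain ⟨g, hg, rfl⟩ := hu
  exact ⟨g, nonZeroDivisors.ne_zero hg, rfl⟩

theorem toLocQ_eq_zero {m : M} :
    toLocQ (k := k) (V := V) M m = 0 ↔
      ∃ g : Sym k V, g ≠ 0 ∧ ((1 : Sym k V) ⊗ₜ[k] g : Env k V) • m = 0 := by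
  rw [LocalizedModule.mkLinearMap_apply, ← LocalizedModule.zero_mk 1, LocalizedModule.mk_eq]
  simp only [one_smul, smul_zero]
  constructor
  · rintro ⟨u, hu⟩
    obtain ⟨g, hg, e⟩ := exists_of_mem_rightDen u.2
    refine ⟨g, hg, ?_⟩
    rw [← e]
    exact hu
  · rintro ⟨g, hg, e⟩
    exact ⟨⟨_, one_tmul_mem_rightDen hg⟩, e⟩

omit [Module.Free k V] in
theorem exists_smul_eq_toLocQ (x : LocQ k V M) : ∃ g : Sym k V, g ≠ 0 ∧ ∃ m : M,
    ((1 : Sym k V) ⊗ₜ[k] g : Env k V) • x = toLocQ M m := by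
  obtain ⟨⟨m, u⟩, h⟩ := IsLocalizedModule.surj (rightDen k V) (toLocQ M) x
  obtain ⟨g, hg, e⟩ := exists_of_mem_rightDen u.2
  refine ⟨g, hg, m, ?_⟩
  rw [← e]
  exact h

theorem smul_mem_iff_of_ne_zero (S : Submodule (EnvQ k V) (LocQ k V M)) {g : Sym k V} (hg : g ≠ 0)
    (x : LocQ k V M) : ((1 : Sym k V) ⊗ₜ[k] g : Env k V) • x ∈ S ↔ x ∈ S := by
  rw [← algebraMap_smul (EnvQ k V) ((1 : Sym k V) ⊗ₜ[k] g : Env k V) x]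
  exact Submodule.smul_mem_iff_of_isUnit S
    (IsLocalization.map_units (EnvQ k V) (⟨_, one_tmul_mem_rightDen hg⟩ : rightDen k V))

theorem smul_eq_zero_iff_of_ne_zero {g : Sym k V} (hg : g ≠ 0)
    (x : LocQ k V M) : ((1 : Sym k V) ⊗ₜ[k] g : Env k V) • x = 0 ↔ x = 0 := by
  have := smul_mem_iff_of_ne_zero ⊥ hg x
  simpa using this

omit [IsDomain k] [Module.Free k V] in
theorem locQMap_toLocQ (f : M →ₗ[Env k V] N) (m : M) :
    locQMap f (toLocQ M m) = toLocQ N (f m) :=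
  IsLocalizedModule.map_apply (rightDen k V) (toLocQ M) (toLocQ N) f m

end LocQ

/-! ## Separation of the vertices by the structure algebra -/

section Separation

variable {k : Type u} [CommRing k] {W : Type u} [Group W] {B : Type v} {C : CoxeterMatrix B}
  {cs : CoxeterSystem C W} {V : Type u} [AddCommGroup V] [Module k V] {r : Realization k cs V}
  [IsDomain k] [Module.Free k V]

/-- The action on `V` is not assumed faithful. When `x` and `y` act alike, `y x⁻¹` is central, and
the witness is the family with value `P` on the coset `ker φ · x` and 0 elsewhere, where `P` is the
product of the roots of the reflections outside `ker φ`. -/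
theorem Realization.exists_apply_ne (hGKM : r.GKM) {x y : W} (hxy : x ≠ y) :
    ∃ z : r.Z, (z : W → Sym k V) x ≠ (z : W → Sym k V) y := by
  classical
  by_cases hv : ∀ v, r.ρ x v = r.ρ y v
  · have hw : ∀ v, r.ρ (y * x⁻¹) v = v := by
      intro v
      rw [map_mul, Module.End.mul_apply, ← hv, Realization.ρ_ρ_inv]
    obtain ⟨φ, hφ, hfin⟩ := cs.exists_hom_of_central (Realization.central_of_ρ_eq hGKM hw)
      (fun h => hxy (mul_inv_eq_one.mp h).symm)
    have hroot : ∀ t : W, ∃ a : V, a ≠ 0 ∧ (cs.IsReflection t → r.IsRoot t a) := by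
      intro t
      by_cases ht : cs.IsReflection t
      · obtain ⟨u, i, rfl⟩ := ht
        exact ⟨_, (r.isRoot_ρ_α u i).ne_zero, fun _ => r.isRoot_ρ_α u i⟩
      · by_cases hV : ∃ a : V, a ≠ 0
        · exact ⟨hV.choose, hV.choose_spec, fun h => absurd h ht⟩
        · exfalso
          obtain ⟨i, -⟩ := cs.exists_leftDescent_of_ne_one (w := y * x⁻¹)
            (fun h => hxy (mul_inv_eq_one.mp h).symm)
          exact hV ⟨_, r.ne_zero i⟩
    choose a ha hroot using hroot
    let P : Sym k V := ∏ t ∈ hfin.toFinset, SymmetricAlgebra.ι k V (a t)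
    have hP : P ≠ 0 := Finset.prod_ne_zero_iff.mpr fun t _ h =>
      ha t (ι_injective (h.trans (map_zero _).symm))
    refine ⟨⟨fun u => if φ (u * x⁻¹) = 1 then P else 0, fun t b w ht => ?_⟩, ?_⟩
    -- A reflection in `ker φ` preserves the coset, so the family does not change; for the others
    -- `α_t` divides both possible values.
    · by_cases h1 : φ t = 1
      · have : φ (t * w * x⁻¹) = φ (w * x⁻¹) := by rw [mul_assoc, map_mul, h1, one_mul]
        simp only [this, sub_self, dvd_zero]
      · have hd : SymmetricAlgebra.ι k V b ∣ P :=
          (ht.dvd (hroot t ht.isReflection)).trans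
            (Finset.dvd_prod_of_mem _ (hfin.mem_toFinset.mpr ⟨ht.isReflection, h1⟩))
        refine dvd_sub ?_ ?_ <;> dsimp only <;> split_ifs
        exacts [hd, dvd_zero _, hd, dvd_zero _]
    · simp only [mul_inv_cancel, map_one, if_true, if_neg hφ]
      exact hP
  · push Not at hv
    obtain ⟨v, hv⟩ := hv
    refine ⟨r.toZRight (SymmetricAlgebra.ι k V v), fun h => hv ?_⟩
    rw [Realization.toZRight_apply, Realization.toZRight_apply, r.act_ι, r.act_ι] at h
    exact ι_injective h

theorem Realization.exists_separating (hGKM : r.GKM) (x : W) (I : Finset W) :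
    ∃ z : r.Z, (z : W → Sym k V) x ≠ 0 ∧ ∀ y ∈ I, y ≠ x → (z : W → Sym k V) y = 0 := by
  classical
  induction I using Finset.induction_on with
  | empty => exact ⟨1, one_ne_zero, by simp⟩
  | insert y I hy ih =>
    obtain ⟨z, hz, hz'⟩ := ih
    by_cases hxy : y = x
    · refine ⟨z, hz, fun y' hy' hne => hz' y' ?_ hne⟩
      exact (Finset.mem_insert.mp hy').resolve_left (fun h => hne (h.trans hxy))
    · obtain ⟨z1, hz1⟩ := Realization.exists_apply_ne hGKM (Ne.symm hxy)
      refine ⟨z * (z1 - r.const ((z1 : W → Sym k V) y)), ?_, ?_⟩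
      · rw [Realization.Z_mul_apply, Realization.Z_sub_apply, Realization.const_apply]
        exact mul_ne_zero hz (sub_ne_zero.mpr hz1)
      · intro y' hy' hne
        rw [Realization.Z_mul_apply, Realization.Z_sub_apply, Realization.const_apply]
        rcases Finset.mem_insert.mp hy' with rfl | h
        · rw [sub_self, mul_zero]
        · rw [hz' y' h hne, zero_mul]

/-- A partition of unity on `I` with denominator `g`. The denominator acts from the right, as these
are the elements inverted in `M_Q`. -/
theorem Realization.exists_partition (hGKM : r.GKM) (I : Finset W) :
    ∃ (g : Sym k V) (e : W → r.Z), g ≠ 0 ∧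
      (∀ x, ∀ y ∈ I, y ≠ x → (e x : W → Sym k V) y = 0) ∧
      ∀ y ∈ I, ((∑ x ∈ I, e x : r.Z) : W → Sym k V) y = r.act y g := by
  classical
  choose z hz hz' using fun x => Realization.exists_separating (r := r) hGKM x I
  -- Chosen so that right multiplication by `f x` has the value `z_x(x)` at `x`; the other factors
  -- `f y` in `e x` then complete it to `x(∏ f)`.
  let f : W → Sym k V := fun x => r.act x⁻¹ ((z x : W → Sym k V) x)
  have hf : ∀ x, f x ≠ 0 := fun x h => hz x ((r.act_eq_zero_iff _).mp h)
  let e : W → r.Z := fun x => z x * r.toZRight (∏ y ∈ I.erase x, f y)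
  have he : ∀ x, ∀ y ∈ I, y ≠ x → (e x : W → Sym k V) y = 0 := by
    intro x y hy hne
    rw [Realization.Z_mul_apply, hz' x y hy hne, zero_mul]
  refine ⟨∏ x ∈ I, f x, e, Finset.prod_ne_zero_iff.mpr fun x _ => hf x, he, ?_⟩
  intro y hy
  have h1 : ((∑ x ∈ I, e x : r.Z) : W → Sym k V) y = ∑ x ∈ I, (e x : W → Sym k V) y := by
    rw [AddSubmonoidClass.coe_finsetSum, Finset.sum_apply]
  rw [h1, Finset.sum_eq_single y]
  · rw [Realization.Z_mul_apply, Realization.toZRight_apply, ← Finset.mul_prod_erase I f hy,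
      map_mul, r.act_act_inv]
  · intro x _ hne
    exact he x y hy (Ne.symm hne)
  · exact fun h => absurd hy h

end Separation

/-! ## `F` takes values in `C'` -/

section CPrime

variable {k : Type u} [CommRing k] {W : Type u} [Group W] {B : Type v} {C : CoxeterMatrix B}
  {cs : CoxeterSystem C W} {V : Type u} [AddCommGroup V] [Module k V] {r : Realization k cs V}

theorem ZObj.left_smul (M : ZObj r) (f : Sym k V) (m : M.carrier) :
    (f ⊗ₜ[k] (1 : Sym k V) : Env k V) • m = r.const f • m := by
  rw [M.env_smul, Realization.envToZ_tmul, map_one, mul_one]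

theorem ZObj.right_smul (M : ZObj r) (f : Sym k V) (m : M.carrier) :
    ((1 : Sym k V) ⊗ₜ[k] f : Env k V) • m = r.toZRight f • m := by
  rw [M.env_smul, Realization.envToZ_tmul, map_one, one_mul]

theorem ZObj.toLocQ_mem_comp (M : ZObj r) (x : W) (m : M.carrier)
    (h : ∀ z : r.Z, z • m = r.const ((z : W → Sym k V) x) • m) : toLocQ M.carrier m ∈ M.comp x := by
  rw [ZObj.mem_comp]
  intro z
  rw [locQMap_toLocQ, ← map_smul, ZObj.left_smul, ← h]
  rfl

theorem ZObj.right_smul_comp (M : ZObj r) {x : W} {m : LocQ k V M.carrier} (hm : m ∈ M.comp x)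
    (f : Sym k V) : ((1 : Sym k V) ⊗ₜ[k] f : Env k V) • m =
      (r.act x f ⊗ₜ[k] (1 : Sym k V) : Env k V) • m := by
  rw [ZObj.mem_comp] at hm
  have h := hm (r.toZRight f)
  rw [Realization.toZRight_apply] at h
  rw [← h]
  have e : M.lsmul (r.toZRight f) =
      ((1 : Sym k V) ⊗ₜ[k] f : Env k V) • (LinearMap.id : M.carrier →ₗ[Env k V] M.carrier) :=
    LinearMap.ext fun m => (M.right_smul f m).symm
  obtain ⟨⟨m', u⟩, hu⟩ := IsLocalizedModule.surj (rightDen k V) (toLocQ M.carrier) m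
  refine (IsLocalizedModule.smul_injective (toLocQ (k := k) (V := V) M.carrier) u) ?_
  change (u : Env k V) • ((1 : Sym k V) ⊗ₜ[k] f : Env k V) • m =
    (u : Env k V) • locQMap (M.lsmul (r.toZRight f)) m
  change (u : Env k V) • m = _ at hu
  rw [smul_comm, ← locQMap_smul, hu, locQMap_toLocQ, ← map_smul, e]
  rfl

variable [IsDomain k] [Module.Free k V]

/-- On `M_Q^x` left multiplication by `f` is right multiplication by `x⁻¹(f)`, which is invertible.
-/
theorem ZObj.eq_zero_of_act (M : ZObj r) {x : W} {m : LocQ k V M.carrier} (hm : m ∈ M.comp x)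
    {f : Sym k V} (hf : f ≠ 0) (h : (f ⊗ₜ[k] (1 : Sym k V) : Env k V) • m = 0) : m = 0 := by
  have h1 := M.right_smul_comp hm (r.act x⁻¹ f)
  rw [r.act_act_inv, h] at h1
  exact (smul_eq_zero_iff_of_ne_zero (fun h0 => hf ((r.act_eq_zero_iff _).mp h0)) m).mp h1

/-- Acting by an element of `Z` that is nonzero at `x` and zero on the rest of `s` isolates the term
at `x`. -/
theorem ZObj.comp_indep (hGKM : r.GKM) (M : ZObj r) (s : Finset W) (f : W → LocQ k V M.carrier)
    (hf : ∀ x, f x ∈ M.comp x) (h0 : ∑ x ∈ s, f x = 0) : ∀ x ∈ s, f x = 0 := by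
  intro x hx
  obtain ⟨z, hz, hz'⟩ := Realization.exists_separating hGKM x s
  refine M.eq_zero_of_act (hf x) hz ?_
  have h1 := congrArg (locQMap (M.lsmul z)) h0
  rw [map_sum, map_zero, Finset.sum_eq_single x] at h1
  · rwa [← (M.mem_comp x _).mp (hf x) z]
  · intro y hy hne
    rw [(M.mem_comp y _).mp (hf y) z, hz' y hy hne, TensorProduct.zero_tmul]
    exact zero_smul (Env k V) (f y)
  · exact fun h => absurd hx h

/-- Elements of a finitely supported `Z`-module are, up to denominators, sums of eigenvectors. -/
theorem ZObj.exists_eigen_decomposition (hGKM : r.GKM) (M : ZObj r) (I : Finset W)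
    (hI : ∀ y z : r.Z, (∀ w ∈ I, (y : W → Sym k V) w = (z : W → Sym k V) w) →
      ∀ m : M.carrier, y • m = z • m) :
    ∃ g : Sym k V, g ≠ 0 ∧ ∀ m : M.carrier, ∃ n : W → M.carrier,
      (∀ x, ∀ z : r.Z, z • n x = r.const ((z : W → Sym k V) x) • n x) ∧
      r.toZRight g • m = ∑ x ∈ I, n x := by
  obtain ⟨g, e, hg, he, hs⟩ := Realization.exists_partition hGKM I
  refine ⟨g, hg, fun m => ⟨fun x => e x • m, fun x z => ?_, ?_⟩⟩
  · rw [← mul_smul, ← mul_smul]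
    refine hI _ _ (fun w hw => ?_) m
    rw [Realization.Z_mul_apply, Realization.const_mul_apply]
    by_cases h : w = x
    · rw [h]
    · rw [he x w hw h, mul_zero, mul_zero]
  · rw [← Finset.sum_smul]
    exact hI _ _ (fun w hw => (hs w hw).symm) m

theorem ZObj.mem_closure_comp (hGKM : r.GKM) {M : ZObj r} (hM : IsZModF M)
    (m : LocQ k V M.carrier) : m ∈ AddSubmonoid.closure {x | ∃ w, x ∈ M.comp w} := by
  obtain ⟨I, hI⟩ := hM.factors
  obtain ⟨g, hg, h⟩ := M.exists_eigen_decomposition hGKM I hI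
  obtain ⟨g', hg', m', hm'⟩ := exists_smul_eq_toLocQ m
  obtain ⟨n, hn, hsum⟩ := h m'
  have key : m ∈ ⨆ w, M.comp w := by
    rw [← smul_mem_iff_of_ne_zero _ hg', hm', ← smul_mem_iff_of_ne_zero _ hg, ← map_smul,
      M.right_smul, hsum, map_sum]
    exact Submodule.sum_mem _ fun x _ =>
      Submodule.mem_iSup_of_mem x (M.toLocQ_mem_comp x _ (hn x))
  refine Submodule.iSup_induction M.comp (motive := fun m => m ∈ AddSubmonoid.closure _) key
    (fun w x hx => AddSubmonoid.subset_closure ⟨w, hx⟩) (zero_mem _) fun x y hx hy => add_mem hx hy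

/-- An element of `Z` vanishing on `I` but not at `x` annihilates `M`, yet acts injectively on
`M_Q^x`. -/
theorem ZObj.comp_eq_bot (hGKM : r.GKM) (M : ZObj r) (I : Finset W)
    (hI : ∀ y z : r.Z, (∀ w ∈ I, (y : W → Sym k V) w = (z : W → Sym k V) w) →
      ∀ m : M.carrier, y • m = z • m) {x : W} (hx : x ∉ I) : M.comp x = ⊥ := by
  rw [Submodule.eq_bot_iff]
  intro m hm
  obtain ⟨z, hz, hz'⟩ := Realization.exists_separating hGKM x I
  refine M.eq_zero_of_act hm hz ?_
  rw [← (M.mem_comp x m).mp hm z]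
  obtain ⟨g, hg, m', hm'⟩ := exists_smul_eq_toLocQ m
  refine (smul_eq_zero_iff_of_ne_zero hg _).mp ?_
  have h0 : M.lsmul z m' = 0 :=
    (hI z 0 (fun w hw => hz' w hw fun h => hx (h ▸ hw)) m').trans (zero_smul _ _)
  rw [← locQMap_smul, hm', locQMap_toLocQ, h0, map_zero]

theorem IsZModF.isCPrime (hGKM : r.GKM) {M : ZObj r} (hM : IsZModF M) :
    IsCPrime r ((functorF r).obj M) where
  isInternal_gr := hM.isInternal_gr
  left_smul_mem d e f hf m hm := (congrArg (· ∈ M.gr (d + e)) (M.left_smul f m)).mpr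
    (hM.smul_mem d e (r.const f) (fun w => hf) m hm)
  right_smul_mem d e f hf m hm := (congrArg (· ∈ M.gr (d + e)) (M.right_smul f m)).mpr
    (hM.smul_mem d e (r.toZRight f) (fun w => r.act_mem_symDeg w hf) m hm)
  isInternal_comp := by
    classical
    exact (isInternal_iff M.comp fun w x hx => neg_one_smul (EnvQ k V) x ▸ Submodule.smul_mem _ _ hx).mpr
      ⟨fun s f hf h0 => M.comp_indep hGKM s f hf h0, ZObj.mem_closure_comp hGKM hM⟩
  finite_comp := by
    obtain ⟨I, hI⟩ := hM.factors
    refine I.finite_toSet.subset fun x hx => ?_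
    by_contra hxI
    exact hx (M.comp_eq_bot hGKM I hI hxI)
  right_smul_eq w x hx f := M.right_smul_comp hx f

end CPrime

end MomentGraph

end

noncomputable section

namespace MomentGraph
/-! ## Scalar extension along the invariants of an involution -/

section Double

variable {Z : Type*} [CommRing Z] (D E : DemazureDatum Z) (M : Type*) [AddCommGroup M]

/-- The underlying group `M × M` of the scalar extension of `M` from the invariants of `σ` to `Z`,
where `(x, y)` stands for `1 ⊗ x + gen ⊗ y`. -/
def Double (_ : DemazureDatum Z) (M : Type*) : Type _ := M × M

instance : AddCommGroup (Double D M) := inferInstanceAs (AddCommGroup (M × M))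

namespace Double

variable {D E M}

/-- The first coordinate. -/
def fst : Double D M →+ M := AddMonoidHom.fst M M

/-- The second coordinate. -/
def snd : Double D M →+ M := AddMonoidHom.snd M M

/-- The element `1 ⊗ x + gen ⊗ y`. -/
def mk (x y : M) : Double D M := (x, y)

@[simp] theorem fst_mk (x y : M) : fst (mk x y : Double D M) = x := rfl

@[simp] theorem snd_mk (x y : M) : snd (mk x y : Double D M) = y := rfl

@[ext] theorem ext {x y : Double D M} (h : fst x = fst y) (h' : snd x = snd y) : x = y :=
  Prod.ext h h'

variable [Module Z M]

/-- The columns of the matrix of `z` are the coordinates of `z · 1` and `z · gen` in the basis `1,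
gen`. -/
instance : Module Z (Double D M) where
  smul z x := mk (D.p z • fst x + D.p (z * D.gen) • snd x) (D.q z • fst x + D.q (z * D.gen) • snd x)
  one_smul x := by
    change mk _ _ = x
    have h : D.σ 1 = 1 := map_one _
    ext
    · simp [D.p_fixed h, D.p_gen]
    · simp [D.q_fixed h, D.q_gen]
  mul_smul y z x := by
    change mk _ _ = mk (_ • fst (mk _ _) + _ • snd (mk _ _)) (_ • fst (mk _ _) + _ • snd (mk _ _))
    ext
    · simp only [fst_mk, snd_mk, smul_add, smul_smul]
      rw [mul_assoc, D.p_mul_eq y z, D.p_mul_eq y (z * D.gen), mul_comm (D.q z),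
        mul_comm (D.q (z * _))]
      module
    · simp only [fst_mk, snd_mk, smul_add, smul_smul]
      rw [mul_assoc, D.q_mul_eq y z, D.q_mul_eq y (z * D.gen), mul_comm (D.q z),
        mul_comm (D.q (z * _))]
      module
  smul_zero z := by
    change mk _ _ = (0 : Double D M)
    ext <;> simp
  smul_add z x y := by
    change mk _ _ = mk _ _ + mk _ _
    ext <;> simp only [fst_mk, snd_mk, map_add, smul_add] <;> abel
  add_smul y z x := by
    change mk _ _ = mk _ _ + mk _ _
    ext <;> simp only [fst_mk, snd_mk, map_add, add_mul, D.p_add, D.q_add, add_smul] <;> abel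
  zero_smul x := by
    change mk _ _ = (0 : Double D M)
    have h : D.σ 0 = 0 := map_zero _
    ext <;> simp [D.p_fixed h, D.q_fixed h]

theorem fst_smul (z : Z) (x : Double D M) :
    fst (z • x) = D.p z • fst x + D.p (z * D.gen) • snd x := rfl

theorem snd_smul (z : Z) (x : Double D M) :
    snd (z • x) = D.q z • fst x + D.q (z * D.gen) • snd x := rfl

theorem fst_smul_of_fixed {z : Z} (hz : D.σ z = z) (x : Double D M) : fst (z • x) = z • fst x := by
  rw [fst_smul, D.p_fixed hz, D.p_mul hz, D.p_gen, mul_zero, zero_smul, add_zero]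

theorem snd_smul_of_fixed {z : Z} (hz : D.σ z = z) (x : Double D M) : snd (z • x) = z • snd x := by
  rw [snd_smul, D.q_fixed hz, D.q_mul hz, D.q_gen, mul_one, zero_smul, zero_add]

theorem smul_mk_zero (z : Z) (m : M) :
    z • (mk m 0 : Double D M) = mk (D.p z • m) (D.q z • m) := by
  ext
  · rw [fst_smul]; simp
  · rw [snd_smul]; simp

theorem gen_smul_mk_zero (m : M) : D.gen • (mk m 0 : Double D M) = mk 0 m := by
  rw [smul_mk_zero, D.p_gen, D.q_gen, zero_smul, one_smul]

theorem eq_mk_add (x : Double D M) : x = mk (fst x) 0 + D.gen • mk (snd x) 0 := by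
  rw [gen_smul_mk_zero]
  ext <;> simp

/-- Functoriality of the scalar extension. -/
def map {N : Type*} [AddCommGroup N] [Module Z N] (f : M →ₗ[Z] N) : Double D M →ₗ[Z] Double D N where
  toFun x := mk (f (fst x)) (f (snd x))
  map_add' x y := by ext <;> simp
  map_smul' z x := by
    ext
    · simp [fst_smul]
    · simp [snd_smul]

/-- Scalar extensions along independent data commute. -/
def comm (h : D.Indep E) : Double D (Double E M) ≃ₗ[Z] Double E (Double D M) where
  toFun x := mk (mk (fst (fst x)) (fst (snd x))) (mk (snd (fst x)) (snd (snd x)))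
  invFun x := mk (mk (fst (fst x)) (fst (snd x))) (mk (snd (fst x)) (snd (snd x)))
  left_inv _ := rfl
  right_inv _ := rfl
  map_add' _ _ := rfl
  map_smul' z x := by
    -- Each generator is fixed by the other involution, so it passes through the coordinates of the
    -- other datum. The entries of the two 4 × 4 matrices then agree because these coordinates
    -- commute.
    have hp : ∀ y, D.p y * E.gen = D.p (y * E.gen) := fun y => by
      rw [mul_comm y, D.p_mul h.fix_gen, mul_comm]
    have hq : ∀ y, D.q y * E.gen = D.q (y * E.gen) := fun y => by
      rw [mul_comm y, D.q_mul h.fix_gen, mul_comm]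
    have hp' : ∀ y, E.p y * D.gen = E.p (y * D.gen) := fun y => by
      rw [mul_comm y, E.p_mul h.fix_gen', mul_comm]
    have hq' : ∀ y, E.q y * D.gen = E.q (y * D.gen) := fun y => by
      rw [mul_comm y, E.q_mul h.fix_gen', mul_comm]
    have hm : ∀ y, y * D.gen * E.gen = y * E.gen * D.gen := fun y => by ring
    ext <;>
    simp only [fst_smul, snd_smul, map_add, fst_mk, snd_mk, RingHom.id_apply, hp, hq, hp', hq',
      h.p_p, h.q_p, h.q_q, h.symm.q_p, hm] <;>
    abel

section BaseChange

variable {R : Type*} [CommRing R] [Algebra R Z] (S : Subalgebra R Z) (hS : ∀ z, z ∈ S ↔ D.σ z = z)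

/-- The inclusion `m ↦ 1 ⊗ m`. -/
def incl : M →ₗ[S] Double D M where
  toFun m := mk m 0
  map_add' x y := by ext <;> simp
  map_smul' a m := by
    have h := (hS a).mp a.2
    change _ = (a : Z) • (mk m 0 : Double D M)
    ext
    · rw [fst_smul_of_fixed h]; rfl
    · rw [snd_smul_of_fixed h]; simp

/-- `Double D M` is the scalar extension `Z ⊗_{Z^σ} M`. -/
def baseChangeEquiv : Z ⊗[S] M ≃ₗ[Z] Double D M :=
  { LinearMap.liftBaseChange Z (incl (D := D) (M := M) S hS) with
    invFun := fun x => (1 : Z) ⊗ₜ[S] fst x + D.gen ⊗ₜ[S] snd x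
    left_inv := by
      intro x
      change (1 : Z) ⊗ₜ[S] fst (LinearMap.liftBaseChange Z (incl S hS) x) +
        D.gen ⊗ₜ[S] snd (LinearMap.liftBaseChange Z (incl S hS) x) = x
      induction x using TensorProduct.induction_on with
      | zero => simp
      | add x y hx hy =>
        rw [map_add, map_add, map_add, tmul_add, tmul_add, add_add_add_comm, hx, hy]
      | tmul z m =>
        have e : LinearMap.liftBaseChange Z (incl S hS) (z ⊗ₜ[S] m) =
            (mk (D.p z • m) (D.q z • m) : Double D M) := by
          rw [LinearMap.liftBaseChange_tmul]
          exact smul_mk_zero z m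
        rw [e, fst_mk, snd_mk]
        -- The coordinates of `z` are invariant, so they may cross the tensor sign.
        have ep : (1 : Z) ⊗ₜ[S] (D.p z • m) = D.p z ⊗ₜ[S] m := by
          change (1 : Z) ⊗ₜ[S] ((⟨D.p z, (hS _).mpr (D.σ_p z)⟩ : S) • m) = _
          rw [← smul_tmul]
          congr 1
          exact mul_one (D.p z)
        have eq : D.gen ⊗ₜ[S] (D.q z • m) = (D.q z * D.gen) ⊗ₜ[S] m := by
          change D.gen ⊗ₜ[S] ((⟨D.q z, (hS _).mpr (D.σ_q z)⟩ : S) • m) = _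
          rw [← smul_tmul]
          rfl
        rw [ep, eq, ← add_tmul, D.p_add_q]
    right_inv := by
      intro x
      change LinearMap.liftBaseChange Z (incl S hS) (_ + _) = x
      rw [map_add, LinearMap.liftBaseChange_tmul, LinearMap.liftBaseChange_tmul, one_smul]
      exact (eq_mk_add x).symm }

end BaseChange

end Double

end Double

/-! ### Graded scalar extensions of `Z`-modules -/

section ZObj

variable {k : Type u} [CommRing k] {W : Type u} [Group W] {B : Type v} {C : CoxeterMatrix B}
  {cs : CoxeterSystem C W} {V : Type u} [AddCommGroup V] [Module k V] {r : Realization k cs V}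

/-- Isomorphisms from homogeneous linear equivalences. -/
def ZObj.isoMk {M N : ZObj r} (e : M.carrier ≃ₗ[r.Z] N.carrier)
    (h : ∀ d, ∀ m ∈ M.gr d, e m ∈ N.gr d) (h' : ∀ d, ∀ n ∈ N.gr d, e.symm n ∈ M.gr d) : M ≅ N where
  hom := ⟨e.toLinearMap, h⟩
  inv := ⟨e.symm.toLinearMap, h'⟩
  hom_inv_id := ZHom.ext (LinearMap.ext fun m => e.symm_apply_apply m)
  inv_hom_id := ZHom.ext (LinearMap.ext fun m => e.apply_symm_apply m)

theorem ZHom.hom_inv_apply {M N : ZObj r} (e : M ≅ N) (m : M.carrier) :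
    ZHom.toLin e.inv (ZHom.toLin e.hom m) = m :=
  LinearMap.congr_fun (congrArg ZHom.toLin e.hom_inv_id) m

theorem ZHom.inv_hom_apply {M N : ZObj r} (e : M ≅ N) (n : N.carrier) :
    ZHom.toLin e.hom (ZHom.toLin e.inv n) = n :=
  LinearMap.congr_fun (congrArg ZHom.toLin e.inv_hom_id) n

/-- The graded version of `Double`. -/
def ZObj.double (D : DemazureDatum r.Z) (M : ZObj r) : ZObj r where
  carrier := Double D M.carrier
  gr d := (M.gr d).comap Double.fst ⊓ (M.gr (d - 2)).comap Double.snd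

/-- `ZObj.double` as a functor. -/
def ZObj.doubleFunctor (D : DemazureDatum r.Z) : ZObj r ⥤ ZObj r where
  obj M := M.double D
  map {M N} f := ⟨Double.map (ZHom.toLin f),
    fun d _ hm => ⟨ZHom.map_gr f d _ hm.1, ZHom.map_gr f _ _ hm.2⟩⟩

/-- `ZObj.double` for independent data commute. -/
def ZObj.doubleComm {D E : DemazureDatum r.Z} (h : D.Indep E) (M : ZObj r) :
    (M.double E).double D ≅ (M.double D).double E :=
  ZObj.isoMk (Double.comm h) (fun _ _ hm => ⟨⟨hm.1.1, hm.2.1⟩, ⟨hm.1.2, hm.2.2⟩⟩)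
    (fun _ _ hm => ⟨⟨hm.1.1, hm.2.1⟩, ⟨hm.1.2, hm.2.2⟩⟩)

variable [IsDomain k] [Module.Free k V]
  (hα : ∀ i, Function.Surjective fun f : Module.Dual k V => f (r.α i)) (hGKM : r.GKM)

/-- The concrete description of `Z ⊗_{Z^s} M`. -/
def ZObj.induceEquiv (i : B) (M : ZObj r) :
    (M.induce i).carrier ≃ₗ[r.Z] (M.double (Realization.rightDatum hα hGKM i)).carrier :=
  Double.baseChangeEquiv (D := Realization.rightDatum hα hGKM i) (M := M.carrier) (r.Zs i)
    fun _ => ⟨fun h => Realization.Z_ext h, fun h w => congrFun (congrArg Subtype.val h) w⟩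

end ZObj

end MomentGraph

end

noncomputable section

namespace MomentGraph

/-! ### Stability of the class of finitely supported graded modules -/

section IsZModF

theorem isInternal_comp_equiv {ι κ M : Type*} [DecidableEq ι] [DecidableEq κ] [AddCommGroup M]
    {A : ι → AddSubgroup M} (h : DirectSum.IsInternal A) (e : κ ≃ ι) :
    DirectSum.IsInternal fun j => A (e j) := by
  rw [isInternal_iff _ fun i x hx => neg_mem hx] at h ⊢
  refine ⟨fun s f hf h0 j hj => ?_, fun m => ?_⟩
  · have := h.1 (s.map e.toEmbedding) (fun i => f (e.symm i))
      (fun i => by simpa using hf (e.symm i)) (by simpa using h0) (e j) (by simpa using hj)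
    simpa using this
  · refine AddSubmonoid.closure_mono ?_ (h.2 m)
    rintro x ⟨i, hx⟩
    exact ⟨e.symm i, by simpa using hx⟩

theorem isInternal_of_retract {ι M N : Type*} [DecidableEq ι] [AddCommGroup M] [AddCommGroup N]
    {A : ι → AddSubgroup M} {A' : ι → AddSubgroup N} (h : DirectSum.IsInternal A')
    (f : M →+ N) (g : N →+ M) (hgf : ∀ m, g (f m) = m) (hf : ∀ i, ∀ m ∈ A i, f m ∈ A' i)
    (hg : ∀ i, ∀ n ∈ A' i, g n ∈ A i) : DirectSum.IsInternal A := by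
  rw [isInternal_iff _ fun i x hx => neg_mem hx] at h ⊢
  refine ⟨fun s x hx h0 i hi => ?_, fun m => ?_⟩
  · have := h.1 s (fun i => f (x i)) (fun i => hf i _ (hx i)) (by rw [← map_sum, h0, map_zero]) i hi
    rw [← hgf (x i), this, map_zero]
  · have h1 := AddSubmonoid.mem_map_of_mem g (h.2 (f m))
    rw [hgf, AddMonoidHom.map_mclosure] at h1
    refine AddSubmonoid.closure_mono ?_ h1
    rintro _ ⟨x, ⟨i, hx⟩, rfl⟩
    exact ⟨i, hg i x hx⟩

variable {k : Type u} [CommRing k] {W : Type u} [Group W] {B : Type v} {C : CoxeterMatrix B}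
  {cs : CoxeterSystem C W} {V : Type u} [AddCommGroup V] [Module k V] {r : Realization k cs V}

theorem IsZModF.of_retract {M N : ZObj r} (hN : IsZModF N) (i : M ⟶ N) (p : N ⟶ M)
    (h : i ≫ p = 𝟙 M) : IsZModF M := by
  have hpi : ∀ m, ZHom.toLin p (ZHom.toLin i m) = m := fun m =>
    LinearMap.congr_fun (congrArg ZHom.toLin h) m
  refine ⟨isInternal_of_retract hN.isInternal_gr (ZHom.toLin i).toAddMonoidHom
    (ZHom.toLin p).toAddMonoidHom hpi (ZHom.map_gr i) (ZHom.map_gr p), ?_, ?_⟩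
  · intro d e z hz m hm
    rw [← hpi (z • m), map_smul]
    exact ZHom.map_gr p _ _ (hN.smul_mem d e z hz _ (ZHom.map_gr i _ _ hm))
  · obtain ⟨I, hI⟩ := hN.factors
    refine ⟨I, fun y z hyz m => ?_⟩
    rw [← hpi (y • m), map_smul, hI y z hyz, ← map_smul, hpi]

theorem IsZModF.of_iso {M N : ZObj r} (hN : IsZModF N) (e : M ≅ N) : IsZModF M :=
  hN.of_retract e.hom e.inv e.hom_inv_id

theorem IsZModF.shift {M : ZObj r} (hM : IsZModF M) (n : ℤ) : IsZModF (M.shift n) where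
  isInternal_gr := isInternal_comp_equiv hM.isInternal_gr (Equiv.addLeft n)
  smul_mem d e z hz m hm := by
    have := hM.smul_mem d (n + e) z hz m hm
    rwa [add_left_comm] at this
  factors := hM.factors

theorem ZObj.mem_directSum_gr {n : ℕ} {M : Fin n → ZObj r} {d : ℤ}
    {m : ∀ i, (M i).carrier} : m ∈ (ZObj.directSum M).gr d ↔ ∀ i, m i ∈ (M i).gr d := by
  have h := AddSubgroup.mem_iInf (x := m)
    (S := fun i => ((M i).gr d).comap (Pi.evalAddMonoidHom (fun i => (M i).carrier) i))
  exact h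

theorem IsZModF.directSum {n : ℕ} {M : Fin n → ZObj r} (hM : ∀ i, IsZModF (M i)) :
    IsZModF (ZObj.directSum M) where
  isInternal_gr := by
    have h := fun i => (isInternal_iff _ fun i x hx => neg_mem hx).mp (hM i).isInternal_gr
    refine (isInternal_iff _ fun i x hx => neg_mem hx).mpr ⟨fun s f hf h0 j hj => ?_, fun m => ?_⟩
    · funext i
      refine (h i).1 s (fun j => (f j : ∀ i, (M i).carrier) i)
        (fun j => ZObj.mem_directSum_gr.mp (hf j) i) ?_ j hj
      exact (map_sum (Pi.evalAddMonoidHom (fun i => (M i).carrier) i)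
        (fun j => (f j : ∀ i, (M i).carrier)) s).symm.trans (congrFun h0 i)
    · classical
      rw [← Finset.univ_sum_single (m : ∀ i, (M i).carrier)]
      refine AddSubmonoid.sum_mem _ fun i _ => ?_
      have h1 := AddSubmonoid.mem_map_of_mem (AddMonoidHom.single (fun i => (M i).carrier) i)
        ((h i).2 ((m : ∀ i, (M i).carrier) i))
      rw [AddMonoidHom.map_mclosure] at h1
      refine AddSubmonoid.closure_mono ?_ h1
      rintro _ ⟨x, ⟨d, hx⟩, rfl⟩
      refine ⟨d, ZObj.mem_directSum_gr.mpr fun j => ?_⟩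
      rw [AddMonoidHom.single_apply]
      by_cases hij : j = i
      · subst hij
        rw [Pi.single_eq_same]
        exact hx
      · rw [Pi.single_eq_of_ne hij]
        exact zero_mem _
  smul_mem d e z hz m hm := ZObj.mem_directSum_gr.mpr fun i =>
    (hM i).smul_mem d e z hz _ (ZObj.mem_directSum_gr.mp hm i)
  factors := by
    classical
    choose I hI using fun i => (hM i).factors
    exact ⟨Finset.univ.biUnion I, fun y z hyz m => funext fun i =>
      hI i y z (fun w hw => hyz w (Finset.mem_biUnion.mpr ⟨i, Finset.mem_univ i, hw⟩)) _⟩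

theorem isZModF_zUnit : IsZModF (zUnit r) where
  isInternal_gr := symDeg_isInternal
  smul_mem _ _ _ hz _ hm := SetLike.mul_mem_graded (A := symDeg k V) (hz 1) hm
  factors := ⟨{1}, fun _ _ hyz m =>
    congrArg (fun a : Sym k V => a * (show Sym k V from m)) (hyz 1 (Finset.mem_singleton_self 1))⟩

variable [IsDomain k] [Module.Free k V]

theorem IsZModF.double {D : DemazureDatum r.Z} (hD : IsGradedDatum D) {M : ZObj r}
    (hM : IsZModF M) : IsZModF (M.double D) where
  isInternal_gr := by
    have h := (isInternal_iff _ fun i x hx => neg_mem hx).mp hM.isInternal_gr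
    have h2 := (isInternal_iff _ fun i x hx => neg_mem hx).mp
      (isInternal_comp_equiv hM.isInternal_gr (Equiv.subRight 2))
    refine (isInternal_iff _ fun i x hx => neg_mem hx).mpr ⟨fun s f hf h0 j hj => ?_, fun m => ?_⟩
    · refine Double.ext (D := D) ?_ ?_
      · refine h.1 s (fun j => Double.fst (D := D) (f j)) (fun j => (hf j).1) ?_ j hj
        exact (map_sum (Double.fst (D := D)) (fun j => (f j : Double D M.carrier)) s).symm.trans
          (congrArg (Double.fst (D := D)) h0)
      · refine h2.1 s (fun j => Double.snd (D := D) (f j)) (fun j => (hf j).2) ?_ j hj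
        exact (map_sum (Double.snd (D := D)) (fun j => (f j : Double D M.carrier)) s).symm.trans
          (congrArg (Double.snd (D := D)) h0)
    · let i₁ : M.carrier →+ Double D M.carrier := AddMonoidHom.inl _ _
      let i₂ : M.carrier →+ Double D M.carrier := AddMonoidHom.inr _ _
      have e : m = i₁ (Double.fst (D := D) m) + i₂ (Double.snd (D := D) m) :=
        Double.ext (D := D) (add_zero _).symm (zero_add _).symm
      rw [e]
      have h3 := AddSubmonoid.mem_map_of_mem i₁ (h.2 (Double.fst (D := D) m))
      have h4 := AddSubmonoid.mem_map_of_mem i₂ (h2.2 (Double.snd (D := D) m))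
      rw [AddMonoidHom.map_mclosure] at h3 h4
      refine add_mem (AddSubmonoid.closure_mono ?_ h3) (AddSubmonoid.closure_mono ?_ h4)
      · rintro _ ⟨x, ⟨d, hx⟩, rfl⟩
        exact ⟨d, hx, (M.gr _).zero_mem⟩
      · rintro _ ⟨x, ⟨d, hx⟩, rfl⟩
        exact ⟨d, (M.gr _).zero_mem, hx⟩
  smul_mem d e z hz m hm := by
    have hg := hz.mul hD.gen_homog
    have h1 := hM.smul_mem _ _ _ (hD.p_homog hz) _ hm.1
    have h2 := hM.smul_mem _ _ _ (hD.p_homog hg) _ hm.2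
    have h3 := hM.smul_mem _ _ _ (hD.q_homog hz) _ hm.1
    have h4 := hM.smul_mem _ _ _ (hD.q_homog hg) _ hm.2
    -- `gen` has degree 2 and `q` lowers degrees by 2, which balances the shift of the second
    -- coordinate.
    rw [show d + 2 + (e - 2) = d + e by ring] at h2
    rw [show d - 2 + e = d + e - 2 by ring] at h3
    rw [show d + 2 - 2 + (e - 2) = d + e - 2 by ring] at h4
    exact ⟨add_mem h1 h2, add_mem h3 h4⟩
  factors := by
    classical
    obtain ⟨I, hI⟩ := hM.factors
    obtain ⟨J, hJ⟩ := hD.q_local I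
    have hz : ∀ z : r.Z, (∀ w ∈ I, (z : W → Sym k V) w = 0) → ∀ m : M.carrier, z • m = 0 :=
      fun z h m => (hI z 0 h m).trans (zero_smul _ m)
    -- The support has to be enlarged by `J`, as `q z` on `I` also sees the values of `σ z`.
    have hq : ∀ z : r.Z, (∀ w ∈ I ∪ J, (z : W → Sym k V) w = 0) → ∀ m : M.carrier,
        D.q z • m = 0 := fun z h m =>
      hz _ (hJ z fun w hw => h w (Finset.mem_union_right _ hw)) m
    have hp : ∀ z : r.Z, (∀ w ∈ I ∪ J, (z : W → Sym k V) w = 0) → ∀ m : M.carrier,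
        D.p z • m = 0 := by
      intro z h m
      rw [DemazureDatum.p, sub_smul, mul_comm, mul_smul, hq z h, smul_zero, sub_zero]
      exact hz z (fun w hw => h w (Finset.mem_union_left _ hw)) m
    refine ⟨I ∪ J, fun y z hyz m => ?_⟩
    rw [← sub_eq_zero, ← sub_smul]
    have h0 : ∀ w ∈ I ∪ J, ((y - z : r.Z) : W → Sym k V) w = 0 := fun w hw => by
      rw [Realization.Z_sub_apply, hyz w hw, sub_self]
    have h1 : ∀ w ∈ I ∪ J, (((y - z) * D.gen : r.Z) : W → Sym k V) w = 0 := fun w hw => by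
      rw [Realization.Z_mul_apply, h0 w hw, zero_mul]
    refine Double.ext (D := D) ?_ ?_
    · refine (Double.fst_smul (D := D) (y - z) m).trans ?_
      rw [hp _ h0, hp _ h1, add_zero]; rfl
    · refine (Double.snd_smul (D := D) (y - z) m).trans ?_
      rw [hq _ h0, hq _ h1, add_zero]; rfl

end IsZModF

/-! ### Interchange of the two factors of `A ⊗_{A^σ} A` -/

section Exchange

variable {A : Type*} [CommRing A] (d : DemazureDatum A)

/-- The coordinates of `a ⊗ 1 + b ⊗ gen` with respect to the basis `1 ⊗ 1, gen ⊗ 1` of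
`A ⊗_{A^σ} A` as a right module. -/
def DemazureDatum.exchange (x : A × A) : A × A :=
  (d.p x.1 + d.gen * d.p x.2, d.q x.1 + d.gen * d.q x.2)

/-- Passing from the left to the right description of `A ⊗_{A^σ} A` is given by the same formula as
passing back, by the flip symmetry. -/
theorem DemazureDatum.exchange_exchange (x : A × A) : d.exchange (d.exchange x) = x := by
  have h1 := fun z => d.p_mul (d.σ_p z) d.gen
  have h2 := fun z => d.p_mul (d.σ_q z) d.gen
  have h3 := fun z => d.q_mul (d.σ_p z) d.gen
  have h4 := fun z => d.q_mul (d.σ_q z) d.gen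
  refine Prod.ext ?_ ?_
  · simp only [exchange, mul_comm d.gen, d.p_add, h1, h2, d.p_fixed (d.σ_p _),
      d.p_fixed (d.σ_q _), d.p_gen, mul_zero, add_zero, d.p_add_q]
  · simp only [exchange, mul_comm d.gen, d.q_add, h3, h4, d.q_fixed (d.σ_p _),
      d.q_fixed (d.σ_q _), d.q_gen, mul_one, zero_add, d.p_add_q]

theorem DemazureDatum.exchange_add (x y : A × A) :
    d.exchange (x + y) = d.exchange x + d.exchange y := by
  refine Prod.ext ?_ ?_ <;> simp only [exchange, Prod.fst_add, Prod.snd_add, d.p_add, d.q_add] <;>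
    ring

theorem DemazureDatum.σ_add_gen : d.σ (d.gen + d.σ d.gen) = d.gen + d.σ d.gen := by
  rw [map_add, d.σ_σ, add_comm]

theorem DemazureDatum.σ_mul_gen : d.σ (d.gen * d.σ d.gen) = d.gen * d.σ d.gen := by
  rw [map_mul, d.σ_σ, mul_comm]

theorem DemazureDatum.q_gen_mul_gen : d.q (d.gen * d.gen) = d.gen + d.σ d.gen := by
  refine d.q_eq ?_
  rw [map_mul, ← d.gen_sub]
  ring

theorem DemazureDatum.p_gen_mul_gen : d.p (d.gen * d.gen) = -(d.gen * d.σ d.gen) := by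
  rw [p, q_gen_mul_gen]
  ring

/-- In one description `gen` acts through its quadratic equation `gen² = (gen + σ gen) gen - gen · σ
gen`, in the other as a scalar on both coordinates. -/
theorem DemazureDatum.exchange_gen (x y : A) :
    d.exchange (-(d.gen * d.σ d.gen) * y, x + (d.gen + d.σ d.gen) * y) =
      (d.gen * (d.exchange (x, y)).1, d.gen * (d.exchange (x, y)).2) := by
  have h1 : d.σ (-(d.gen * d.σ d.gen)) = -(d.gen * d.σ d.gen) := by rw [map_neg, d.σ_mul_gen]
  refine Prod.ext ?_ ?_
  · simp only [exchange, d.p_add, d.p_mul h1, d.p_mul d.σ_add_gen]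
    ring
  · simp only [exchange, d.q_add, d.q_mul h1, d.q_mul d.σ_add_gen]
    ring

variable {Z : Type*} [CommRing Z] {D E : DemazureDatum Z} [Module Z A]

/-- The map `DemazureDatum.exchange` on scalar extensions. -/
def Double.exchange (D E : DemazureDatum Z) : Double D A →+ Double E A where
  toFun x := d.exchange x
  map_zero' := by
    have h := d.exchange_add 0 0
    rw [add_zero] at h
    exact left_eq_add.mp h
  map_add' := d.exchange_add

/-- If `D` and `E` restrict to the two sides of `A ⊗_{A^σ} A`, then the two extensions of `A`
agree. -/
def Double.exchangeEquiv (h : E.Indep D) (ε : Z →+* A) (hε : ∀ (z : Z) (a : A), z • a = ε z * a)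
    (hq : ∀ z, D.σ z = z → ε (E.q z) = d.q (ε z)) (hD : ε D.gen = d.gen) (hE : ε E.gen = d.gen)
    (hσ : ε (D.σ D.gen) = d.σ d.gen) : Double D A ≃ₗ[Z] Double E A :=
  have hp : ∀ z, D.σ z = z → ε (E.p z) = d.p (ε z) := fun z hz => by
    rw [DemazureDatum.p, DemazureDatum.p, map_sub, map_mul, hq z hz, hE]
  -- `Z` is generated over the invariants of `D` by `D.gen`. An invariant `z` acts on the source
  -- coordinatewise, and on the target by the matrix of `ε z` in the basis `1, gen` of `A`.
  have key1 : ∀ z, D.σ z = z → ∀ x : Double D A,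
      exchange d D E (z • x) = z • exchange d D E x := by
    intro z hz x
    have hz' : D.σ (z * E.gen) = z * E.gen := by rw [map_mul, hz, h.fix_gen']
    have e1 : fst (z • x) = ε z * fst x := by rw [fst_smul_of_fixed hz, hε]
    have e2 : snd (z • x) = ε z * snd x := by rw [snd_smul_of_fixed hz, hε]
    refine ext ?_ ?_
    · rw [fst_smul, hε, hε, hp z hz, hp _ hz', map_mul, hE]
      change d.p (fst (z • x)) + _ * d.p (snd (z • x)) =
        d.p _ * (d.p (fst x) + _ * d.p (snd x)) + _ * (d.q (fst x) + _ * d.q (snd x))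
      rw [e1, e2, d.p_mul_eq (ε z) (fst x), d.p_mul_eq (ε z) (snd x)]
      ring
    · rw [snd_smul, hε, hε, hq z hz, hq _ hz', map_mul, hE]
      change d.q (fst (z • x)) + _ * d.q (snd (z • x)) =
        d.q _ * (d.p (fst x) + _ * d.p (snd x)) + _ * (d.q (fst x) + _ * d.q (snd x))
      rw [e1, e2, d.q_mul_eq (ε z) (fst x), d.q_mul_eq (ε z) (snd x)]
      ring
  have key2 : ∀ x : Double D A, exchange d D E (D.gen • x) = D.gen • exchange d D E x := by
    intro x
    have e1 : D.gen • x =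
        mk (-(d.gen * d.σ d.gen) * snd x) (fst x + (d.gen + d.σ d.gen) * snd x) := by
      refine ext ?_ ?_
      · rw [fst_smul, D.p_gen, zero_smul, zero_add, D.p_gen_mul_gen, hε, map_neg, map_mul, hD, hσ]
        rfl
      · rw [snd_smul, D.q_gen, one_smul, D.q_gen_mul_gen, hε, map_add, hD, hσ]
        rfl
    have e2 := d.exchange_gen (fst x) (snd x)
    rw [e1]
    refine ext ?_ ?_
    · rw [fst_smul_of_fixed h.fix_gen, hε, hD]
      exact congrArg Prod.fst e2
    · rw [snd_smul_of_fixed h.fix_gen, hε, hD]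
      exact congrArg Prod.snd e2
  { exchange d D E with
    invFun := exchange d E D
    left_inv := d.exchange_exchange
    right_inv := d.exchange_exchange
    map_smul' := fun z x => by
      change exchange d D E (z • x) = z • exchange d D E x
      conv_lhs => rw [← D.p_add_q z, add_smul, mul_smul, map_add, key1 _ (D.σ_p z),
        key1 _ (D.σ_q z), key2, ← mul_smul, ← add_smul, D.p_add_q] }

end Exchange

/-! ## Two-sided Bott–Samelson modules -/

section BottSamelson

variable {k : Type u} [CommRing k] {W : Type u} [Group W] {B : Type v} {C : CoxeterMatrix B}
  {cs : CoxeterSystem C W} {V : Type u} [AddCommGroup V] [Module k V] {r : Realization k cs V}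
  [IsDomain k] [Module.Free k V]

theorem Realization.symDatum_q_mem (i : B) {d : ℤ} {f : Sym k V} (hf : f ∈ symDeg k V d) :
    (r.symDatum i).q f ∈ symDeg k V (d - 2) := by
  refine mem_symDeg_of_mul (ι_mem_symDeg (r.α i)) (Realization.ι_α_ne_zero i) ?_
  have h := (r.symDatum i).a_mul_q f
  exact h ▸ sub_mem hf (r.act_mem_symDeg _ hf)

omit [IsDomain k] [Module.Free k V] in
theorem ι_mul_mem_symDeg (v : V) {d : ℤ} {f : Sym k V} (hf : f ∈ symDeg k V (d - 2)) :
    SymmetricAlgebra.ι k V v * f ∈ symDeg k V d := by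
  have h := SetLike.mul_mem_graded (A := symDeg k V) (ι_mem_symDeg v) hf
  rwa [add_sub_cancel] at h

theorem Realization.symDatum_p_mem (i : B) {d : ℤ} {f : Sym k V} (hf : f ∈ symDeg k V d) :
    (r.symDatum i).p f ∈ symDeg k V d := by
  rw [DemazureDatum.p, mul_comm]
  exact sub_mem hf (ι_mul_mem_symDeg _ (Realization.symDatum_q_mem i hf))

variable (hα : ∀ i, Function.Surjective fun f : Module.Dual k V => f (r.α i)) (hGKM : r.GKM)

/-- Inducing from `Z^s` is given by `ZObj.double`. -/
def ZObj.induceIso (i : B) {M : ZObj r} (hM : IsZModF M) :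
    M.induce i ≅ M.double (Realization.rightDatum hα hGKM i) :=
  ZObj.isoMk (ZObj.induceEquiv hα hGKM i M)
    (fun d m hm => by
      refine (AddSubgroup.closure_le (K := ((M.double (Realization.rightDatum hα hGKM i)).gr d).comap
        (ZObj.induceEquiv hα hGKM i M).toAddMonoidHom)).mpr ?_ hm
      rintro _ ⟨a, b, rfl, z, hz, m, hm, rfl⟩
      have h := (hM.double (Realization.rightDatum_isGraded hα hGKM i)).smul_mem a b z hz
        (Double.mk m 0 : Double (Realization.rightDatum hα hGKM i) M.carrier) ⟨hm, (M.gr _).zero_mem⟩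
      exact h)
    (fun d m hm => by
      have h1 : r.ZHomog 0 1 := fun w => SetLike.one_mem_graded (symDeg k V)
      exact ((M.induce i).gr d).add_mem
        (AddSubgroup.subset_closure ⟨0, d, zero_add d, 1, h1, _, hm.1, rfl⟩)
        (AddSubgroup.subset_closure ⟨2, d - 2, by ring, _,
          (Realization.rightDatum_isGraded hα hGKM i).gen_homog, _, hm.2, rfl⟩))

/-- Right invariance gives `z_s = z_1`, so at the identity the left quotient `(z_1 - s(z_s))/α_s` is
the Demazure operator of `R`. -/
theorem Realization.leftDatum_q_one (i : B) {z : r.Z}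
    (hz : (Realization.rightDatum hα hGKM i).σ z = z) :
    ((Realization.leftDatum hα hGKM i).q z : W → Sym k V) 1 =
      (r.symDatum i).q ((z : W → Sym k V) 1) := by
  refine ((r.symDatum i).q_eq ?_).symm
  have h1 := congrFun (congrArg Subtype.val ((Realization.leftDatum hα hGKM i).a_mul_q z)) 1
  have h2 : (z : W → Sym k V) (1 * cs.simple i) = (z : W → Sym k V) 1 :=
    congrFun (congrArg Subtype.val hz) 1
  refine Eq.trans ?_ h1.symm
  change _ - r.act _ ((z : W → Sym k V) 1) = _ - r.act _ ((z : W → Sym k V) (cs.simple i * 1))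
  rw [← h2, one_mul, mul_one]

/-- Evaluation at the identity. -/
def Realization.evalOne (r : Realization k cs V) : r.Z →+* Sym k V :=
  (Pi.evalRingHom (fun _ : W => Sym k V) 1).comp r.Z.val.toRingHom

/-- `Z ⊗_{Z^s} R(e)` can be computed using the left or the right multiplication by `s`. -/
def Realization.exchangeIso (i : B) :
    (zUnit r).double (Realization.rightDatum hα hGKM i) ≅
      (zUnit r).double (Realization.leftDatum hα hGKM i) :=
  let e := @Double.exchangeEquiv (Sym k V) _ (r.symDatum i) r.Z _
    (Realization.rightDatum hα hGKM i) (Realization.leftDatum hα hGKM i) (zUnit r).module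
    (Realization.datum_indep hα hGKM i i) r.evalOne (fun _ _ => rfl)
    (fun _ hz => Realization.leftDatum_q_one hα hGKM i hz)
    (r.act_one (SymmetricAlgebra.ι k V (r.δ i))) rfl
    (congrArg (fun w => r.act w (SymmetricAlgebra.ι k V (r.δ i))) (one_mul (cs.simple i)))
  have h : ∀ (d : ℤ) (x : Sym k V × Sym k V), x.1 ∈ symDeg k V d → x.2 ∈ symDeg k V (d - 2) →
      ((r.symDatum i).exchange x).1 ∈ symDeg k V d ∧
        ((r.symDatum i).exchange x).2 ∈ symDeg k V (d - 2) := fun _ _ h1 h2 =>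
    ⟨add_mem (Realization.symDatum_p_mem i h1)
        (ι_mul_mem_symDeg _ (Realization.symDatum_p_mem i h2)),
      add_mem (Realization.symDatum_q_mem i h1)
        (ι_mul_mem_symDeg _ (Realization.symDatum_q_mem i h2))⟩
  ZObj.isoMk e (fun d m hm => h d m hm.1 hm.2) (fun d m hm => h d m hm.1 hm.2)

/-- The iterated extension of `R(e)` along left multiplications. -/
def Realization.LBS (x : List B) : ZObj r :=
  x.foldr (fun i N => N.double (Realization.leftDatum hα hGKM i)) (zUnit r)

theorem Realization.isZModF_LBS (x : List B) : IsZModF (Realization.LBS hα hGKM x) := by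
  induction x with
  | nil => exact isZModF_zUnit
  | cons i x ih => exact ih.double (Realization.leftDatum_isGraded hα hGKM i)

/-- The right extension commutes past all left extensions down to `R(e)`, where it is exchanged for
a left one; hence the new letter comes last. -/
theorem Realization.LBS_append_singleton (x : List B) (i : B) :
    Nonempty ((Realization.LBS hα hGKM x).double (Realization.rightDatum hα hGKM i) ≅
      Realization.LBS hα hGKM (x ++ [i])) := by
  induction x with
  | nil => exact ⟨Realization.exchangeIso hα hGKM i⟩
  | cons j x ih =>
    obtain ⟨e⟩ := ih
    exact ⟨ZObj.doubleComm (Realization.datum_indep hα hGKM j i).symm _ ≪≫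
      (ZObj.doubleFunctor _).mapIso e⟩

theorem Realization.foldr_induce_iso_LBS (x : List B) :
    Nonempty (x.foldr (fun i N => N.induce i) (zUnit r) ≅ Realization.LBS hα hGKM x.reverse) := by
  induction x with
  | nil => exact ⟨Iso.refl _⟩
  | cons i x ih =>
    obtain ⟨e⟩ := ih
    rw [List.reverse_cons]
    obtain ⟨e'⟩ := Realization.LBS_append_singleton hα hGKM x.reverse i
    exact ⟨ZObj.induceIso hα hGKM i ((Realization.isZModF_LBS hα hGKM _).of_iso e) ≪≫
      (ZObj.doubleFunctor _).mapIso e ≪≫ e'⟩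

end BottSamelson

end MomentGraph

end

noncomputable section

namespace MomentGraph

/-! ## Direct sums and tensor products of bimodules -/

section Bimod

variable {k V W : Type u} [CommRing k] [AddCommGroup V] [Module k V]

section Loc

variable {M N : Type u} [AddCommGroup M] [Module (Env k V) M] [AddCommGroup N] [Module (Env k V) N]

theorem locQMap_add (f g : M →ₗ[Env k V] N) (x : LocQ k V M) :
    locQMap (f + g) x = locQMap f x + locQMap g x :=
  LinearMap.congr_fun (map_add (IsLocalizedModule.map (rightDen k V) (toLocQ M) (toLocQ N)) f g) x

theorem locQMap_zero (x : LocQ k V M) : locQMap (0 : M →ₗ[Env k V] N) x = 0 :=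
  LinearMap.congr_fun (map_zero (IsLocalizedModule.map (rightDen k V) (toLocQ M) (toLocQ N))) x

theorem locQMap_sum {ι : Type*} (s : Finset ι) (f : ι → M →ₗ[Env k V] N) (x : LocQ k V M) :
    locQMap (∑ i ∈ s, f i) x = ∑ i ∈ s, locQMap (f i) x := by
  classical
  induction s using Finset.induction_on with
  | empty => simp [locQMap_zero]
  | insert i s hi ih => rw [Finset.sum_insert hi, Finset.sum_insert hi, locQMap_add, ih]

theorem locQMap_symm_apply (e : M ≃ₗ[Env k V] N) (x : LocQ k V M) :
    locQMap e.symm.toLinearMap (locQMap e.toLinearMap x) = x := by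
  rw [← locQMap_comp, LinearEquiv.comp_coe, LinearEquiv.self_trans_symm]
  exact locQMap_id x

theorem locQMap_apply_symm (e : M ≃ₗ[Env k V] N) (x : LocQ k V N) :
    locQMap e.toLinearMap (locQMap e.symm.toLinearMap x) = x :=
  locQMap_symm_apply e.symm x

end Loc

/-- The families `(M_Q^w)` of two bimodules correspond under an isomorphism as soon as the
isomorphism respects them in one direction, the first one spans, and the second one is
independent. -/
theorem comp_symm_mem {M N : BimodObj k V W} (e : M.carrier ≃ₗ[Env k V] N.carrier)
    (he : ∀ w, ∀ x ∈ M.comp w, locQMap e.toLinearMap x ∈ N.comp w) (hM : ⨆ w, M.comp w = ⊤)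
    (hN : ∀ (s : Finset W) (f : W → LocQ k V N.carrier), (∀ w, f w ∈ N.comp w) →
      ∑ w ∈ s, f w = 0 → ∀ w ∈ s, f w = 0) (w : W) {y : LocQ k V N.carrier} (hy : y ∈ N.comp w) :
    locQMap e.symm.toLinearMap y ∈ M.comp w := by
  classical
  have hx : locQMap e.symm.toLinearMap y ∈ ⨆ w, M.comp w := hM ▸ Submodule.mem_top
  obtain ⟨f, hf, hsum⟩ := (Submodule.mem_iSup_iff_exists_finsupp _ _).mp hx
  have h0 := hN (insert w f.support)
    (fun v => locQMap e.toLinearMap (f v) - if v = w then y else 0) (fun v => by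
      rw [sub_eq_add_neg, ← neg_one_smul (EnvQ k V)]
      refine add_mem (he v _ (hf v)) (Submodule.smul_mem _ _ ?_)
      split_ifs with h
      · exact h ▸ hy
      · exact zero_mem _) (by
      rw [Finset.sum_sub_distrib, Finset.sum_ite_eq', if_pos (Finset.mem_insert_self _ _),
        ← map_sum, sub_eq_zero, ← locQMap_apply_symm e y, ← hsum, Finsupp.sum]
      congr 1
      refine (Finset.sum_subset (Finset.subset_insert _ _) fun v _ hv => ?_).symm
      exact Finsupp.notMem_support_iff.mp hv) w (Finset.mem_insert_self _ _)
  rw [if_pos rfl, sub_eq_zero] at h0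
  rw [← h0, locQMap_symm_apply]
  exact hf w

/-- Isomorphisms from linear equivalences. -/
def BimodObj.isoMk {M N : BimodObj k V W} (e : M.carrier ≃ₗ[Env k V] N.carrier)
    (h : ∀ d, ∀ m ∈ M.gr d, e m ∈ N.gr d) (h' : ∀ d, ∀ n ∈ N.gr d, e.symm n ∈ M.gr d)
    (hc : ∀ w, ∀ x ∈ M.comp w, locQMap e.toLinearMap x ∈ N.comp w)
    (hc' : ∀ w, ∀ x ∈ N.comp w, locQMap e.symm.toLinearMap x ∈ M.comp w) : M ≅ N where
  hom := ⟨e.toLinearMap, h, hc⟩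
  inv := ⟨e.symm.toLinearMap, h', hc'⟩
  hom_inv_id := BimodHom.ext (LinearMap.ext fun m => e.symm_apply_apply m)
  inv_hom_id := BimodHom.ext (LinearMap.ext fun m => e.apply_symm_apply m)

theorem BimodHom.hom_inv_apply {M N : BimodObj k V W} (e : M ≅ N) (m : M.carrier) :
    BimodHom.toLin e.inv (BimodHom.toLin e.hom m) = m :=
  LinearMap.congr_fun (congrArg BimodHom.toLin e.hom_inv_id) m

theorem BimodHom.inv_hom_apply {M N : BimodObj k V W} (e : M ≅ N) (n : N.carrier) :
    BimodHom.toLin e.hom (BimodHom.toLin e.inv n) = n :=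
  LinearMap.congr_fun (congrArg BimodHom.toLin e.inv_hom_id) n

namespace BimodObj

variable {n : ℕ} {M : Fin n → BimodObj k V W} {N : BimodObj k V W}

theorem mem_directSum_gr {d : ℤ} {m : ∀ i, (M i).carrier} :
    m ∈ (directSum M).gr d ↔ ∀ i, m i ∈ (M i).gr d := by
  have h := AddSubgroup.mem_iInf (x := m)
    (S := fun i => ((M i).gr d).comap (Pi.evalAddMonoidHom (fun i => (M i).carrier) i))
  exact h

theorem mem_directSum_comp {w : W} {x : LocQ k V (∀ i, (M i).carrier)} :
    x ∈ (directSum M).comp w ↔ ∀ i, locQMap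
      (LinearMap.proj i : (∀ i, (M i).carrier) →ₗ[Env k V] (M i).carrier) x ∈ (M i).comp w := by
  have h := Submodule.mem_iInf (x := x) fun i => ((M i).comp w).comap
    (locQMap (LinearMap.proj i : (∀ i, (M i).carrier) →ₗ[Env k V] (M i).carrier))
  exact h

variable (M) in
/-- The projections of a direct sum. -/
def proj (i : Fin n) : directSum M ⟶ M i where
  toLin := (LinearMap.proj i : (∀ i, (M i).carrier) →ₗ[Env k V] (M i).carrier)
  map_gr _ _ hm := mem_directSum_gr.mp hm i
  map_comp _ _ hx := mem_directSum_comp.mp hx i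

/-- Maps into a direct sum. -/
def lift (f : ∀ i, N ⟶ M i) : N ⟶ directSum M where
  toLin := (LinearMap.pi fun i => BimodHom.toLin (f i) :
    N.carrier →ₗ[Env k V] (∀ i, (M i).carrier))
  map_gr d m hm := mem_directSum_gr.mpr fun i => BimodHom.map_gr (f i) d m hm
  map_comp w x hx := mem_directSum_comp.mpr fun i => by
    have h := BimodHom.map_comp (f i) w x hx
    have e : BimodHom.toLin (f i) =
        (LinearMap.proj i : (∀ i, (M i).carrier) →ₗ[Env k V] (M i).carrier) ∘ₗ
          (LinearMap.pi fun i => BimodHom.toLin (f i)) := rfl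
    rw [e] at h
    exact (locQMap_comp (LinearMap.proj i : (∀ i, (M i).carrier) →ₗ[Env k V] (M i).carrier)
      (LinearMap.pi fun i => BimodHom.toLin (f i)) x).symm ▸ h

/-- Maps out of a direct sum. -/
def desc (f : ∀ i, M i ⟶ N) : directSum M ⟶ N where
  toLin := (∑ i, BimodHom.toLin (f i) ∘ₗ
    (LinearMap.proj i : (∀ i, (M i).carrier) →ₗ[Env k V] (M i).carrier))
  map_gr d m hm := by
    have h : ∑ i, BimodHom.toLin (f i) ((m : ∀ i, (M i).carrier) i) ∈ N.gr d :=
      sum_mem fun i _ => BimodHom.map_gr (f i) d _ (mem_directSum_gr.mp hm i)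
    exact (LinearMap.sum_apply Finset.univ (fun i => BimodHom.toLin (f i) ∘ₗ
      (LinearMap.proj i : (∀ i, (M i).carrier) →ₗ[Env k V] (M i).carrier)) m).symm ▸ h
  map_comp w x hx := by
    have h : ∑ i, locQMap (BimodHom.toLin (f i) ∘ₗ
        (LinearMap.proj i : (∀ i, (M i).carrier) →ₗ[Env k V] (M i).carrier)) x ∈ N.comp w :=
      sum_mem fun i _ => (locQMap_comp (BimodHom.toLin (f i))
        (LinearMap.proj i : (∀ i, (M i).carrier) →ₗ[Env k V] (M i).carrier) x).symm ▸
        BimodHom.map_comp (f i) w _ (mem_directSum_comp.mp hx i)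
    exact (locQMap_sum Finset.univ (fun i => BimodHom.toLin (f i) ∘ₗ
      (LinearMap.proj i : (∀ i, (M i).carrier) →ₗ[Env k V] (M i).carrier)) x).symm ▸ h

theorem desc_apply (f : ∀ i, M i ⟶ N) (m : ∀ i, (M i).carrier) :
    BimodHom.toLin (desc f) m = ∑ i, BimodHom.toLin (f i) (m i) :=
  LinearMap.sum_apply Finset.univ (fun i => BimodHom.toLin (f i) ∘ₗ
      (LinearMap.proj i : (∀ i, (M i).carrier) →ₗ[Env k V] (M i).carrier)) m

variable (M) in
/-- The inclusions of the summands of a direct sum. -/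
def inj (i : Fin n) : M i ⟶ directSum M where
  toLin := (LinearMap.single (Env k V) (fun i => (M i).carrier) i :
    (M i).carrier →ₗ[Env k V] (∀ i, (M i).carrier))
  map_gr d m hm := mem_directSum_gr.mpr fun j => by
    change (Pi.single i m : ∀ i, (M i).carrier) j ∈ _
    by_cases hij : j = i
    · subst hij
      exact (Pi.single_eq_same (M := fun i => (M i).carrier) j m).symm ▸ hm
    · exact (Pi.single_eq_of_ne (M := fun i => (M i).carrier) hij m).symm ▸ ((M j).gr d).zero_mem
  map_comp w x hx := mem_directSum_comp.mpr fun j => by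
    have h := locQMap_comp (LinearMap.proj j : (∀ i, (M i).carrier) →ₗ[Env k V] (M j).carrier)
      (LinearMap.single (Env k V) (fun i => (M i).carrier) i) x
    refine h ▸ ?_
    by_cases hij : i = j
    · subst hij
      rw [LinearMap.proj_comp_single_same, locQMap_id]
      exact hx
    · rw [LinearMap.proj_comp_single_ne _ _ _ _ (Ne.symm hij), locQMap_zero]
      exact zero_mem _

/-- Direct sums of isomorphisms. -/
def directSumIso {N : Fin n → BimodObj k V W} (e : ∀ i, M i ≅ N i) : directSum M ≅ directSum N where
  hom := lift fun i => proj M i ≫ (e i).hom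
  inv := lift fun i => proj N i ≫ (e i).inv
  hom_inv_id := BimodHom.ext (LinearMap.ext fun m => funext fun i =>
    BimodHom.hom_inv_apply (e i) ((m : ∀ i, (M i).carrier) i))
  inv_hom_id := BimodHom.ext (LinearMap.ext fun m => funext fun i =>
    BimodHom.inv_hom_apply (e i) ((m : ∀ i, (N i).carrier) i))

/-- Shifts of isomorphisms. -/
def shiftIso {M N : BimodObj k V W} (e : M ≅ N) (n : ℤ) : M.shift n ≅ N.shift n where
  hom := BimodHom.mk (M := M.shift n) (N := N.shift n) (BimodHom.toLin (M := M) (N := N) e.hom)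
    (fun d => BimodHom.map_gr (M := M) (N := N) e.hom (n + d))
    (BimodHom.map_comp (M := M) (N := N) e.hom)
  inv := BimodHom.mk (M := N.shift n) (N := M.shift n) (BimodHom.toLin (M := N) (N := M) e.inv)
    (fun d => BimodHom.map_gr (M := N) (N := M) e.inv (n + d))
    (BimodHom.map_comp (M := N) (N := M) e.inv)
  hom_inv_id := BimodHom.ext (LinearMap.ext (BimodHom.hom_inv_apply e))
  inv_hom_id := BimodHom.ext (LinearMap.ext (BimodHom.inv_hom_apply e))

end BimodObj

/-! ### Functoriality of the tensor product in the second factor -/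

theorem BiTensor.induction {M N : Type u} [AddCommGroup M] [Module (Env k V) M] [AddCommGroup N]
    [Module (Env k V) N] {P : BiTensor k V M N → Prop} (h0 : P 0)
    (h : ∀ (m : M) (n : N), P (biTmul m n)) (ha : ∀ x y, P x → P y → P (x + y))
    (x : BiTensor k V M N) : P x :=
  TensorProduct.induction_on (R := Sym k V) (M := RightMod M) (N := LeftMod N) x h0 h ha

theorem BiTensor.linearMap_ext {M N P : Type u} [AddCommGroup M] [Module (Env k V) M]
    [AddCommGroup N] [Module (Env k V) N] [AddCommGroup P] [Module (Env k V) P]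
    {f g : BiTensor k V M N →ₗ[Env k V] P} (h : ∀ m n, f (biTmul m n) = g (biTmul m n)) : f = g :=
  LinearMap.ext fun x => BiTensor.induction (P := fun x => f x = g x) ((map_zero f).trans (map_zero g).symm) h
    (fun x y hx hy => by rw [map_add, map_add, hx, hy]) x

/-- Bimodule maps out of a tensor product. -/
def BiTensor.lift {M N P : Type u} [AddCommGroup M] [Module (Env k V) M]
    [AddCommGroup N] [Module (Env k V) N] [AddCommGroup P] [Module (Env k V) P]
    (f : M →+ N →+ P)
    (hf : ∀ (a : Sym k V) m n, f (((1 : Sym k V) ⊗ₜ[k] a : Env k V) • m) n =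
      f m ((a ⊗ₜ[k] (1 : Sym k V) : Env k V) • n))
    (hs : ∀ (a b : Sym k V) m n, f ((a ⊗ₜ[k] (1 : Sym k V) : Env k V) • m)
      (((1 : Sym k V) ⊗ₜ[k] b : Env k V) • n) = (a ⊗ₜ[k] b : Env k V) • f m n) :
    BiTensor k V M N →ₗ[Env k V] P :=
  let F : BiTensor k V M N →+ P :=
    TensorProduct.liftAddHom (R := Sym k V) (M := RightMod M) (N := LeftMod N) f hf
  { F with
    map_smul' := fun c x => by
      change F (c • x) = c • F x
      induction c using TensorProduct.induction_on with
      | zero =>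
        exact (congrArg F (zero_smul (Env k V) x)).trans
          ((map_zero F).trans (zero_smul (Env k V) (F x)).symm)
      | add c d hc hd => rw [add_smul, add_smul, map_add, hc, hd]
      | tmul a b =>
        refine BiTensor.induction (P := fun x => F ((a ⊗ₜ[k] b : Env k V) • x) =
          (a ⊗ₜ[k] b : Env k V) • F x) ?_ ?_ ?_ x
        · rw [smul_zero, map_zero, smul_zero]
        · intro m n
          rw [smul_biTmul]
          exact hs a b m n
        · intro x y hx hy
          rw [smul_add, map_add, map_add, smul_add, hx, hy] }

theorem biTmul_add {M N : Type u} [AddCommGroup M] [Module (Env k V) M] [AddCommGroup N]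
    [Module (Env k V) N] (m : M) (n n' : N) :
    (biTmul m (n + n') : BiTensor k V M N) = biTmul m n + biTmul m n' :=
  TensorProduct.tmul_add (R := Sym k V) (M := RightMod M) (N := LeftMod N) m n n'

theorem add_biTmul {M N : Type u} [AddCommGroup M] [Module (Env k V) M] [AddCommGroup N]
    [Module (Env k V) N] (m m' : M) (n : N) :
    (biTmul (m + m') n : BiTensor k V M N) = biTmul m n + biTmul m' n :=
  TensorProduct.add_tmul (R := Sym k V) (M := RightMod M) (N := LeftMod N) m m' n

/-- The map `(m, n) ↦ m ⊗ n` as a biadditive map. -/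
def biTmulHom {M N : Type u} [AddCommGroup M] [Module (Env k V) M] [AddCommGroup N]
    [Module (Env k V) N] : M →+ N →+ BiTensor k V M N :=
  AddMonoidHom.mk' (fun m => AddMonoidHom.mk' (fun n => biTmul m n) (biTmul_add m))
    fun m m' => AddMonoidHom.ext fun n => add_biTmul m m' n

/-- Functoriality of `BiTensor` in the second factor. -/
def BiTensor.lTensor (M : Type u) {N N' : Type u} [AddCommGroup M] [Module (Env k V) M]
    [AddCommGroup N] [Module (Env k V) N] [AddCommGroup N'] [Module (Env k V) N']
    (f : N →ₗ[Env k V] N') : BiTensor k V M N →ₗ[Env k V] BiTensor k V M N' :=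
  BiTensor.lift ((AddMonoidHom.compHom' f.toAddMonoidHom).comp biTmulHom)
    (fun a m n => by
      change biTmul _ (f n) = biTmul _ (f _)
      rw [biTmul_balanced, map_smul])
    (fun a b m n => by
      change biTmul _ (f _) = _ • biTmul _ (f n)
      rw [map_smul, smul_biTmul])

variable [Group W]

/-- Linear maps out of a tensor product preserve degrees if they do so on pure tensors. -/
theorem BimodObj.tensor_gr_le (M N P : BimodObj k V W)
    (f : BiTensor k V M.carrier N.carrier →ₗ[Env k V] P.carrier)
    (hf : ∀ i j, ∀ m ∈ M.gr i, ∀ n ∈ N.gr j, f (biTmul m n) ∈ P.gr (i + j)) (d : ℤ)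
    (x : BiTensor k V M.carrier N.carrier) (hx : x ∈ (M.tensor N).gr d) : f x ∈ P.gr d := by
  refine (AddSubgroup.closure_le (K := (P.gr d).comap f.toAddMonoidHom)).mpr ?_ hx
  rintro _ ⟨i, j, rfl, m, hm, n, hn, rfl⟩
  exact hf i j m hm n hn

/-- Linear maps out of a tensor product respect the decompositions if they do so on pure
tensors. -/
theorem BimodObj.tensor_comp_le (M N P : BimodObj k V W)
    (f : BiTensor k V M.carrier N.carrier →ₗ[Env k V] P.carrier)
    (hf : ∀ a b m n, toLocQ M.carrier m ∈ M.comp a → toLocQ N.carrier n ∈ N.comp b →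
      toLocQ P.carrier (f (biTmul m n)) ∈ P.comp (a * b)) (w : W)
    (x : LocQ k V (BiTensor k V M.carrier N.carrier)) (hx : x ∈ (M.tensor N).comp w) :
    locQMap f x ∈ P.comp w := by
  refine (Submodule.span_le (p := (P.comp w).comap (locQMap f))).mpr ?_ hx
  rintro _ ⟨a, b, rfl, m, n, hm, hn, rfl⟩
  change locQMap f _ ∈ P.comp (a * b)
  rw [locQMap_toLocQ]
  exact hf a b m n hm hn

/-- Functoriality of the tensor product in the second factor. -/
def BimodObj.tensorMap (M : BimodObj k V W) {N N' : BimodObj k V W} (f : N ⟶ N') :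
    M.tensor N ⟶ M.tensor N' where
  toLin := BiTensor.lTensor M.carrier (BimodHom.toLin f)
  map_gr := BimodObj.tensor_gr_le M N (M.tensor N') _ fun i j m hm n hn =>
    AddSubgroup.subset_closure ⟨i, j, rfl, m, hm, _, BimodHom.map_gr f j n hn, rfl⟩
  map_comp := BimodObj.tensor_comp_le M N (M.tensor N') _ fun a b m n hm hn =>
    Submodule.subset_span (R := EnvQ k V) (M := LocQ k V (BiTensor k V M.carrier N'.carrier)) ⟨a, b, rfl, m, BimodHom.toLin f n, hm,
      locQMap_toLocQ (BimodHom.toLin f) n ▸ BimodHom.map_comp f b _ hn, rfl⟩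

/-- Tensor products preserve isomorphisms in the second factor. -/
def BimodObj.tensorIso (M : BimodObj k V W) {N N' : BimodObj k V W} (e : N ≅ N') :
    M.tensor N ≅ M.tensor N' where
  hom := M.tensorMap e.hom
  inv := M.tensorMap e.inv
  hom_inv_id := BimodHom.ext (BiTensor.linearMap_ext (M := M.carrier) (N := N.carrier)
    fun m n => congrArg (biTmul m) (BimodHom.hom_inv_apply e n))
  inv_hom_id := BimodHom.ext (BiTensor.linearMap_ext (M := M.carrier) (N := N'.carrier)
    fun m n => congrArg (biTmul m) (BimodHom.inv_hom_apply e n))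

end Bimod

end MomentGraph

end

noncomputable section

namespace MomentGraph

/-! ## The bimodule `B_s` -/

section Bs

namespace DemazureDatum

variable {A T : Type*} [CommRing A] [CommRing T] (d : DemazureDatum A) {l ρ : A →+* T}

theorem mul_eq_of_fixed (h : ∀ a, d.σ a = a → l a = ρ a) {x : T}
    (hx : ρ d.gen * x = l d.gen * x) (a : A) : ρ a * x = l a * x := by
  rw [← d.p_add_q a, map_add, map_add, map_mul, map_mul, h _ (d.σ_p a), h _ (d.σ_q a), add_mul,
    add_mul, mul_assoc, hx, mul_assoc]

/-- With `T = R ⊗_{R^s} R` and its two inclusions of `R`, this yields the elements of `B_s`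
belonging to `e`, and `mul_gen_sub'` those belonging to `s`. Only `a = gen` needs checking; there it
follows from the invariance of `gen + σ gen` and `gen · σ gen`. -/
theorem mul_gen_sub (h : ∀ a, d.σ a = a → l a = ρ a) (a : A) :
    ρ a * (l d.gen - ρ (d.σ d.gen)) = l a * (l d.gen - ρ (d.σ d.gen)) := by
  refine d.mul_eq_of_fixed h ?_ a
  have h1 := h _ d.σ_add_gen
  have h2 := h _ d.σ_mul_gen
  rw [map_add, map_add] at h1
  rw [map_mul, map_mul] at h2
  linear_combination -(l d.gen) * h1 + h2

theorem mul_gen_sub' (h : ∀ a, d.σ a = a → l a = ρ a) (a : A) :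
    ρ a * (l d.gen - ρ d.gen) = l (d.σ a) * (l d.gen - ρ d.gen) := by
  -- Twisting `l` by `σ` does not change it on invariants.
  have h' : ∀ a, d.σ a = a → (l.comp d.σ) a = ρ a := fun a ha => by
    rw [RingHom.comp_apply, ha, h a ha]
  refine d.mul_eq_of_fixed (l := l.comp d.σ) h' ?_ a
  have h1 := h _ d.σ_add_gen
  have h2 := h _ d.σ_mul_gen
  rw [map_add, map_add] at h1
  rw [map_mul, map_mul] at h2
  rw [RingHom.comp_apply]
  linear_combination ρ d.gen * h1 - h2

end DemazureDatum

variable {k : Type u} [CommRing k] {W : Type u} [Group W] {B : Type v} {C : CoxeterMatrix B}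
  {cs : CoxeterSystem C W} {V : Type u} [AddCommGroup V] [Module k V] {r : Realization k cs V}

namespace Realization

theorem tmul_fixed (i : B) {f : Sym k V} (hf : r.act (cs.simple i) f = f) (a b : Sym k V) :
    (f * a) ⊗ₜ[r.fixed i] b = a ⊗ₜ[r.fixed i] (f * b) :=
  TensorProduct.smul_tmul (R := r.fixed i) (⟨f, hf⟩ : r.fixed i) a b

variable (r) in
/-- The left inclusion `R → R ⊗_{R^s} R`. -/
def BsInl (i : B) : Sym k V →+* r.BsCarrier i :=
  (Algebra.TensorProduct.includeLeft : Sym k V →ₐ[r.fixed i] r.BsCarrier i).toRingHom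

variable (r) in
/-- The right inclusion `R → R ⊗_{R^s} R`. -/
def BsInr (i : B) : Sym k V →+* r.BsCarrier i :=
  (Algebra.TensorProduct.includeRight : Sym k V →ₐ[r.fixed i] r.BsCarrier i).toRingHom

theorem env_smul_Bs (i : B) (f g : Sym k V) (b : r.BsCarrier i) :
    (f ⊗ₜ[k] g : Env k V) • b = r.BsInl i f * r.BsInr i g * b := by
  change Algebra.TensorProduct.productMap _ _ (f ⊗ₜ[k] g) * b = _
  rw [Algebra.TensorProduct.productMap_apply_tmul]
  rfl

theorem left_smul_Bs (i : B) (f : Sym k V) (b : r.BsCarrier i) :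
    (f ⊗ₜ[k] (1 : Sym k V) : Env k V) • b = r.BsInl i f * b := by
  rw [env_smul_Bs, map_one, mul_one]

theorem right_smul_Bs (i : B) (f : Sym k V) (b : r.BsCarrier i) :
    ((1 : Sym k V) ⊗ₜ[k] f : Env k V) • b = r.BsInr i f * b := by
  rw [env_smul_Bs, map_one, one_mul]

theorem BsInl_eq_BsInr (i : B) (f : Sym k V) (hf : r.act (cs.simple i) f = f) :
    r.BsInl i f = r.BsInr i f := by
  have h := tmul_fixed i hf 1 1
  rw [mul_one] at h
  exact h

variable [IsDomain k] [Module.Free k V]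

variable (r) in
/-- `symDatum` as a linear map over the invariants. -/
def fixedLin (i : B) (f : Sym k V → Sym k V) (ha : ∀ x y, f (x + y) = f x + f y)
    (hf : ∀ x, (r.symDatum i).σ x = x → ∀ y, f (x * y) = x * f y) :
    Sym k V →ₗ[r.fixed i] Sym k V where
  toFun := f
  map_add' := ha
  map_smul' a y := hf a a.2 y

variable (r) in
/-- The first right coordinate on `R ⊗_{R^s} R` for the basis `1 ⊗ 1`, `δ ⊗ 1`. -/
def BsFst (i : B) : r.BsCarrier i →+ Sym k V :=
  (LinearMap.mul' (r.fixed i) (Sym k V) ∘ₗ TensorProduct.map (r.fixedLin i (r.symDatum i).p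
    (r.symDatum i).p_add fun _ h y => (r.symDatum i).p_mul h y) LinearMap.id).toAddMonoidHom

variable (r) in
/-- The second right coordinate on `R ⊗_{R^s} R` for the basis `1 ⊗ 1`, `δ ⊗ 1`. -/
def BsSnd (i : B) : r.BsCarrier i →+ Sym k V :=
  (LinearMap.mul' (r.fixed i) (Sym k V) ∘ₗ TensorProduct.map (r.fixedLin i (r.symDatum i).q
    (r.symDatum i).q_add fun _ h y => (r.symDatum i).q_mul h y) LinearMap.id).toAddMonoidHom

theorem BsFst_tmul (i : B) (f g : Sym k V) :
    r.BsFst i (f ⊗ₜ[r.fixed i] g) = (r.symDatum i).p f * g := rfl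

theorem BsSnd_tmul (i : B) (f g : Sym k V) :
    r.BsSnd i (f ⊗ₜ[r.fixed i] g) = (r.symDatum i).q f * g := rfl

/-- Write the left factor as `p f + q f · δ` and move the invariant coefficients to the right. With
the formulas for the coordinates this makes `B_s` free on the right. -/
theorem Bs_eq (i : B) (b : r.BsCarrier i) : b = ((1 : Sym k V) ⊗ₜ[k] r.BsFst i b : Env k V) • 1 +
    ((1 : Sym k V) ⊗ₜ[k] r.BsSnd i b : Env k V) • r.BsInl i (r.symDatum i).gen := by
  rw [right_smul_Bs, right_smul_Bs, mul_one]
  induction b using TensorProduct.induction_on with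
  | zero => simp
  | add x y hx hy =>
    conv_lhs => rw [hx, hy]
    simp only [map_add]
    ring
  | tmul f g =>
    rw [BsFst_tmul, BsSnd_tmul, map_mul, map_mul, ← BsInl_eq_BsInr i _ ((r.symDatum i).σ_p f),
      ← BsInl_eq_BsInr i _ ((r.symDatum i).σ_q f), mul_right_comm, ← map_mul, ← add_mul, ← map_add,
      (r.symDatum i).p_add_q]
    change _ = (f ⊗ₜ[r.fixed i] 1) * (1 ⊗ₜ[r.fixed i] g)
    rw [Algebra.TensorProduct.tmul_mul_tmul, mul_one, one_mul]

theorem BsFst_smul (i : B) (f g : Sym k V) (b : r.BsCarrier i) :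
    r.BsFst i ((f ⊗ₜ[k] g : Env k V) • b) = ((r.symDatum i).p f * r.BsFst i b +
      (r.symDatum i).p (f * (r.symDatum i).gen) * r.BsSnd i b) * g := by
  induction b using TensorProduct.induction_on with
  | zero => simp
  | add x y hx hy =>
    rw [smul_add, map_add, map_add, map_add, hx, hy]
    ring
  | tmul a b =>
    rw [smul_BsCarrier, BsFst_tmul, BsFst_tmul, BsSnd_tmul, (r.symDatum i).p_mul_eq f a]
    ring

theorem BsSnd_smul (i : B) (f g : Sym k V) (b : r.BsCarrier i) :
    r.BsSnd i ((f ⊗ₜ[k] g : Env k V) • b) = ((r.symDatum i).q f * r.BsFst i b +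
      (r.symDatum i).q (f * (r.symDatum i).gen) * r.BsSnd i b) * g := by
  induction b using TensorProduct.induction_on with
  | zero => simp
  | add x y hx hy =>
    rw [smul_add, map_add, map_add, map_add, hx, hy]
    ring
  | tmul a b =>
    rw [smul_BsCarrier, BsSnd_tmul, BsFst_tmul, BsSnd_tmul, (r.symDatum i).q_mul_eq f a]
    ring

theorem BsFst_right_smul (i : B) (g : Sym k V) (b : r.BsCarrier i) :
    r.BsFst i (((1 : Sym k V) ⊗ₜ[k] g : Env k V) • b) = g * r.BsFst i b := by
  have h : (r.symDatum i).σ 1 = 1 := map_one _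
  rw [BsFst_smul, (r.symDatum i).p_fixed h, one_mul, one_mul, (r.symDatum i).p_gen, zero_mul,
    add_zero, mul_comm]

theorem BsSnd_right_smul (i : B) (g : Sym k V) (b : r.BsCarrier i) :
    r.BsSnd i (((1 : Sym k V) ⊗ₜ[k] g : Env k V) • b) = g * r.BsSnd i b := by
  have h : (r.symDatum i).σ 1 = 1 := map_one _
  rw [BsSnd_smul, (r.symDatum i).q_fixed h, one_mul, (r.symDatum i).q_gen, zero_mul, zero_add,
    one_mul, mul_comm]

theorem Bs_ext (i : B) {b c : r.BsCarrier i} (h : r.BsFst i b = r.BsFst i c)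
    (h' : r.BsSnd i b = r.BsSnd i c) : b = c := by
  rw [Bs_eq i b, Bs_eq i c, h, h']

theorem Bs_torsionFree (i : B) {g : Sym k V} (hg : g ≠ 0) {b : r.BsCarrier i}
    (h : ((1 : Sym k V) ⊗ₜ[k] g : Env k V) • b = 0) : b = 0 := by
  refine Bs_ext i ?_ ?_
  · have h1 := congrArg (r.BsFst i) h
    rw [BsFst_right_smul, map_zero] at h1
    rw [map_zero]
    exact (mul_eq_zero.mp h1).resolve_left hg
  · have h1 := congrArg (r.BsSnd i) h
    rw [BsSnd_right_smul, map_zero] at h1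
    rw [map_zero]
    exact (mul_eq_zero.mp h1).resolve_left hg

/-- Right torsion freeness allows the eigenvector condition to be tested in `B_s` instead of its
localization. -/
theorem toLocQ_mem_Bs_comp (i : B) {w : W} (hw : w = 1 ∨ w = cs.simple i) {b : r.BsCarrier i} :
    toLocQ (r.BsCarrier i) b ∈ (r.Bs i).comp w ↔
      ∀ f, ((1 : Sym k V) ⊗ₜ[k] f : Env k V) • b = (r.act w f ⊗ₜ[k] (1 : Sym k V) : Env k V) • b := by
  have h1 : (r.Bs i).comp w = ⨅ f : Sym k V,
        LinearMap.ker
          (algebraMap (Env k V) (EnvQ k V)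
              ((1 : Sym k V) ⊗ₜ[k] f - r.act w f ⊗ₜ[k] (1 : Sym k V)) •
            (LinearMap.id : LocQ k V (r.BsCarrier i) →ₗ[EnvQ k V] LocQ k V (r.BsCarrier i))) :=
    iSup_pos hw
  rw [h1]
  have h2 := Submodule.mem_iInf (x := toLocQ (r.BsCarrier i) b) fun f : Sym k V =>
        LinearMap.ker
          (algebraMap (Env k V) (EnvQ k V)
              ((1 : Sym k V) ⊗ₜ[k] f - r.act w f ⊗ₜ[k] (1 : Sym k V)) •
            (LinearMap.id : LocQ k V (r.BsCarrier i) →ₗ[EnvQ k V] LocQ k V (r.BsCarrier i)))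
  refine h2.trans (forall_congr' fun f => ?_)
  rw [LinearMap.mem_ker, LinearMap.smul_apply, LinearMap.id_apply,
    algebraMap_smul (EnvQ k V) _ (toLocQ (r.BsCarrier i) b), ← map_smul, toLocQ_eq_zero, sub_smul,
    ← sub_eq_zero (a := ((1 : Sym k V) ⊗ₜ[k] f : Env k V) • b)]
  constructor
  · rintro ⟨g, hg, h⟩
    exact Bs_torsionFree i hg h
  · intro h
    exact ⟨1, one_ne_zero, by rw [h, smul_zero]⟩

omit [IsDomain k] [Module.Free k V] in
theorem Bs_comp_eq_bot (i : B) {w : W} (hw : ¬ (w = 1 ∨ w = cs.simple i)) :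
    (r.Bs i).comp w = ⊥ := iSup_neg hw

end Realization

end Bs

end MomentGraph

end

noncomputable section

namespace MomentGraph

/-! ## Tensor products with `B_s` -/

section TensorBs

variable (k V : Type u) [CommRing k] [AddCommGroup V] [Module k V]

/-- Nonzero elements of `R` act injectively from the right. -/
def RightTorsionFree (M : Type u) [AddCommGroup M] [Module (Env k V) M] : Prop :=
  ∀ g : Sym k V, g ≠ 0 → ∀ m : M, ((1 : Sym k V) ⊗ₜ[k] g : Env k V) • m = 0 → m = 0

variable {k V} {W : Type u} [Group W] {B : Type v} {C : CoxeterMatrix B}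
  {cs : CoxeterSystem C W} {r : Realization k cs V}

theorem ZObj.mem_comp_one_zUnit (x : LocQ k V (zUnit r).carrier) : x ∈ (zUnit r).comp 1 := by
  rw [ZObj.mem_comp]
  intro z
  have e : (zUnit r).lsmul z = (((z : W → Sym k V) 1 ⊗ₜ[k] (1 : Sym k V) : Env k V) •
      (LinearMap.id : (zUnit r).carrier →ₗ[Env k V] (zUnit r).carrier)) :=
    LinearMap.ext fun m => ((zUnit r).left_smul _ m).symm
  have h := LinearMap.congr_fun (map_smul (IsLocalizedModule.map (rightDen k V)
    (toLocQ (zUnit r).carrier) (toLocQ (zUnit r).carrier))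
    ((z : W → Sym k V) 1 ⊗ₜ[k] (1 : Sym k V) : Env k V) LinearMap.id) x
  rw [e]
  exact h.trans (congrArg (fun y => ((z : W → Sym k V) 1 ⊗ₜ[k] (1 : Sym k V) : Env k V) • y) (locQMap_id x))

theorem ZObj.toLocQ_mem_comp_iff [IsDomain k] [Module.Free k V] {P : ZObj r}
    (hP : RightTorsionFree k V P.carrier) (x : W) (m : P.carrier) :
    toLocQ P.carrier m ∈ P.comp x ↔ ∀ z : r.Z, z • m = r.const ((z : W → Sym k V) x) • m := by
  refine ⟨fun h z => ?_, P.toLocQ_mem_comp x m⟩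
  have h1 := (P.mem_comp x _).mp h z
  rw [locQMap_toLocQ, ← map_smul, ← sub_eq_zero, ← map_sub, toLocQ_eq_zero] at h1
  obtain ⟨g, hg, h2⟩ := h1
  have h3 := sub_eq_zero.mp (hP g hg _ h2)
  rw [P.left_smul] at h3
  exact h3

variable [IsDomain k] [Module.Free k V]

omit [IsDomain k] [Module.Free k V] in
theorem Realization.σL_toZRight (i : B) (f : Sym k V) :
    r.σL i (r.toZRight f) = r.toZRight f := Realization.Z_ext fun w => by
  rw [Realization.σL_apply, Realization.toZRight_apply, Realization.toZRight_apply, ← r.act_mul,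
    cs.simple_mul_simple_cancel_left]

variable (hα : ∀ i, Function.Surjective fun f : Module.Dual k V => f (r.α i)) (hGKM : r.GKM)

theorem Realization.leftDatum_q_const (i : B) (f : Sym k V) :
    (Realization.leftDatum hα hGKM i).q (r.const f) = r.const ((r.symDatum i).q f) := by
  refine (Realization.leftDatum hα hGKM i).q_eq ?_
  change r.const f - r.const ((r.symDatum i).σ f) = r.const (r.symDatum i).a * _
  rw [← map_sub, ← map_mul, (r.symDatum i).a_mul_q]

theorem Realization.leftDatum_p_const (i : B) (f : Sym k V) :
    (Realization.leftDatum hα hGKM i).p (r.const f) = r.const ((r.symDatum i).p f) := by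
  rw [DemazureDatum.p, Realization.leftDatum_q_const, DemazureDatum.p, map_sub, map_mul]
  rfl

/-- The right action is coordinatewise and the left action is by the matrix of `a` over `R`, exactly
as in `BsFst_smul`; this is what makes `ZObj.tensorBsHom` a bimodule map. -/
theorem ZObj.fst_env_smul_double (i : B) (P : ZObj r) (a c : Sym k V)
    (x : (P.double (Realization.leftDatum hα hGKM i)).carrier) :
    Double.fst (D := Realization.leftDatum hα hGKM i) ((a ⊗ₜ[k] c : Env k V) • x) =
      r.const ((r.symDatum i).p a) • r.toZRight c •
        Double.fst (D := Realization.leftDatum hα hGKM i) x +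
      r.const ((r.symDatum i).p (a * (r.symDatum i).gen)) • r.toZRight c •
        Double.snd (D := Realization.leftDatum hα hGKM i) x := by
  have h : (Realization.leftDatum hα hGKM i).σ (r.toZRight c) = r.toZRight c :=
    Realization.σL_toZRight i c
  rw [ZObj.env_smul, Realization.envToZ_tmul]
  refine (congrArg (Double.fst (D := Realization.leftDatum hα hGKM i))
    (mul_smul (r.const a) (r.toZRight c) x)).trans ?_
  refine (Double.fst_smul (r.const a) (r.toZRight c • x)).trans ?_
  rw [Realization.leftDatum_p_const]
  refine congrArg₂ (· + ·) (congrArg _ (Double.fst_smul_of_fixed h x)) ?_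
  refine congrArg₂ (· • ·) ?_ (Double.snd_smul_of_fixed h x)
  rw [← Realization.leftDatum_p_const hα hGKM, map_mul]
  rfl

theorem ZObj.snd_env_smul_double (i : B) (P : ZObj r) (a c : Sym k V)
    (x : (P.double (Realization.leftDatum hα hGKM i)).carrier) :
    Double.snd (D := Realization.leftDatum hα hGKM i) ((a ⊗ₜ[k] c : Env k V) • x) =
      r.const ((r.symDatum i).q a) • r.toZRight c •
        Double.fst (D := Realization.leftDatum hα hGKM i) x +
      r.const ((r.symDatum i).q (a * (r.symDatum i).gen)) • r.toZRight c •
        Double.snd (D := Realization.leftDatum hα hGKM i) x := by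
  have h : (Realization.leftDatum hα hGKM i).σ (r.toZRight c) = r.toZRight c :=
    Realization.σL_toZRight i c
  rw [ZObj.env_smul, Realization.envToZ_tmul]
  refine (congrArg (Double.snd (D := Realization.leftDatum hα hGKM i))
    (mul_smul (r.const a) (r.toZRight c) x)).trans ?_
  refine (Double.snd_smul (r.const a) (r.toZRight c • x)).trans ?_
  rw [Realization.leftDatum_q_const]
  refine congrArg₂ (· + ·) (congrArg _ (Double.fst_smul_of_fixed h x)) ?_
  refine congrArg₂ (· • ·) ?_ (Double.snd_smul_of_fixed h x)
  rw [← Realization.leftDatum_q_const hα hGKM, map_mul]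
  rfl

/-- The map `R ⊗_{R^s} R ⊗_R P → Z ⊗ P`. -/
def ZObj.tensorBsHom (i : B) (P : ZObj r) : BiTensor k V (r.BsCarrier i) P.carrier →ₗ[Env k V]
    (P.double (Realization.leftDatum hα hGKM i)).carrier :=
  BiTensor.lift
    (AddMonoidHom.mk' (fun b => AddMonoidHom.mk' (fun n =>
      (Double.mk (r.const (r.BsFst i b) • n) (r.const (r.BsSnd i b) • n) :
        Double (Realization.leftDatum hα hGKM i) P.carrier)) fun n n' =>
          Double.ext (D := Realization.leftDatum hα hGKM i) (smul_add _ n n') (smul_add _ n n'))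
      fun b b' => AddMonoidHom.ext fun n => Double.ext (D := Realization.leftDatum hα hGKM i)
        (((congrArg (r.const · • n) (map_add (r.BsFst i) b b')).trans
          (congrArg (· • n) (map_add r.const _ _))).trans (add_smul _ _ n))
        (((congrArg (r.const · • n) (map_add (r.BsSnd i) b b')).trans
          (congrArg (· • n) (map_add r.const _ _))).trans (add_smul _ _ n)))
    (fun a b n => by
      refine Double.ext (D := Realization.leftDatum hα hGKM i) ?_ ?_
      · change r.const (r.BsFst i (_ • b)) • n = r.const (r.BsFst i b) • (_ • n)
        rw [Realization.BsFst_right_smul, mul_comm, map_mul, mul_smul, P.left_smul]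
      · change r.const (r.BsSnd i (_ • b)) • n = r.const (r.BsSnd i b) • (_ • n)
        rw [Realization.BsSnd_right_smul, mul_comm, map_mul, mul_smul, P.left_smul])
    (fun a c b n => by
      refine Double.ext (D := Realization.leftDatum hα hGKM i) ?_ ?_
      · refine Eq.trans ?_ (ZObj.fst_env_smul_double hα hGKM i P a c _).symm
        change r.const (r.BsFst i ((a ⊗ₜ[k] (1 : Sym k V) : Env k V) • b)) •
          (((1 : Sym k V) ⊗ₜ[k] c : Env k V) • n) =
          r.const ((r.symDatum i).p a) • r.toZRight c • r.const (r.BsFst i b) • n +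
          r.const ((r.symDatum i).p (a * (r.symDatum i).gen)) • r.toZRight c •
            r.const (r.BsSnd i b) • n
        rw [Realization.BsFst_smul, mul_one, P.right_smul, map_add, map_mul, map_mul]
        module
      · refine Eq.trans ?_ (ZObj.snd_env_smul_double hα hGKM i P a c _).symm
        change r.const (r.BsSnd i ((a ⊗ₜ[k] (1 : Sym k V) : Env k V) • b)) •
          (((1 : Sym k V) ⊗ₜ[k] c : Env k V) • n) =
          r.const ((r.symDatum i).q a) • r.toZRight c • r.const (r.BsFst i b) • n +
          r.const ((r.symDatum i).q (a * (r.symDatum i).gen)) • r.toZRight c •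
            r.const (r.BsSnd i b) • n
        rw [Realization.BsSnd_smul, mul_one, P.right_smul, map_add, map_mul, map_mul]
        module)

/-- The map `Z ⊗ P → R ⊗_{R^s} R ⊗_R P`. -/
def ZObj.tensorBsInv (i : B) (P : ZObj r) :
    Double (Realization.leftDatum hα hGKM i) P.carrier →+
      BiTensor k V (r.BsCarrier i) P.carrier :=
  (biTmulHom (1 : r.BsCarrier i)).comp Double.fst +
    (biTmulHom (r.BsInl i (r.symDatum i).gen)).comp Double.snd

theorem ZObj.tensorBsInv_tensorBsHom (i : B) (P : ZObj r)
    (x : BiTensor k V (r.BsCarrier i) P.carrier) :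
    ZObj.tensorBsInv hα hGKM i P (ZObj.tensorBsHom hα hGKM i P x) = x := by
  refine BiTensor.induction (P := fun x => ZObj.tensorBsInv hα hGKM i P
    (ZObj.tensorBsHom hα hGKM i P x) = x) ?_ (fun b n => ?_) (fun x y hx hy => ?_) x
  · exact (congrArg _ (map_zero (ZObj.tensorBsHom hα hGKM i P))).trans
      (map_zero (ZObj.tensorBsInv hα hGKM i P))
  · change (biTmul (1 : r.BsCarrier i) (r.const (r.BsFst i b) • n) +
      biTmul (r.BsInl i (r.symDatum i).gen) (r.const (r.BsSnd i b) • n) :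
        BiTensor k V (r.BsCarrier i) P.carrier) = biTmul b n
    rw [← P.left_smul, ← P.left_smul, ← biTmul_balanced, ← biTmul_balanced, ← add_biTmul,
      ← Realization.Bs_eq]
  · exact ((congrArg _ (map_add (ZObj.tensorBsHom hα hGKM i P) x y)).trans
      (map_add (ZObj.tensorBsInv hα hGKM i P) _ _)).trans (congrArg₂ (· + ·) hx hy)

theorem Realization.BsFst_one (i : B) : r.BsFst i 1 = 1 := by
  have h : (r.symDatum i).σ 1 = 1 := map_one _
  refine (Realization.BsFst_tmul i 1 1).trans ?_
  rw [(r.symDatum i).p_fixed h, one_mul]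

theorem Realization.BsSnd_one (i : B) : r.BsSnd i 1 = 0 := by
  have h : (r.symDatum i).σ 1 = 1 := map_one _
  refine (Realization.BsSnd_tmul i 1 1).trans ?_
  rw [(r.symDatum i).q_fixed h, zero_mul]

theorem Realization.BsFst_gen (i : B) : r.BsFst i (r.BsInl i (r.symDatum i).gen) = 0 := by
  refine (Realization.BsFst_tmul i (r.symDatum i).gen 1).trans ?_
  rw [(r.symDatum i).p_gen, zero_mul]

theorem Realization.BsSnd_gen (i : B) : r.BsSnd i (r.BsInl i (r.symDatum i).gen) = 1 := by
  refine (Realization.BsSnd_tmul i (r.symDatum i).gen 1).trans ?_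
  rw [(r.symDatum i).q_gen, one_mul]

theorem ZObj.tensorBsHom_tensorBsInv (i : B) (P : ZObj r)
    (x : Double (Realization.leftDatum hα hGKM i) P.carrier) :
    ZObj.tensorBsHom hα hGKM i P (ZObj.tensorBsInv hα hGKM i P x) = x := by
  refine (map_add (ZObj.tensorBsHom hα hGKM i P) (biTmul (1 : r.BsCarrier i) (Double.fst x))
    (biTmul (r.BsInl i (r.symDatum i).gen) (Double.snd x))).trans ?_
  refine Double.ext (D := Realization.leftDatum hα hGKM i) ?_ ?_
  · change r.const (r.BsFst i 1) • Double.fst x +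
      r.const (r.BsFst i (r.BsInl i (r.symDatum i).gen)) • Double.snd x = _
    rw [Realization.BsFst_one, Realization.BsFst_gen, map_one, map_zero, one_smul, zero_smul,
      add_zero]
  · change r.const (r.BsSnd i 1) • Double.fst x +
      r.const (r.BsSnd i (r.BsInl i (r.symDatum i).gen)) • Double.snd x = _
    rw [Realization.BsSnd_one, Realization.BsSnd_gen, map_one, map_zero, one_smul, zero_smul,
      zero_add]

/-- `R ⊗_{R^s} R ⊗_R P ≃ Z ⊗ P`. -/
def ZObj.tensorBsEquiv (i : B) (P : ZObj r) : BiTensor k V (r.BsCarrier i) P.carrier ≃ₗ[Env k V]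
    (P.double (Realization.leftDatum hα hGKM i)).carrier :=
  { ZObj.tensorBsHom hα hGKM i P with
    invFun := ZObj.tensorBsInv hα hGKM i P
    left_inv := ZObj.tensorBsInv_tensorBsHom hα hGKM i P
    right_inv := ZObj.tensorBsHom_tensorBsInv hα hGKM i P }

/-! ### Compatibility with the gradings and the decompositions -/

theorem ZObj.tensorBsHom_gr (i : B) {P : ZObj r} (hP : IsZModF P) {a b : ℤ} {m : r.BsCarrier i}
    (hm : m ∈ (r.Bs i).gr a) {n : P.carrier} (hn : n ∈ P.gr b) :
    ZObj.tensorBsHom hα hGKM i P (biTmul m n) ∈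
      ((P.double (Realization.leftDatum hα hGKM i)).shift 1).gr (a + b) := by
  -- The summand 1 comes from the shift in `B_s`, and the 2 from the degree of `δ`.
  have key : r.BsFst i m ∈ symDeg k V (1 + a) ∧ r.BsSnd i m ∈ symDeg k V (1 + a - 2) := by
    refine (AddSubgroup.closure_le (K := (symDeg k V (1 + a)).toAddSubgroup.comap (r.BsFst i) ⊓
      (symDeg k V (1 + a - 2)).toAddSubgroup.comap (r.BsSnd i))).mpr ?_ hm
    rintro _ ⟨c, d, hcd, f, hf, g, hg, rfl⟩
    refine ⟨?_, ?_⟩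
    · have h := SetLike.mul_mem_graded (A := symDeg k V) (Realization.symDatum_p_mem (r := r) i hf) hg
      rw [hcd] at h
      exact h
    · have h := SetLike.mul_mem_graded (A := symDeg k V) (Realization.symDatum_q_mem (r := r) i hf) hg
      rw [show c - 2 + d = 1 + a - 2 by linarith] at h
      exact h
  refine ⟨?_, ?_⟩
  · have h := hP.smul_mem _ _ (r.const (r.BsFst i m)) (fun _ => key.1) n hn
    rw [add_assoc] at h
    exact h
  · have h := hP.smul_mem _ _ (r.const (r.BsSnd i m)) (fun _ => key.2) n hn
    rw [show 1 + a - 2 + b = 1 + (a + b) - 2 by ring] at h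
    exact h

theorem ZObj.tensorBsInv_gr (i : B) {P : ZObj r} (d : ℤ)
    (x : Double (Realization.leftDatum hα hGKM i) P.carrier)
    (hx : x ∈ ((P.double (Realization.leftDatum hα hGKM i)).shift 1).gr d) :
    ZObj.tensorBsInv hα hGKM i P x ∈ ((r.Bs i).tensor ((functorF r).obj P)).gr d := by
  have h0 : (1 : r.BsCarrier i) ∈ (r.Bs i).gr (-1) := AddSubgroup.subset_closure
    ⟨0, 0, by ring, 1, SetLike.one_mem_graded (symDeg k V), 1,
      SetLike.one_mem_graded (symDeg k V), rfl⟩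
  have h1 : r.BsInl i (r.symDatum i).gen ∈ (r.Bs i).gr 1 := AddSubgroup.subset_closure
    ⟨2, 0, by ring, _, ι_mem_symDeg _, 1, SetLike.one_mem_graded (symDeg k V), rfl⟩
  exact (((r.Bs i).tensor ((functorF r).obj P)).gr d).add_mem
    (AddSubgroup.subset_closure ⟨-1, 1 + d, by ring, _, h0, _, hx.1, rfl⟩)
    (AddSubgroup.subset_closure ⟨1, 1 + d - 2, by ring, _, h1, _, hx.2, rfl⟩)

end TensorBs

end MomentGraph

end

noncomputable section

namespace MomentGraph

/-! ### `B_s ⊗ -` and the left extension: decompositions -/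

section TensorBsIso

variable {k V : Type u} [CommRing k] [AddCommGroup V] [Module k V] {W : Type u} [Group W]
  {B : Type v} {C : CoxeterMatrix B} {cs : CoxeterSystem C W} {r : Realization k cs V}
  [IsDomain k] [Module.Free k V]
  (hα : ∀ i, Function.Surjective fun f : Module.Dual k V => f (r.α i)) (hGKM : r.GKM)

theorem RightTorsionFree.toLocQ_eq_zero {M : Type u} [AddCommGroup M] [Module (Env k V) M]
    (hM : RightTorsionFree k V M) {m : M} (h : toLocQ (k := k) (V := V) M m = 0) : m = 0 := by
  obtain ⟨g, hg, h⟩ := MomentGraph.toLocQ_eq_zero.mp h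
  exact hM g hg m h

omit [IsDomain k] [Module.Free k V] in
theorem Realization.apply_mul_of_fixed (i : B) {a : W} (ha : a = 1 ∨ a = cs.simple i) {y : r.Z}
    (hy : r.σL i y = y) (b : W) :
    (y : W → Sym k V) (a * b) = r.act a ((y : W → Sym k V) b) := by
  rcases ha with rfl | rfl
  · rw [one_mul, r.act_one]
  · conv_lhs => rw [← hy]
    rw [Realization.σL_apply, cs.simple_mul_simple_cancel_left]

/-- A left-invariant `y` acts on `n` by `y_b`. Moved across the tensor sign this is right
multiplication of `m` by `y_b`, hence left multiplication by `a(y_b) = y_{ab}`. -/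
theorem ZObj.fixed_smul_tensorBsHom (i : B) {P : ZObj r} {a b : W}
    (ha : a = 1 ∨ a = cs.simple i) {m : r.BsCarrier i}
    (hm : ∀ f, ((1 : Sym k V) ⊗ₜ[k] f : Env k V) • m = (r.act a f ⊗ₜ[k] (1 : Sym k V) : Env k V) • m)
    {n : P.carrier} (hn : ∀ z : r.Z, z • n = r.const ((z : W → Sym k V) b) • n) {y : r.Z}
    (hy : r.σL i y = y) : y • ZObj.tensorBsHom hα hGKM i P (biTmul m n) =
      r.const ((y : W → Sym k V) (a * b)) • ZObj.tensorBsHom hα hGKM i P (biTmul m n) := by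
  rw [Realization.apply_mul_of_fixed i ha hy, ← ZObj.left_smul,
    ← map_smul (ZObj.tensorBsHom hα hGKM i P), smul_biTmul, ← hm]
  refine Double.ext (D := Realization.leftDatum hα hGKM i) ?_ ?_
  · refine (Double.fst_smul_of_fixed hy _).trans ?_
    change y • r.const (r.BsFst i m) • n = r.const (r.BsFst i (_ • m)) • ((1 : Env k V) • n)
    rw [Realization.BsFst_right_smul, smul_comm, hn, one_smul, mul_comm, map_mul, mul_smul]
  · refine (Double.snd_smul_of_fixed hy _).trans ?_
    change y • r.const (r.BsSnd i m) • n = r.const (r.BsSnd i (_ • m)) • ((1 : Env k V) • n)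
    rw [Realization.BsSnd_right_smul, smul_comm, hn, one_smul, mul_comm, map_mul, mul_smul]

/-- The left-invariant case suffices, because `z = p z + q z · gen` and the left `gen` is a constant
family. For `a ∉ {e, s}` the component of `B_s` is zero. -/
theorem ZObj.tensorBsHom_comp (i : B) {P : ZObj r} (hP : RightTorsionFree k V P.carrier) (a b : W)
    (m : r.BsCarrier i) (n : P.carrier) (hm : toLocQ (r.BsCarrier i) m ∈ (r.Bs i).comp a)
    (hn : toLocQ P.carrier n ∈ P.comp b) :
    toLocQ _ (ZObj.tensorBsHom hα hGKM i P (biTmul m n)) ∈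
      (P.double (Realization.leftDatum hα hGKM i)).comp (a * b) := by
  by_cases ha : a = 1 ∨ a = cs.simple i
  · rw [Realization.toLocQ_mem_Bs_comp i ha] at hm
    rw [ZObj.toLocQ_mem_comp_iff hP] at hn
    refine ZObj.toLocQ_mem_comp _ _ _ fun z => ?_
    have h : ∀ y, r.σL i y = y → _ := fun y => ZObj.fixed_smul_tensorBsHom hα hGKM i ha hm hn
    have hz := (Realization.leftDatum hα hGKM i).p_add_q z
    conv_lhs => rw [← hz]
    rw [add_smul, mul_smul, smul_comm, h _ ((Realization.leftDatum hα hGKM i).σ_p z),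
      h _ ((Realization.leftDatum hα hGKM i).σ_q z), ← mul_smul, ← add_smul]
    congr 1
    conv_rhs => rw [← hz]
    rw [Realization.Z_add_apply, Realization.Z_mul_apply, map_add, map_mul, mul_comm]
    rfl
  · rw [Realization.Bs_comp_eq_bot i ha] at hm
    have hm0 : m = 0 := RightTorsionFree.toLocQ_eq_zero (k := k) (V := V)
      (fun g hg b hb => Realization.Bs_torsionFree i hg hb) ((Submodule.mem_bot _).mp hm)
    subst hm0
    have h0 : (biTmul (0 : r.BsCarrier i) n : BiTensor k V (r.BsCarrier i) P.carrier) = 0 :=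
      TensorProduct.zero_tmul (R := Sym k V) (RightMod (r.BsCarrier i)) (show LeftMod P.carrier from n)
    rw [h0, map_zero, map_zero]
    exact zero_mem _

/-- The two eigenvectors `δ ⊗ 1 - 1 ⊗ s(δ)` and `δ ⊗ 1 - 1 ⊗ δ` differ by `1 ⊗ α_s`. -/
theorem Realization.exists_Bs_eigen (i : B) (b : r.BsCarrier i) : ∃ x y : r.BsCarrier i,
    toLocQ (r.BsCarrier i) x ∈ (r.Bs i).comp 1 ∧
    toLocQ (r.BsCarrier i) y ∈ (r.Bs i).comp (cs.simple i) ∧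
    ((1 : Sym k V) ⊗ₜ[k] SymmetricAlgebra.ι k V (r.α i) : Env k V) • b = x - y := by
  have hl := Realization.BsInl_eq_BsInr (r := r) i
  refine ⟨(r.BsInl i (r.symDatum i).gen - r.BsInr i ((r.symDatum i).σ (r.symDatum i).gen)) * b,
    (r.BsInl i (r.symDatum i).gen - r.BsInr i (r.symDatum i).gen) * b, ?_, ?_, ?_⟩
  · rw [Realization.toLocQ_mem_Bs_comp i (Or.inl rfl)]
    intro f
    rw [r.act_one, Realization.right_smul_Bs, Realization.left_smul_Bs, ← mul_assoc, ← mul_assoc,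
      (r.symDatum i).mul_gen_sub hl]
  · rw [Realization.toLocQ_mem_Bs_comp i (Or.inr rfl)]
    intro f
    rw [Realization.right_smul_Bs, Realization.left_smul_Bs, ← mul_assoc, ← mul_assoc,
      (r.symDatum i).mul_gen_sub' hl]
    rfl
  · have h : SymmetricAlgebra.ι k V (r.α i) =
        (r.symDatum i).gen - (r.symDatum i).σ (r.symDatum i).gen := (r.symDatum i).gen_sub.symm
    rw [Realization.right_smul_Bs, h, map_sub]
    ring

-- After clearing denominators a tensor `m ⊗ n` is a sum of tensors whose two factors both lie in a
-- component. This spanning, with the independence on the other side, lets `comp_symm_mem` treat the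
-- inverse map.
include hGKM in
theorem ZObj.iSup_tensorBs_comp (i : B) {P : ZObj r} (hP : IsZModF P) :
    ⨆ w, ((r.Bs i).tensor ((functorF r).obj P)).comp w = ⊤ := by
  rw [eq_top_iff]
  rintro x -
  obtain ⟨I, hI⟩ := hP.factors
  obtain ⟨g, hg, hdec⟩ := P.exists_eigen_decomposition hGKM I hI
  let T : W → Submodule (EnvQ k V) (LocQ k V (BiTensor k V (r.BsCarrier i) P.carrier)) :=
    ((r.Bs i).tensor ((functorF r).obj P)).comp
  let S := ⨆ w, T w
  let ψ := toLocQ (k := k) (V := V) (BiTensor k V (r.BsCarrier i) P.carrier)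
  suffices key : ∀ x : LocQ k V (BiTensor k V (r.BsCarrier i) P.carrier), x ∈ S from key x
  clear x
  intro x
  have hgen : ∀ (a b : W) (m : r.BsCarrier i) (n : P.carrier),
      toLocQ (r.BsCarrier i) m ∈ (r.Bs i).comp a → toLocQ P.carrier n ∈ P.comp b →
      ψ (biTmul m n) ∈ S := fun a b m n hm hn =>
    Submodule.mem_iSup_of_mem (p := T) (a * b) (Submodule.subset_span (R := EnvQ k V)
      (M := LocQ k V (BiTensor k V (r.BsCarrier i) P.carrier)) ⟨a, b, rfl, m, n, hm, hn, rfl⟩)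
  have heig : ∀ (w : W) (m : r.BsCarrier i) (n : P.carrier),
      (∀ z : r.Z, z • n = r.const ((z : W → Sym k V) w) • n) → ψ (biTmul m n) ∈ S := by
    intro w m n hn
    have hne : r.act w⁻¹ (SymmetricAlgebra.ι k V (r.α i)) ≠ 0 :=
      fun h => Realization.ι_α_ne_zero i ((r.act_eq_zero_iff _).mp h)
    obtain ⟨y, y', hy, hy', e⟩ := Realization.exists_Bs_eigen i m
    have hn' := P.toLocQ_mem_comp w n hn
    -- On an eigenvector `n` for `w`, right multiplication by `w⁻¹(α_s)` is left multiplication by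
    -- `α_s`, which crosses over to the right of `m`.
    have e1 : ((1 : Sym k V) ⊗ₜ[k] r.act w⁻¹ (SymmetricAlgebra.ι k V (r.α i)) : Env k V) •
        (biTmul m n : BiTensor k V (r.BsCarrier i) P.carrier) = biTmul y n - biTmul y' n := by
      rw [smul_biTmul, P.right_smul, hn, Realization.toZRight_apply, r.act_act_inv, ← P.left_smul,
        ← biTmul_balanced, ← Algebra.TensorProduct.one_def, one_smul, e]
      exact TensorProduct.sub_tmul (R := Sym k V) (M := RightMod (r.BsCarrier i))
        (N := LeftMod P.carrier) y y' n
    rw [← smul_mem_iff_of_ne_zero S hne, ← map_smul, e1, map_sub, sub_eq_add_neg,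
      ← neg_one_smul (EnvQ k V)]
    exact add_mem (hgen _ _ _ _ hy hn') (Submodule.smul_mem _ _ (hgen _ _ _ _ hy' hn'))
  obtain ⟨h, hh, y, hy⟩ := exists_smul_eq_toLocQ (k := k) (V := V)
    (M := BiTensor k V (r.BsCarrier i) P.carrier) x
  rw [← smul_mem_iff_of_ne_zero S hh, hy]
  refine BiTensor.induction (P := fun y => ψ y ∈ S) ?_ (fun m n => ?_) (fun x y hx hy => ?_) y
  · rw [map_zero]
    exact zero_mem _
  · obtain ⟨n', hn', hsum⟩ := hdec n
    have e : ((1 : Sym k V) ⊗ₜ[k] g : Env k V) •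
        (biTmul m n : BiTensor k V (r.BsCarrier i) P.carrier) = ∑ x ∈ I, biTmul m (n' x) := by
      rw [smul_biTmul, P.right_smul, hsum, ← Algebra.TensorProduct.one_def, one_smul]
      exact map_sum (biTmulHom m) n' I
    rw [← smul_mem_iff_of_ne_zero S hg, ← map_smul, e, map_sum]
    exact Submodule.sum_mem _ fun x _ => heig x m _ (hn' x)
  · rw [map_add]
    exact add_mem hx hy

/-- Tensoring with `B_s` corresponds to the extension along the left multiplication. -/
def ZObj.tensorBsIso (i : B) {P : ZObj r} (hP : IsZModF P)
    (hP' : RightTorsionFree k V P.carrier) : (r.Bs i).tensor ((functorF r).obj P) ≅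
      (functorF r).obj ((P.double (Realization.leftDatum hα hGKM i)).shift 1) :=
  let e := ZObj.tensorBsEquiv hα hGKM i P
  have hc := BimodObj.tensor_comp_le (r.Bs i) ((functorF r).obj P)
    ((functorF r).obj ((P.double (Realization.leftDatum hα hGKM i)).shift 1))
    (ZObj.tensorBsHom hα hGKM i P) (ZObj.tensorBsHom_comp hα hGKM i hP')
  BimodObj.isoMk (M := (r.Bs i).tensor ((functorF r).obj P))
    (N := (functorF r).obj ((P.double (Realization.leftDatum hα hGKM i)).shift 1)) e
    (BimodObj.tensor_gr_le (r.Bs i) ((functorF r).obj P)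
      ((functorF r).obj ((P.double (Realization.leftDatum hα hGKM i)).shift 1))
      (ZObj.tensorBsHom hα hGKM i P)
      fun _ _ _ hm _ hn => ZObj.tensorBsHom_gr hα hGKM i hP hm hn)
    (fun d x hx => ZObj.tensorBsInv_gr hα hGKM i d x hx) hc
    fun w _ hx => comp_symm_mem (M := (r.Bs i).tensor ((functorF r).obj P))
      (N := (functorF r).obj ((P.double (Realization.leftDatum hα hGKM i)).shift 1)) e hc
      (ZObj.iSup_tensorBs_comp hGKM i hP)
      (ZObj.comp_indep hGKM ((P.double (Realization.leftDatum hα hGKM i)).shift 1)) w hx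

end TensorBsIso

end MomentGraph

end

noncomputable section

namespace MomentGraph

/-! ## Bott–Samelson objects correspond under `F` -/

section BottSamelsonIso

variable {k V : Type u} [CommRing k] [AddCommGroup V] [Module k V]

/-- Bimodules that are finitely generated and flat as right modules. -/
structure IsRightFlat (k V : Type u) [CommRing k] [AddCommGroup V] [Module k V] (M : Type u)
    [AddCommGroup M] [Module (Env k V) M] : Prop where
  finite : Module.Finite (Sym k V) (RightMod M)
  flat : Module.Flat (Sym k V) (RightMod M)

section RightMod

variable {M N : Type u} [AddCommGroup M] [Module (Env k V) M] [AddCommGroup N] [Module (Env k V) N]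

/-- A bimodule map as a map of right modules. -/
def RightMod.map (f : M →ₗ[Env k V] N) : RightMod M →ₗ[Sym k V] RightMod N where
  toFun := f
  map_add' := map_add f
  map_smul' a m := map_smul f ((1 : Sym k V) ⊗ₜ[k] a : Env k V) (show M from m)

theorem IsRightFlat.of_retract (hN : IsRightFlat k V N) (i : M →ₗ[Env k V] N)
    (p : N →ₗ[Env k V] M) (h : ∀ m, p (i m) = m) : IsRightFlat k V M where
  finite := by
    have := hN.finite
    exact Module.Finite.of_surjective (RightMod.map p) fun m => ⟨i m, h m⟩
  flat := by
    have := hN.flat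
    exact Module.Flat.of_retract (RightMod.map i) (RightMod.map p) (LinearMap.ext h)

theorem IsRightFlat.env_finite (hM : IsRightFlat k V M) : Module.Finite (Env k V) M := by
  obtain ⟨s, hs⟩ := hM.finite.fg_top
  let t : Finset M := s
  refine ⟨⟨t, ?_⟩⟩
  rw [eq_top_iff]
  rintro x -
  have hx : (show RightMod M from x) ∈ Submodule.span (Sym k V) (s : Set (RightMod M)) :=
    hs ▸ Submodule.mem_top
  refine Submodule.span_induction (p := fun (x : RightMod M) _ =>
    (show M from x) ∈ Submodule.span (Env k V) (t : Set M)) ?_ ?_ ?_ ?_ hx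
  · exact fun x hx => Submodule.subset_span hx
  · exact zero_mem (Submodule.span (Env k V) (t : Set M))
  · exact fun x y _ _ hx hy => add_mem (S := Submodule (Env k V) M) hx hy
  · exact fun a x _ hx => Submodule.smul_mem (Submodule.span (Env k V) (t : Set M)) _ hx

theorem rightTorsionFree_of_flat [IsDomain k] [Module.Free k V]
    (h : Module.Flat (Sym k V) (RightMod M)) : RightTorsionFree k V M := fun g hg _ hm =>
  Module.Flat.isSMulRegular_of_nonZeroDivisors (M := RightMod M)
    (mem_nonZeroDivisors_of_ne_zero hg) (hm.trans (smul_zero (A := RightMod M) g).symm)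

theorem IsRightFlat.pi {n : ℕ} {M : Fin n → Type u} [∀ i, AddCommGroup (M i)]
    [∀ i, Module (Env k V) (M i)] (h : ∀ i, IsRightFlat k V (M i)) :
    IsRightFlat k V (∀ i, M i) := by
  have h1 := fun i => (h i).finite
  have h2 := fun i => (h i).flat
  let e : RightMod (∀ i, M i) ≃ₗ[Sym k V] ∀ i, RightMod (M i) :=
    { AddEquiv.refl (∀ i, M i) with map_smul' := fun _ _ => rfl }
  let e' := (DirectSum.linearEquivFunOnFintype (Sym k V) (Fin n) fun i => RightMod (M i))
  exact ⟨Module.Finite.equiv e.symm, Module.Flat.of_linearEquiv (e.trans e'.symm)⟩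

end RightMod

variable {W : Type u} [Group W]
  {B : Type v} {C : CoxeterMatrix B} {cs : CoxeterSystem C W} {r : Realization k cs V}

theorem isRightFlat_zUnit : IsRightFlat k V (zUnit r).carrier := by
  let e : RightMod (zUnit r).carrier ≃ₗ[Sym k V] Sym k V :=
    { AddEquiv.refl (Sym k V) with
      map_smul' := fun a m => by
        have h := (zUnit r).right_smul a m
        refine h.trans ?_
        change r.act 1 a * (show Sym k V from m) = a * (show Sym k V from m)
        rw [r.act_one] }
  exact ⟨Module.Finite.equiv e.symm, Module.Flat.of_linearEquiv e⟩

variable [IsDomain k] [Module.Free k V]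

-- As `σ` fixes the families `(w(f))_w`, the right `R`-action is coordinatewise and the extension is
-- two copies of `M` as a right module.
omit [IsDomain k] [Module.Free k V] in
theorem IsRightFlat.double {D : DemazureDatum r.Z}
    (hD : ∀ f, D.σ (r.toZRight f) = r.toZRight f) {M : ZObj r} (hM : IsRightFlat k V M.carrier) :
    IsRightFlat k V (M.double D).carrier := by
  have h1 := hM.finite
  have h2 := hM.flat
  let e : RightMod (M.double D).carrier ≃ₗ[Sym k V] RightMod M.carrier × RightMod M.carrier :=
    { toFun := fun x => (Double.fst (D := D) x, Double.snd (D := D) x)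
      invFun := fun x => Double.mk (D := D) x.1 x.2
      left_inv := fun _ => rfl
      right_inv := fun _ => rfl
      map_add' := fun _ _ => rfl
      map_smul' := fun a x => by
        have h := (M.double D).right_smul a x
        refine Prod.ext ?_ ?_
        · refine ((congrArg (Double.fst (D := D)) h).trans
            (Double.fst_smul_of_fixed (hD a) _)).trans ?_
          exact (M.right_smul a _).symm
        · refine ((congrArg (Double.snd (D := D)) h).trans
            (Double.snd_smul_of_fixed (hD a) _)).trans ?_
          exact (M.right_smul a _).symm }
  let e' := (LinearEquiv.finTwoArrow (Sym k V) (RightMod M.carrier)).symm.trans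
    (DirectSum.linearEquivFunOnFintype (Sym k V) (Fin 2) fun _ => RightMod M.carrier).symm
  exact ⟨Module.Finite.equiv e.symm, Module.Flat.of_linearEquiv (e.trans e')⟩

variable (hα : ∀ i, Function.Surjective fun f : Module.Dual k V => f (r.α i)) (hGKM : r.GKM)

theorem Realization.isRightFlat_LBS (x : List B) :
    IsRightFlat k V (Realization.LBS hα hGKM x).carrier := by
  induction x with
  | nil => exact isRightFlat_zUnit
  | cons i x ih =>
    exact IsRightFlat.double (D := Realization.leftDatum hα hGKM i)
      (M := Realization.LBS hα hGKM x) (fun f => Realization.σL_toZRight i f) ih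

omit [IsDomain k] [Module.Free k V] in
theorem envToZ_one (a : Env k V) : (r.envToZ a : W → Sym k V) 1 =
    Algebra.TensorProduct.lmul' k (S := Sym k V) a := by
  induction a using TensorProduct.induction_on with
  | zero => rw [map_zero, map_zero]; rfl
  | add a b ha hb => rw [map_add, map_add, Realization.Z_add_apply, ha, hb]
  | tmul f g => rw [r.envToZ_apply, r.act_one, Algebra.TensorProduct.lmul'_apply_tmul]

include hGKM in
/-- `F` preserves the unit objects. -/
theorem unitObj_iso : Nonempty (unitObj k V W ≅ (functorF r).obj (zUnit r)) := by
  let e : (unitObj k V W).carrier ≃ₗ[Env k V] ((functorF r).obj (zUnit r)).carrier :=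
    { AddEquiv.refl (Sym k V) with
      map_smul' := fun a m =>
        congrArg (fun x : Sym k V => x * (show Sym k V from m)) (envToZ_one (r := r) a).symm }
  have hc : ∀ w, ∀ x ∈ (unitObj k V W).comp w,
      locQMap e.toLinearMap x ∈ ((functorF r).obj (zUnit r)).comp w := by
    intro w x hx
    by_cases hw : w = 1
    · subst hw
      exact ZObj.mem_comp_one_zUnit _
    · have h0 : (unitObj k V W).comp w = ⊥ := iSup_neg hw
      rw [h0, Submodule.mem_bot] at hx
      rw [hx, map_zero]
      exact zero_mem _
  refine ⟨BimodObj.isoMk e (fun d m hm => hm) (fun d m hm => hm) hc fun w x hx =>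
    comp_symm_mem e hc ?_ (ZObj.comp_indep hGKM (zUnit r)) w hx⟩
  have h1 : (unitObj k V W).comp 1 = ⊤ := iSup_pos rfl
  exact eq_top_iff.mpr (h1 ▸ le_iSup (unitObj k V W).comp 1)

/-- Shifts commute with `ZObj.double`. -/
def ZObj.doubleShiftIso (D : DemazureDatum r.Z) (P : ZObj r) (l : ℤ) :
    ((P.shift l).double D).shift 1 ≅ (P.double D).shift (l + 1) :=
  have h : ∀ (d : ℤ) (x : Double D P.carrier), x ∈ (((P.shift l).double D).shift 1).gr d ↔
      x ∈ ((P.double D).shift (l + 1)).gr d := fun d x => by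
    change (_ ∈ P.gr (l + (1 + d)) ∧ _ ∈ P.gr (l + (1 + d - 2))) ↔
      (_ ∈ P.gr (l + 1 + d) ∧ _ ∈ P.gr (l + 1 + d - 2))
    rw [← add_assoc, ← add_sub_assoc, ← add_assoc]
    rfl
  ZObj.isoMk (M := ((P.shift l).double D).shift 1) (N := (P.double D).shift (l + 1))
    (LinearEquiv.refl r.Z (Double D P.carrier)) (fun d x hx => (h d x).mp hx)
    (fun d x hx => (h d x).mpr hx)

/-- Each factor `B_s` carries a shift by 1, whereas `Realization.LBS` carries none; hence the shift
by the length. -/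
theorem Realization.foldr_tensor_iso (x : List B) :
    Nonempty (x.foldr (fun i N => (r.Bs i).tensor N) (unitObj k V W) ≅
      (functorF r).obj ((Realization.LBS hα hGKM x).shift x.length)) := by
  induction x with
  | nil =>
    obtain ⟨e⟩ := unitObj_iso hGKM
    refine ⟨e ≪≫ (functorF r).mapIso (ZObj.isoMk (M := zUnit r) (N := (zUnit r).shift 0)
      (LinearEquiv.refl r.Z _) (fun d m hm => ?_) (fun d m hm => ?_))⟩
    · change m ∈ (zUnit r).gr (0 + d)
      rw [zero_add]
      exact hm
    · change m ∈ (zUnit r).gr (0 + d) at hm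
      rw [zero_add] at hm
      exact hm
  | cons i x ih =>
    obtain ⟨e⟩ := ih
    have hM := (Realization.isZModF_LBS hα hGKM x).shift x.length
    have hF : RightTorsionFree k V ((Realization.LBS hα hGKM x).shift x.length).carrier :=
      rightTorsionFree_of_flat (Realization.isRightFlat_LBS hα hGKM x).flat
    refine ⟨(r.Bs i).tensorIso e ≪≫ ZObj.tensorBsIso hα hGKM i hM hF ≪≫
      (functorF r).mapIso (ZObj.doubleShiftIso _ _ _ ≪≫ eqToIso ?_)⟩
    rw [List.length_cons]
    push_cast
    rfl

end BottSamelsonIso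

end MomentGraph

end

noncomputable section

namespace MomentGraph

/-! ## Direct sums and direct summands -/

section Summand

variable {k : Type u} [CommRing k] {W : Type u} [Group W] {B : Type v} {C : CoxeterMatrix B}
  {cs : CoxeterSystem C W} {V : Type u} [AddCommGroup V] [Module k V] {r : Realization k cs V}

namespace ZObj

variable {n : ℕ} {M : Fin n → ZObj r} {N : ZObj r}

variable (M) in
/-- The projections of a direct sum. -/
def proj (i : Fin n) : directSum M ⟶ M i where
  toLin := (LinearMap.proj i : (∀ i, (M i).carrier) →ₗ[r.Z] (M i).carrier)
  map_gr _ _ hm := mem_directSum_gr.mp hm i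

/-- Maps into a direct sum. -/
def lift (f : ∀ i, N ⟶ M i) : N ⟶ directSum M where
  toLin := (LinearMap.pi fun i => ZHom.toLin (f i) : N.carrier →ₗ[r.Z] (∀ i, (M i).carrier))
  map_gr d m hm := mem_directSum_gr.mpr fun i => ZHom.map_gr (f i) d m hm

/-- Maps out of a direct sum. -/
def desc (f : ∀ i, M i ⟶ N) : directSum M ⟶ N where
  toLin := (∑ i, ZHom.toLin (f i) ∘ₗ
    (LinearMap.proj i : (∀ i, (M i).carrier) →ₗ[r.Z] (M i).carrier))
  map_gr d m hm := by
    have h : ∑ i, ZHom.toLin (f i) ((m : ∀ i, (M i).carrier) i) ∈ N.gr d :=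
      sum_mem fun i _ => ZHom.map_gr (f i) d _ (mem_directSum_gr.mp hm i)
    exact (LinearMap.sum_apply Finset.univ (fun i => ZHom.toLin (f i) ∘ₗ
      (LinearMap.proj i : (∀ i, (M i).carrier) →ₗ[r.Z] (M i).carrier)) m).symm ▸ h

theorem desc_apply (f : ∀ i, M i ⟶ N) (m : ∀ i, (M i).carrier) :
    ZHom.toLin (desc f) m = ∑ i, ZHom.toLin (f i) (m i) :=
  LinearMap.sum_apply Finset.univ (fun i => ZHom.toLin (f i) ∘ₗ
      (LinearMap.proj i : (∀ i, (M i).carrier) →ₗ[r.Z] (M i).carrier)) m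

variable (M) in
/-- The inclusions of the summands of a direct sum. -/
def inj (i : Fin n) : M i ⟶ directSum M where
  toLin := (LinearMap.single r.Z (fun i => (M i).carrier) i :
    (M i).carrier →ₗ[r.Z] (∀ i, (M i).carrier))
  map_gr d m hm := mem_directSum_gr.mpr fun j => by
    change (Pi.single i m : ∀ i, (M i).carrier) j ∈ _
    by_cases hij : j = i
    · subst hij
      exact (Pi.single_eq_same (M := fun i => (M i).carrier) j m).symm ▸ hm
    · exact (Pi.single_eq_of_ne (M := fun i => (M i).carrier) hij m).symm ▸ ((M j).gr d).zero_mem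

theorem sum_inj (m : ∀ i, (M i).carrier) :
    (∑ i, (show ∀ i, (M i).carrier from ZHom.toLin (inj M i) (m i))) = m :=
  Finset.univ_sum_single m

/-- Direct sums of isomorphisms. -/
def directSumIso {N : Fin n → ZObj r} (e : ∀ i, M i ≅ N i) : directSum M ≅ directSum N where
  hom := lift fun i => proj M i ≫ (e i).hom
  inv := lift fun i => proj N i ≫ (e i).inv
  hom_inv_id := ZHom.ext (LinearMap.ext fun m => funext fun i =>
    ZHom.hom_inv_apply (e i) ((m : ∀ i, (M i).carrier) i))
  inv_hom_id := ZHom.ext (LinearMap.ext fun m => funext fun i =>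
    ZHom.inv_hom_apply (e i) ((m : ∀ i, (N i).carrier) i))

/-- Shifts of isomorphisms. -/
def shiftIso {M N : ZObj r} (e : M ≅ N) (n : ℤ) : M.shift n ≅ N.shift n where
  hom := ZHom.mk (M := M.shift n) (N := N.shift n) (ZHom.toLin (M := M) (N := N) e.hom)
    (fun d => ZHom.map_gr (M := M) (N := N) e.hom (n + d))
  inv := ZHom.mk (M := N.shift n) (N := M.shift n) (ZHom.toLin (M := N) (N := M) e.inv)
    (fun d => ZHom.map_gr (M := N) (N := M) e.inv (n + d))
  hom_inv_id := ZHom.ext (LinearMap.ext (ZHom.hom_inv_apply e))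
  inv_hom_id := ZHom.ext (LinearMap.ext (ZHom.inv_hom_apply e))

/-- Being a direct summand in terms of maps. -/
theorem isSummand_iff {M N : ZObj r} : M.IsSummand N ↔
    ∃ (M' : ZObj r) (i : M ⟶ N) (p : N ⟶ M) (i' : M' ⟶ N) (p' : N ⟶ M'),
      (∀ m, ZHom.toLin p (ZHom.toLin i m) = m) ∧ (∀ m, ZHom.toLin p' (ZHom.toLin i' m) = m) ∧
      ∀ n, ZHom.toLin i (ZHom.toLin p n) + ZHom.toLin i' (ZHom.toLin p' n) = n := by
  constructor
  · rintro ⟨M', ⟨e⟩⟩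
    refine ⟨M', inj ![M, M'] 0 ≫ e.hom, e.inv ≫ proj ![M, M'] 0, inj ![M, M'] 1 ≫ e.hom,
      e.inv ≫ proj ![M, M'] 1, fun m => ?_, fun m => ?_, fun n => ?_⟩
    · refine (congrArg (ZHom.toLin (proj ![M, M'] 0)) (ZHom.hom_inv_apply e _)).trans ?_
      exact Pi.single_eq_same (M := fun i => (![M, M'] i).carrier) 0 m
    · refine (congrArg (ZHom.toLin (proj ![M, M'] 1)) (ZHom.hom_inv_apply e _)).trans ?_
      exact Pi.single_eq_same (M := fun i => (![M, M'] i).carrier) 1 m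
    · have h := sum_inj (M := ![M, M']) (ZHom.toLin e.inv n)
      rw [Fin.sum_univ_two] at h
      refine (map_add (ZHom.toLin e.hom) _ _).symm.trans ?_
      exact (congrArg (ZHom.toLin e.hom) h).trans (ZHom.inv_hom_apply e n)
  · rintro ⟨M', i, p, i', p', h1, h2, h3⟩
    -- Applying `p'` to `i p + i' p' = 1` on the image of `i` gives `p' i = p' i + p' i`.
    have h4 : ∀ m, ZHom.toLin p' (ZHom.toLin i m) = 0 := fun m => by
      have h := congrArg (ZHom.toLin p') (h3 (ZHom.toLin i m))
      rw [map_add, h2, h1] at h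
      exact left_eq_add.mp (by rwa [eq_comm, add_comm])
    have h5 : ∀ m, ZHom.toLin p (ZHom.toLin i' m) = 0 := fun m => by
      have h := congrArg (ZHom.toLin p) (h3 (ZHom.toLin i' m))
      rw [map_add, h2, h1] at h
      exact left_eq_add.mp h.symm
    let f : ∀ j, ![M, M'] j ⟶ N := fun j => match j with
      | 0 => i
      | 1 => i'
    let g : ∀ j, N ⟶ ![M, M'] j := fun j => match j with
      | 0 => p
      | 1 => p'
    have hd : ∀ m, ZHom.toLin (desc f) m = ZHom.toLin i (m 0) + ZHom.toLin i' (m 1) := fun m =>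
      (desc_apply f m).trans (Fin.sum_univ_two _)
    refine ⟨M', ⟨⟨desc f, lift g, ZHom.ext (LinearMap.ext fun m => ?_),
      ZHom.ext (LinearMap.ext fun n => ?_)⟩⟩⟩
    · refine (congrArg (ZHom.toLin (lift g)) (hd m)).trans (funext fun j => ?_)
      match j with
      | 0 =>
        refine (map_add (ZHom.toLin p) _ _).trans ?_
        exact (congrArg₂ (· + ·) (h1 _) (h5 _)).trans (add_zero _)
      | 1 =>
        refine (map_add (ZHom.toLin p') _ _).trans ?_
        exact (congrArg₂ (· + ·) (h4 _) (h2 _)).trans (zero_add _)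
    · exact (hd _).trans (h3 n)

theorem IsSummand.of_iso {M N N' : ZObj r} (h : M.IsSummand N) (e : N ≅ N') : M.IsSummand N' := by
  obtain ⟨M', ⟨e'⟩⟩ := h
  exact ⟨M', ⟨e' ≪≫ e⟩⟩

end ZObj

namespace BimodObj

variable {n : ℕ} {M : Fin n → BimodObj k V W}

omit [Group W] in
theorem sum_inj (m : ∀ i, (M i).carrier) :
    (∑ i, (show ∀ i, (M i).carrier from BimodHom.toLin (inj M i) (m i))) = m :=
  Finset.univ_sum_single m

omit [Group W] in
/-- Being a direct summand in terms of maps. -/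
theorem isSummand_iff {M N : BimodObj k V W} : M.IsSummand N ↔
    ∃ (M' : BimodObj k V W) (i : M ⟶ N) (p : N ⟶ M) (i' : M' ⟶ N) (p' : N ⟶ M'),
      (∀ m, BimodHom.toLin p (BimodHom.toLin i m) = m) ∧
      (∀ m, BimodHom.toLin p' (BimodHom.toLin i' m) = m) ∧
      ∀ n, BimodHom.toLin i (BimodHom.toLin p n) + BimodHom.toLin i' (BimodHom.toLin p' n) = n := by
  constructor
  · rintro ⟨M', ⟨e⟩⟩
    refine ⟨M', inj ![M, M'] 0 ≫ e.hom, e.inv ≫ proj ![M, M'] 0, inj ![M, M'] 1 ≫ e.hom,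
      e.inv ≫ proj ![M, M'] 1, fun m => ?_, fun m => ?_, fun n => ?_⟩
    · refine (congrArg (BimodHom.toLin (proj ![M, M'] 0)) (BimodHom.hom_inv_apply e _)).trans ?_
      exact Pi.single_eq_same (M := fun i => (![M, M'] i).carrier) 0 m
    · refine (congrArg (BimodHom.toLin (proj ![M, M'] 1)) (BimodHom.hom_inv_apply e _)).trans ?_
      exact Pi.single_eq_same (M := fun i => (![M, M'] i).carrier) 1 m
    · have h := sum_inj (M := ![M, M']) (BimodHom.toLin e.inv n)
      rw [Fin.sum_univ_two] at h
      refine (map_add (BimodHom.toLin e.hom) _ _).symm.trans ?_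
      exact (congrArg (BimodHom.toLin e.hom) h).trans (BimodHom.inv_hom_apply e n)
  · rintro ⟨M', i, p, i', p', h1, h2, h3⟩
    have h4 : ∀ m, BimodHom.toLin p' (BimodHom.toLin i m) = 0 := fun m => by
      have h := congrArg (BimodHom.toLin p') (h3 (BimodHom.toLin i m))
      rw [map_add, h2, h1] at h
      exact left_eq_add.mp (by rwa [eq_comm, add_comm])
    have h5 : ∀ m, BimodHom.toLin p (BimodHom.toLin i' m) = 0 := fun m => by
      have h := congrArg (BimodHom.toLin p) (h3 (BimodHom.toLin i' m))
      rw [map_add, h2, h1] at h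
      exact left_eq_add.mp h.symm
    let f : ∀ j, ![M, M'] j ⟶ N := fun j => match j with
      | 0 => i
      | 1 => i'
    let g : ∀ j, N ⟶ ![M, M'] j := fun j => match j with
      | 0 => p
      | 1 => p'
    have hd : ∀ m, BimodHom.toLin (desc f) m =
        BimodHom.toLin i (m 0) + BimodHom.toLin i' (m 1) := fun m =>
      (desc_apply f m).trans (Fin.sum_univ_two _)
    refine ⟨M', ⟨⟨desc f, lift g, BimodHom.ext (LinearMap.ext fun m => ?_),
      BimodHom.ext (LinearMap.ext fun n => ?_)⟩⟩⟩
    · refine (congrArg (BimodHom.toLin (lift g)) (hd m)).trans (funext fun j => ?_)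
      match j with
      | 0 =>
        refine (map_add (BimodHom.toLin p) _ _).trans ?_
        exact (congrArg₂ (· + ·) (h1 _) (h5 _)).trans (add_zero _)
      | 1 =>
        refine (map_add (BimodHom.toLin p') _ _).trans ?_
        exact (congrArg₂ (· + ·) (h4 _) (h2 _)).trans (zero_add _)
    · exact (hd _).trans (h3 n)

omit [Group W] in
theorem IsSummand.of_iso {M N N' : BimodObj k V W} (h : M.IsSummand N) (e : N ≅ N') :
    M.IsSummand N' := by
  obtain ⟨M', ⟨e'⟩⟩ := h
  exact ⟨M', ⟨e' ≪≫ e⟩⟩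

end BimodObj

/-- `F` commutes with finite direct sums. -/
def functorFDirectSum {n : ℕ} (M : Fin n → ZObj r) : (functorF r).obj (ZObj.directSum M) ≅
    BimodObj.directSum fun i => (functorF r).obj (M i) where
  hom := BimodObj.lift fun i => (functorF r).map (ZObj.proj M i)
  inv := BimodObj.desc fun i => (functorF r).map (ZObj.inj M i)
  hom_inv_id := BimodHom.ext (LinearMap.ext fun m =>
    (BimodObj.desc_apply (fun i => (functorF r).map (ZObj.inj M i)) _).trans
      (ZObj.sum_inj (M := M) m))
  inv_hom_id := BimodHom.ext (LinearMap.ext fun m =>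
    (congrArg (BimodHom.toLin (BimodObj.lift fun i => (functorF r).map (ZObj.proj M i)))
    (BimodObj.desc_apply (fun i => (functorF r).map (ZObj.inj M i)) m)).trans
      (ZObj.sum_inj (M := M) m))

theorem ZObj.IsSummand.map_functorF {M N : ZObj r} (h : M.IsSummand N) :
    ((functorF r).obj M).IsSummand ((functorF r).obj N) := by
  obtain ⟨M', i, p, i', p', h1, h2, h3⟩ := ZObj.isSummand_iff.mp h
  exact BimodObj.isSummand_iff.mpr ⟨(functorF r).obj M', (functorF r).map i, (functorF r).map p,
    (functorF r).map i', (functorF r).map p', h1, h2, h3⟩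

theorem ZObj.shift_shift (M : ZObj r) (l n : ℤ) : (M.shift l).shift n = M.shift (l + n) := by
  simp only [ZObj.shift, add_assoc]
  rfl

theorem IsRightFlat.of_isSummand {M N : ZObj r} (h : M.IsSummand N)
    (hN : IsRightFlat k V N.carrier) : IsRightFlat k V M.carrier := by
  obtain ⟨-, i, p, -, -, h1, -, -⟩ := ZObj.isSummand_iff.mp h
  exact hN.of_retract (ZHom.toBimod i) (ZHom.toBimod p) h1

theorem IsZModF.of_isSummand {M N : ZObj r} (h : M.IsSummand N) (hN : IsZModF N) : IsZModF M := by
  obtain ⟨-, i, p, -, -, h1, -, -⟩ := ZObj.isSummand_iff.mp h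
  exact hN.of_retract i p (ZHom.ext (LinearMap.ext h1))

end Summand

end MomentGraph

end

noncomputable section

namespace MomentGraph

/-! ## The equivalence -/

section Equivalence

variable {k : Type u} [CommRing k] {W : Type u} [Group W] {B : Type v} {C : CoxeterMatrix B}
  {cs : CoxeterSystem C W} {V : Type u} [AddCommGroup V] [Module k V] {r : Realization k cs V}
  [IsDomain k] [Module.Free k V]
  (hα : ∀ i, Function.Surjective fun f : Module.Dual k V => f (r.α i)) (hGKM : r.GKM)

theorem Realization.BS_iso_LBS (x : List B) (n : ℤ) :
    Nonempty (r.BS x n ≅ (functorF r).obj ((Realization.LBS hα hGKM x).shift (x.length + n))) := by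
  obtain ⟨e⟩ := Realization.foldr_tensor_iso hα hGKM x
  rw [← ZObj.shift_shift]
  exact ⟨BimodObj.shiftIso e n⟩

theorem ZObj.BS_iso_LBS (x : List B) (n : ℤ) :
    Nonempty (ZObj.BS r x n ≅ (Realization.LBS hα hGKM x.reverse).shift n) := by
  obtain ⟨e⟩ := Realization.foldr_induce_iso_LBS hα hGKM x
  exact ⟨ZObj.shiftIso e n⟩

/-- Finite direct sums of shifts of the modules `LBS`. -/
def Realization.sumLBS {m : ℕ} (x : Fin m → List B) (n : Fin m → ℤ) : ZObj r :=
  ZObj.directSum fun j => (Realization.LBS hα hGKM (x j)).shift (n j)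

theorem Realization.isZModF_sumLBS {m : ℕ} (x : Fin m → List B) (n : Fin m → ℤ) :
    IsZModF (Realization.sumLBS hα hGKM x n) :=
  IsZModF.directSum fun j => (Realization.isZModF_LBS hα hGKM (x j)).shift (n j)

theorem Realization.isRightFlat_sumLBS {m : ℕ} (x : Fin m → List B) (n : Fin m → ℤ) :
    IsRightFlat k V (Realization.sumLBS hα hGKM x n).carrier := by
  have h := IsRightFlat.pi fun j => Realization.isRightFlat_LBS hα hGKM (x j)
  let e : (Realization.sumLBS hα hGKM x n).carrier ≃ₗ[Env k V]
      ∀ j, (Realization.LBS hα hGKM (x j)).carrier :=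
    { AddEquiv.refl (∀ j, (Realization.LBS hα hGKM (x j)).carrier) with
      map_smul' := fun _ _ => rfl }
  exact h.of_retract e.toLinearMap e.symm.toLinearMap fun _ => rfl

/-- The images under `F` of the sums of modules `LBS` are sums of Bott–Samelson bimodules. -/
theorem Realization.functorF_sumLBS_iso {m : ℕ} (x : Fin m → List B) (n : Fin m → ℤ) :
    Nonempty ((functorF r).obj (Realization.sumLBS hα hGKM x n) ≅
      BimodObj.directSum fun j => r.BS (x j) (n j - (x j).length)) := by
  have h : ∀ j, Nonempty ((functorF r).obj ((Realization.LBS hα hGKM (x j)).shift (n j)) ≅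
      r.BS (x j) (n j - (x j).length)) := fun j => by
    obtain ⟨e⟩ := Realization.BS_iso_LBS hα hGKM (x j) (n j - (x j).length)
    rw [add_sub_cancel] at e
    exact ⟨e.symm⟩
  exact ⟨functorFDirectSum _ ≪≫ BimodObj.directSumIso fun j => (h j).some⟩

theorem Realization.sumLBS_iso {m : ℕ} (x : Fin m → List B) (n : Fin m → ℤ) :
    Nonempty ((ZObj.directSum fun j => ZObj.BS r (x j) (n j)) ≅
      Realization.sumLBS hα hGKM (fun j => (x j).reverse) n) :=
  ⟨ZObj.directSumIso fun j => (ZObj.BS_iso_LBS hα hGKM (x j) (n j)).some⟩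

include hα hGKM in
theorem IsZSoergel.isRightFlat {M : ZObj r} (hM : IsZSoergel r M) : IsRightFlat k V M.carrier := by
  obtain ⟨-, m, x, n, h⟩ := hM
  exact (Realization.isRightFlat_sumLBS hα hGKM _ n).of_isSummand
    (h.of_iso (Realization.sumLBS_iso hα hGKM x n).some)

include hα hGKM in
/-- `F` maps the direct summands of Bott–Samelson modules to Soergel bimodules. -/
theorem IsZSoergel.isSoergelBimod {M : ZObj r} (hM : IsZSoergel r M) :
    IsSoergelBimod r ((functorF r).obj M) := by
  have hflat := hM.isRightFlat hα hGKM
  obtain ⟨hM, m, x, n, h⟩ := hM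
  refine ⟨⟨hM.isCPrime hGKM, hflat.env_finite, hflat.flat⟩, m, fun j => (x j).reverse,
    fun j => n j - (x j).reverse.length, ?_⟩
  exact ((h.of_iso (Realization.sumLBS_iso hα hGKM x n).some).map_functorF).of_iso
    (Realization.functorF_sumLBS_iso hα hGKM _ n).some

include hGKM in
/-- Morphisms of bimodules between images of `F` are linear over the structure algebra. -/
theorem BimodHom.map_Z_smul {M N : ZObj r} (hM : IsZModF M) (hN : RightTorsionFree k V N.carrier)
    (f : (functorF r).obj M ⟶ (functorF r).obj N) (z : r.Z) (m : M.carrier) :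
    (show N.carrier from BimodHom.toLin f (z • m : M.carrier)) =
      z • (show N.carrier from BimodHom.toLin f m) := by
  let φ : M.carrier →ₗ[Env k V] N.carrier := BimodHom.toLin f
  change φ (z • m) = z • φ m
  obtain ⟨I, hI⟩ := hM.factors
  obtain ⟨g, hg, hdec⟩ := M.exists_eigen_decomposition hGKM I hI
  obtain ⟨n, hn, hsum⟩ := hdec m
  -- `φ` preserves the component at `w`, where `z` acts on both sides as left multiplication by
  -- `z_w`.
  have heig : ∀ w, φ (z • n w) = z • φ (n w) := by
    intro w
    have h1 := BimodHom.map_comp f w _ (M.toLocQ_mem_comp w (n w) (hn w))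
    have h2 : toLocQ N.carrier (φ (n w)) ∈ N.comp w := locQMap_toLocQ φ (n w) ▸ h1
    rw [(ZObj.toLocQ_mem_comp_iff hN w _).mp h2 z, hn w z, ← M.left_smul, ← N.left_smul, map_smul]
  -- It suffices to compare after right multiplication by `g`, where `m` becomes a sum of
  -- eigenvectors.
  rw [← sub_eq_zero]
  refine hN g hg _ ?_
  rw [smul_sub, ← map_smul, M.right_smul, N.right_smul, smul_comm _ z (φ m), ← N.right_smul,
    ← map_smul, M.right_smul, smul_comm _ z m, hsum, Finset.smul_sum, map_sum, map_sum,
    Finset.smul_sum, sub_eq_zero]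
  exact Finset.sum_congr rfl fun w _ => heig w

/-- The module structure on a retract whose idempotent is linear. -/
abbrev retractModule {Z N P : Type*} [CommRing Z] [AddCommGroup N] [AddCommGroup P] [Module Z P]
    (i : N →+ P) (p : P →+ N) (h : ∀ n, p (i n) = n)
    (hc : ∀ (z : Z) x, i (p (z • x)) = z • i (p x)) : Module Z N where
  smul z n := p (z • i n)
  one_smul n := by
    change p ((1 : Z) • i n) = n
    rw [one_smul, h]
  mul_smul y z n := by
    change p ((y * z) • i n) = p (y • i (p (z • i n)))
    rw [hc, h, mul_smul]
  smul_zero z := by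
    change p (z • i 0) = 0
    rw [map_zero, smul_zero, map_zero]
  smul_add z x y := by
    change p (z • i (x + y)) = p (z • i x) + p (z • i y)
    rw [map_add, smul_add, map_add]
  add_smul y z x := by
    change p ((y + z) • i x) = p (y • i x) + p (z • i x)
    rw [add_smul, map_add]
  zero_smul x := by
    change p ((0 : Z) • i x) = 0
    rw [zero_smul, map_zero]

/-- A graded bimodule with an action of the structure algebra as a `Z`-module. -/
def BimodObj.toZObj (N : BimodObj k V W) (h : Module r.Z N.carrier) : ZObj r where
  carrier := N.carrier
  gr := N.gr

/-- Retracts of images of `F` come from `Z`-modules. -/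
theorem exists_retract_lift {P : ZObj r} (hP : IsZModF P)
    (hP' : RightTorsionFree k V P.carrier) (hGKM : r.GKM) {N : BimodObj k V W}
    (i : N ⟶ (functorF r).obj P) (p : (functorF r).obj P ⟶ N)
    (h : ∀ n, BimodHom.toLin p (BimodHom.toLin i n) = n) :
    ∃ (M : ZObj r) (i' : M ⟶ P) (p' : P ⟶ M) (_ : (functorF r).obj M ≅ N),
      (∀ n, ZHom.toLin p' (ZHom.toLin i' n) = n) ∧
      ∀ x, ZHom.toLin i' (ZHom.toLin p' x) = BimodHom.toLin i (BimodHom.toLin p x) := by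
  let i₀ : N.carrier →+ P.carrier := (BimodHom.toLin i).toAddMonoidHom
  let p₀ : P.carrier →+ N.carrier := (BimodHom.toLin p).toAddMonoidHom
  have h₀ : ∀ n, p₀ (i₀ n) = n := h
  -- The idempotent `i p` is an endomorphism of `F(P)` and is therefore `Z`-linear.
  have hc : ∀ (z : r.Z) x, i₀ (p₀ (z • x)) = z • i₀ (p₀ x) := fun z x =>
    BimodHom.map_Z_smul hGKM hP hP' (p ≫ i) z x
  let M : ZObj r := N.toZObj (retractModule i₀ p₀ h₀ hc)
  let i' : M ⟶ P :=
    { toLin :=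
        { toFun := i₀
          map_add' := map_add i₀
          map_smul' := fun z (n : N.carrier) => by
            change i₀ (p₀ (z • i₀ n)) = z • i₀ n
            rw [hc, h₀] }
      map_gr := BimodHom.map_gr i }
  let p' : P ⟶ M :=
    { toLin :=
        { toFun := p₀
          map_add' := map_add p₀
          map_smul' := fun z x => by
            change p₀ (z • x) = p₀ (z • i₀ (p₀ x))
            rw [← hc, h₀] }
      map_gr := BimodHom.map_gr p }
  refine ⟨M, i', p', ⟨(functorF r).map i' ≫ p, i ≫ (functorF r).map p',
    BimodHom.ext (LinearMap.ext fun n => ?_), BimodHom.ext (LinearMap.ext fun n => ?_)⟩,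
    h₀, fun _ => rfl⟩
  · exact (congrArg (fun n => p₀ (i₀ n)) (h₀ n)).trans (h₀ n)
  · exact (congrArg (fun n => p₀ (i₀ n)) (h₀ n)).trans (h₀ n)

include hα hGKM in
/-- Every Soergel bimodule is in the image of `F`. -/
theorem IsSoergelBimod.exists_iso {N : BimodObj k V W} (hN : IsSoergelBimod r N) :
    ∃ M : ZObj r, IsZSoergel r M ∧ Nonempty ((functorF r).obj M ≅ N) := by
  obtain ⟨-, m, x, n, hN⟩ := hN
  -- The length is added here to cancel the one subtracted on the bimodule side.
  obtain ⟨e⟩ := Realization.functorF_sumLBS_iso hα hGKM x fun j => (x j).length + n j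
  simp only [add_sub_cancel_left] at e
  let P := Realization.sumLBS hα hGKM x fun j => (x j).length + n j
  have hP : IsZModF P := Realization.isZModF_sumLBS hα hGKM x _
  have hP' : RightTorsionFree k V P.carrier :=
    rightTorsionFree_of_flat (Realization.isRightFlat_sumLBS hα hGKM x _).flat
  obtain ⟨N', i, p, i', p', h1, h2, h3⟩ := BimodObj.isSummand_iff.mp (hN.of_iso e.symm)
  obtain ⟨M, ι, π, ε, hM, hM'⟩ := exists_retract_lift hP hP' hGKM i p h1
  -- A direct summand comes with a complement, so the complementary idempotent is lifted too.
  obtain ⟨M', ι', π', -, hM1, hM1'⟩ := exists_retract_lift hP hP' hGKM i' p' h2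
  have hsum : M.IsSummand P := ZObj.isSummand_iff.mpr ⟨M', ι, π, ι', π', hM, hM1, fun x => by
    rw [hM', hM1']
    exact h3 x⟩
  obtain ⟨e'⟩ := Realization.sumLBS_iso hα hGKM (fun j => (x j).reverse)
    fun j => (x j).length + n j
  simp only [List.reverse_reverse] at e'
  exact ⟨M, ⟨hP.of_isSummand hsum, m, _, _, hsum.of_iso e'.symm⟩, ⟨ε⟩⟩

instance : (functorF r).Faithful where
  map_injective {_ _} _ _ h := ZHom.ext (LinearMap.ext fun m =>
    LinearMap.congr_fun (congrArg BimodHom.toLin h) m)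

-- The target is a summand of a sum of modules `Realization.LBS`, hence flat and torsion free on the
-- right, so a bimodule map into it is `Z`-linear.
include hα hGKM in
theorem functorF_full : ((IsZSoergel r).ι ⋙ functorF r).Full where
  map_surjective {X Y} f := by
    have hY : RightTorsionFree k V Y.obj.carrier :=
      rightTorsionFree_of_flat (Y.property.isRightFlat hα hGKM).flat
    let g : X.obj ⟶ Y.obj :=
      { toLin :=
          { toFun := BimodHom.toLin f
            map_add' := map_add (BimodHom.toLin f)
            map_smul' := BimodHom.map_Z_smul hGKM X.property.1 hY f }
        map_gr := BimodHom.map_gr f }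
    exact ⟨ObjectProperty.homMk g, rfl⟩

end Equivalence

end MomentGraph

end

theorem mainTheorem8 {k : Type u} [CommRing k] [IsDomain k] [IsNoetherianRing k]
    {W : Type u} [Group W] {B : Type v} [Finite B] {C : CoxeterMatrix B} (cs : CoxeterSystem C W)
    {V : Type u} [AddCommGroup V] [Module k V] [Module.Free k V] [Module.Finite k V]
    (r : MomentGraph.Realization k cs V)
    (hα : ∀ i, Function.Surjective fun f : Module.Dual k V => f (r.α i))
    (hGKM : r.GKM) :
    (∀ M : MomentGraph.ZObj r, MomentGraph.IsZModF M →
      MomentGraph.IsCPrime r ((MomentGraph.functorF r).obj M)) ∧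
    ∃ h : ∀ M : (MomentGraph.IsZSoergel r).FullSubcategory,
        MomentGraph.IsSoergelBimod r ((MomentGraph.functorF r).obj M.obj),
      ((MomentGraph.IsSoergelBimod r).lift
        ((MomentGraph.IsZSoergel r).ι ⋙ MomentGraph.functorF r) h).IsEquivalence := by
  have hfull := MomentGraph.functorF_full hα hGKM
  refine ⟨fun M hM => hM.isCPrime hGKM,
    fun M => MomentGraph.IsZSoergel.isSoergelBimod hα hGKM M.property, ?_⟩
  refine { faithful := inferInstance, full := inferInstance, essSurj := ⟨fun N => ?_⟩ }
  obtain ⟨M, hM, ⟨e⟩⟩ := MomentGraph.IsSoergelBimod.exists_iso hα hGKM N.property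
  exact ⟨⟨M, hM⟩, ⟨ObjectProperty.isoMk _ e⟩⟩
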